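/- **Conventions.** A *complete bornological algebra* is a (not necessarily unital) associative complex algebra $A$ with a convex bornology (small sets are closed under subsets, finite unions, sums and absolutely convex hulls, and points are small), such that the multiplication is bounded and each small set is contained in a small completant disk (an absolutely convex set whose span, normed with it as unit ball, is a Banach space). Bounded homomorphisms are algebra homomorphisms that map small sets to small sets. The completion of a convex bornological space is the separated inductive limit of the Hausdorff completions of the seminormed spans of its small disks; $\hat\otimes$ is the completion of the algebraic tensor product with the bornology generated by the sets $S\otimes T$ with $S,T$ small. $N$ is *a-nilpotent* if $\bigcup_{n\ge1}S^n$ is small for each small $S\subseteq N$. An *extension* of complete bornological algebras $K\rightarrowtail E\twoheadrightarrow Q$ consists of bounded homomorphisms such that $K\to E$ is a bornological isomorphism onto $\ker(E\to Q)$ and $E\to Q$ is a bornological quotient map; it is *allowable* if $E\to Q$ has a bounded linear section, and an *a-nilpotent extension* of $Q$ if it is allowable and $K$ is a-nilpotent. Let $\Omega A$ be the (non-unital) algebra of noncommutative differential forms over $A$, with the convex bornology generated by the sets $\{a_0\,da_1\cdots da_n : n\ge0\}\cup\{da_1\cdots da_n : n\ge1\}$, where all $a_i\in S$, for small $S\subseteq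 A$. The *analytic tensor algebra* $\mathcal TA$ is the even part of the completion of $\Omega A$, with the extension of the Fedosov product $x\odot y=xy-(-1)^{\deg x}dx\,dy$. Let $\tau_A\colon\mathcal TA\to A$ be the projection to forms of degree $0$, and $\mathcal JA=\ker\tau_A$. The algebra $R$ is *a-quasi-free* if $\tau_R$ has a bounded homomorphism as a section. A *universal a-nilpotent extension* of $A$ is an a-nilpotent extension $N\rightarrowtail R\twoheadrightarrow A$ with a-quasi-free $R$. A *morphism of extensions* is a triple $(\xi,\psi,\phi)$ of bounded homomorphisms (on kernels, middle terms and quotients) with commuting squares. Let $\mathcal P$ be $C^\infty([0,1])$ with its bounded (Fréchet) bornology, or $AC([0,1])$, the completion of $C^\infty([0,1])$ for the norm $|f(0)|+\int_0^1|f'|$. A *smooth* (respectively, *absolutely continuous*) *homotopy* between bounded homomorphisms $A\to B$ is a bounded homomorphism $A\to\mathcal P\hat\otimes B$ whose evaluations at $0$ and $1$ are the given homomorphisms. A *homotopy* between morphisms of extensions from $K_0\rightarrowtail E_0\twoheadrightarrow Q_0$ to $K_1\rightarrowtail E_1\twoheadrightarrow Q_1$ is a morphism $(\Xi,\Psi,\Phi)$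 into $\mathcal P\hat\otimes K_1\rightarrowtail\mathcal P\hat\otimes E_1\twoheadrightarrow\mathcal P\hat\otimes Q_1$ whose evaluations at $0$ and $1$ are the given morphisms. It is *relative to $\phi$* if $\Phi_t=\phi$ for all $t\in[0,1]$, and *relative to $A$* if $Q_0=Q_1=A$ and $\Phi_t=\mathrm{id}_A$ for all $t$. A morphism $(\xi,\psi,\mathrm{id}_A)$ is a *smooth homotopy equivalence relative to $A$* if there is a morphism $(\xi',\psi',\mathrm{id}_A)$ in the opposite direction such that both composites are smoothly homotopic to the identity relative to $A$. **Theorem.** Let $A$ be a complete bornological algebra. 1. $\mathcal JA\rightarrowtail\mathcal TA\twoheadrightarrow A$ is a universal a-nilpotent extension of $A$. 2. Any universal a-nilpotent extension $N\rightarrowtail R\twoheadrightarrow A$ is smoothly homotopy equivalent relative to $A$ to $\mathcal JA\rightarrowtail\mathcal TA\twoheadrightarrow A$. In particular, $R$ is smoothly homotopy equivalent to $\mathcal TA$, and $N$ is smoothly homotopy equivalent to $\mathcal JA$. 3. Any morphism of extensions $(\xi,\psi,\mathrm{id}_A)$ between two universal a-nilpotent extensions of $A$ is a smooth homotopy equivalence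 relative to $A$, and any two such morphisms with the same source and target are smoothly homotopic relative to $A$. 4. (Universal Extension Theorem) Let $N\rightarrowtail R\twoheadrightarrow A$ be a universal a-nilpotent extension, let $K\rightarrowtail E\twoheadrightarrow Q$ be an a-nilpotent extension of a complete bornological algebra $Q$, and let $\phi\colon A\to Q$ be a bounded homomorphism. Then there is a morphism of extensions $(\xi,\psi,\phi)$ from the first to the second that lifts $\phi$, and it is unique up to smooth homotopy relative to $\phi$. More generally, if $(\xi_t,\psi_t,\phi_t)$, $t=0,1$, are two morphisms between these extensions and $\Phi\colon A\to C^\infty([0,1])\hat\otimes Q$ is a smooth homotopy between $\phi_0$ and $\phi_1$, then $\Phi$ lifts to a smooth homotopy $(\Xi,\Psi,\Phi)$ between $(\xi_0,\psi_0,\phi_0)$ and $(\xi_1,\psi_1,\phi_1)$. The analogous statements hold for absolutely continuous homotopies. -/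

import Mathlib

open Bornology Set
open scoped Pointwise TensorProduct

universe u v w u₁ v₁ w₁ u₂ v₂ w₂

namespace BornologicalAlgebra

/-! ### Disks, convex bornologies, completeness -/

set_option linter.unusedSectionVars false

section Basic

variable {V : Type*} [AddCommGroup V] [Module ℂ V] {W : Type*} [AddCommGroup W] [Module ℂ W]

/-- A disk is a circled convex (that is, absolutely convex) subset. -/
def IsDisk (S : Set V) : Prop :=
  ∀ ⦃x⦄, x ∈ S → ∀ ⦃y⦄, y ∈ S → ∀ a b : ℂ, ‖a‖ + ‖b‖ ≤ 1 → a • x + b • y ∈ S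

/-- The disked hull, the smallest disk that contains `S`. -/
def diskHull (S : Set V) : Set V := ⋂₀ {D | IsDisk D ∧ S ⊆ D}

/-- Convergence `x n → y` for the seminorm with unit ball `S` (for a disk `S`). -/
def LimIn (S : Set V) (x : ℕ → V) (y : V) : Prop :=
  ∀ ε : ℝ, 0 < ε → ∃ N, ∀ n, N ≤ n → x n - y ∈ (ε : ℂ) • S

/-- The Cauchy condition for the seminorm with unit ball `S` (for a disk `S`). -/
def CauchyIn (S : Set V) (x : ℕ → V) : Prop :=
  ∀ ε : ℝ, 0 < ε → ∃ N, ∀ m, N ≤ m → ∀ n, N ≤ n → x m - x n ∈ (ε : ℂ) • S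

/-- A completant disk: the linear span of `S`, with the seminorm whose unit ball is `S`, is a
normed space (first condition on `S`) and complete (second condition). -/
def IsCompletantDisk (S : Set V) : Prop :=
  IsDisk S ∧ (∀ x : V, (∀ ε : ℝ, 0 < ε → x ∈ (ε : ℂ) • S) → x = 0) ∧
    ∀ x : ℕ → V, CauchyIn S x → ∃ y, LimIn S x y

variable (V) in
/-- A convex bornological vector space; the sets with `Bornology.IsBounded` are the small sets.
(Mathlib's `Bornology` provides: points are small, subsets and finite unions of small sets are
small.) -/
class ConvexBornology [Bornology V] : Prop where
  isBounded_add : ∀ S T : Set V, IsBounded S → IsBounded T → IsBounded (S + T)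
  isBounded_diskHull : ∀ S : Set V, IsBounded S → IsBounded (diskHull S)

variable (V) in
/-- A complete bornological vector space: each small set lies in a small completant disk. -/
class CompleteBornology [Bornology V] : Prop where
  exists_completant : ∀ S : Set V, IsBounded S →
    ∃ T : Set V, IsBounded T ∧ IsCompletantDisk T ∧ S ⊆ T

/-- A bounded map sends small sets to small sets. -/
def IsBoundedMap {X Y : Type*} [Bornology X] [Bornology Y] (f : X → Y) : Prop :=
  ∀ S : Set X, IsBounded S → IsBounded (f '' S)

/-- Bornological convergence of a sequence. -/
def BornTendsto [Bornology V] (x : ℕ → V) (y : V) : Prop :=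
  ∃ S : Set V, IsBounded S ∧ IsDisk S ∧ LimIn S x y

/-- Bornologically closed sets. -/
def IsBornClosed [Bornology V] (W : Set V) : Prop :=
  ∀ (x : ℕ → V) (y : V), (∀ n, x n ∈ W) → BornTendsto x y → y ∈ W

theorem subset_diskHull (S : Set V) : S ⊆ diskHull S :=
  subset_sInter fun _ h => h.2

theorem isDisk_diskHull (S : Set V) : IsDisk (diskHull S) := by
  intro x hx y hy a b hab D hD
  exact hD.1 (hx D hD) (hy D hD) a b hab

theorem diskHull_subset {S D : Set V} (hD : IsDisk D) (h : S ⊆ D) : diskHull S ⊆ D :=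
  sInter_subset_of_mem ⟨hD, h⟩

theorem IsDisk.smul_mem {S : Set V} (hS : IsDisk S) {x : V} (hx : x ∈ S) {a : ℂ} (ha : ‖a‖ ≤ 1) :
    a • x ∈ S := by
  simpa using hS hx hx a 0 (by simpa using ha)

theorem IsDisk.neg_mem {S : Set V} (hS : IsDisk S) {x : V} (hx : x ∈ S) : -x ∈ S := by
  simpa using hS.smul_mem hx (a := -1) (by simp)

theorem IsDisk.zero_mem {S : Set V} (hS : IsDisk S) {x : V} (hx : x ∈ S) : (0 : V) ∈ S := by
  simpa using hS.smul_mem hx (a := 0) (by simp)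

theorem IsDisk.smul {S : Set V} (hS : IsDisk S) (c : ℂ) : IsDisk (c • S) := by
  rintro _ ⟨x, hx, rfl⟩ _ ⟨y, hy, rfl⟩ a b hab
  exact ⟨a • x + b • y, hS hx hy a b hab, by simp [smul_smul, mul_comm]⟩

theorem IsDisk.preimage {D : Set W} (hD : IsDisk D) (l : V →ₗ[ℂ] W) : IsDisk (l ⁻¹' D) := by
  intro x hx y hy a b hab
  simpa using hD hx hy a b hab

theorem IsDisk.image {D : Set V} (hD : IsDisk D) (l : V →ₗ[ℂ] W) : IsDisk (l '' D) := by
  rintro _ ⟨x, hx, rfl⟩ _ ⟨y, hy, rfl⟩ a b hab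
  exact ⟨_, hD hx hy a b hab, by simp⟩

theorem image_diskHull_subset (l : V →ₗ[ℂ] W) (S : Set V) :
    l '' diskHull S ⊆ diskHull (l '' S) := by
  rw [image_subset_iff]
  exact diskHull_subset ((isDisk_diskHull _).preimage l)
    (image_subset_iff.1 (subset_diskHull _))

theorem diskHull_mono {S T : Set V} (h : S ⊆ T) : diskHull S ⊆ diskHull T :=
  diskHull_subset (isDisk_diskHull _) (h.trans (subset_diskHull _))

theorem IsDisk.smul_subset {S : Set V} (hS : IsDisk S) {a b : ℂ} (h : ‖a‖ ≤ ‖b‖) :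
    a • S ⊆ b • S := by
  rintro _ ⟨x, hx, rfl⟩
  by_cases hb : b = 0
  · subst hb
    have : a = 0 := by simpa using h
    subst this
    exact ⟨x, hx, by simp⟩
  · refine ⟨(b⁻¹ * a) • x, hS.smul_mem hx ?_, by simp [smul_smul, hb]⟩
    rw [norm_mul, norm_inv, inv_mul_le_iff₀ (norm_pos_iff.2 hb)]
    simpa using h

theorem IsDisk.mono {S : Set V} (hS : IsDisk S) {a b : ℝ} (ha : 0 ≤ a) (h : a ≤ b) :
    (a : ℂ) • S ⊆ (b : ℂ) • S :=
  hS.smul_subset (by simpa [abs_of_nonneg ha, abs_of_nonneg (ha.trans h)] using h)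

theorem IsDisk.add_mem {S : Set V} (hS : IsDisk S) {a b : ℝ} (ha : 0 < a) (hb : 0 < b) {x y : V}
    (hx : x ∈ (a : ℂ) • S) (hy : y ∈ (b : ℂ) • S) : x + y ∈ ((a + b : ℝ) : ℂ) • S := by
  obtain ⟨x, hx, rfl⟩ := hx
  obtain ⟨y, hy, rfl⟩ := hy
  have hab : (0 : ℝ) < a + b := by positivity
  have hab' : ((a + b : ℝ) : ℂ) ≠ 0 := by exact_mod_cast hab.ne'
  refine ⟨((a / (a + b) : ℝ) : ℂ) • x + ((b / (a + b) : ℝ) : ℂ) • y, hS hx hy _ _ ?_, ?_⟩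
  · rw [Complex.norm_real, Complex.norm_real, Real.norm_of_nonneg (by positivity),
      Real.norm_of_nonneg (by positivity), ← add_div, div_self hab.ne']
  · have h1 : ((a + b : ℝ) : ℂ) * ((a / (a + b) : ℝ) : ℂ) = a := by
      rw [← Complex.ofReal_mul]; congr 1; field_simp
    have h2 : ((a + b : ℝ) : ℂ) * ((b / (a + b) : ℝ) : ℂ) = b := by
      rw [← Complex.ofReal_mul]; congr 1; field_simp
    simp only [smul_add, smul_smul, h1, h2]

theorem IsDisk.neg_mem_smul {S : Set V} (hS : IsDisk S) {a : ℂ} {x : V} (hx : x ∈ a • S) :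
    -x ∈ a • S :=
  (hS.smul a).neg_mem hx

theorem IsDisk.sub_mem {S : Set V} (hS : IsDisk S) {a b : ℝ} (ha : 0 < a) (hb : 0 < b) {x y : V}
    (hx : x ∈ (a : ℂ) • S) (hy : y ∈ (b : ℂ) • S) : x - y ∈ ((a + b : ℝ) : ℂ) • S := by
  rw [sub_eq_add_neg]
  exact hS.add_mem ha hb hx (hS.neg_mem_smul hy)

theorem smul_smul_mem {S : Set V} {c : ℂ} {x : V} (hx : x ∈ S) : c • x ∈ c • S := ⟨x, hx, rfl⟩

theorem LimIn.mono {S T : Set V} (h : S ⊆ T) {x : ℕ → V} {y : V} (hx : LimIn S x y) :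
    LimIn T x y := fun ε hε => by
  obtain ⟨N, hN⟩ := hx ε hε
  exact ⟨N, fun n hn => smul_set_mono h (hN n hn)⟩

theorem CauchyIn.mono {S T : Set V} (h : S ⊆ T) {x : ℕ → V} (hx : CauchyIn S x) :
    CauchyIn T x := fun ε hε => by
  obtain ⟨N, hN⟩ := hx ε hε
  exact ⟨N, fun m hm n hn => smul_set_mono h (hN m hm n hn)⟩

theorem LimIn.add {S : Set V} (hS : IsDisk S) {x x' : ℕ → V} {y y' : V} (h : LimIn S x y)
    (h' : LimIn S x' y') : LimIn S (x + x') (y + y') := fun ε hε => by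
  obtain ⟨N, hN⟩ := h (ε / 2) (by positivity)
  obtain ⟨N', hN'⟩ := h' (ε / 2) (by positivity)
  refine ⟨max N N', fun n hn => ?_⟩
  have := hS.add_mem (by positivity) (by positivity) (hN n (le_trans (le_max_left _ _) hn))
    (hN' n (le_trans (le_max_right _ _) hn))
  rw [add_halves] at this
  convert this using 1
  simp only [Pi.add_apply]; abel

theorem CauchyIn.add {S : Set V} (hS : IsDisk S) {x x' : ℕ → V} (h : CauchyIn S x)
    (h' : CauchyIn S x') : CauchyIn S (x + x') := fun ε hε => by
  obtain ⟨N, hN⟩ := h (ε / 2) (by positivity)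
  obtain ⟨N', hN'⟩ := h' (ε / 2) (by positivity)
  refine ⟨max N N', fun m hm n hn => ?_⟩
  have := hS.add_mem (by positivity) (by positivity)
    (hN m (le_trans (le_max_left _ _) hm) n (le_trans (le_max_left _ _) hn))
    (hN' m (le_trans (le_max_right _ _) hm) n (le_trans (le_max_right _ _) hn))
  rw [add_halves] at this
  convert this using 1
  simp only [Pi.add_apply]; abel

theorem mem_of_smul_aux {S : Set V} (hS : IsDisk S) {x : V} {c : ℂ} {ε : ℝ} (hε : 0 < ε)
    (hx : x ∈ ((ε / (‖c‖ + 1) : ℝ) : ℂ) • S) : c • x ∈ (ε : ℂ) • S := by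
  obtain ⟨x, hx, rfl⟩ := hx
  have : c • (((ε / (‖c‖ + 1) : ℝ) : ℂ) • x) ∈ (c * ((ε / (‖c‖ + 1) : ℝ) : ℂ)) • S :=
    ⟨x, hx, by simp [smul_smul]⟩
  refine hS.smul_subset ?_ this
  rw [norm_mul, Complex.norm_real, Complex.norm_real, Real.norm_of_nonneg (by positivity),
    Real.norm_of_nonneg (by positivity), mul_div_assoc', div_le_iff₀ (by positivity)]
  nlinarith [norm_nonneg c]

theorem LimIn.smul {S : Set V} (hS : IsDisk S) {x : ℕ → V} {y : V} (h : LimIn S x y) (c : ℂ) :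
    LimIn S (c • x) (c • y) := fun ε hε => by
  obtain ⟨N, hN⟩ := h (ε / (‖c‖ + 1)) (by positivity)
  refine ⟨N, fun n hn => ?_⟩
  rw [Pi.smul_apply, ← smul_sub]
  exact mem_of_smul_aux hS hε (hN n hn)

theorem CauchyIn.smul {S : Set V} (hS : IsDisk S) {x : ℕ → V} (h : CauchyIn S x) (c : ℂ) :
    CauchyIn S (c • x) := fun ε hε => by
  obtain ⟨N, hN⟩ := h (ε / (‖c‖ + 1)) (by positivity)
  refine ⟨N, fun m hm n hn => ?_⟩
  rw [Pi.smul_apply, Pi.smul_apply, ← smul_sub]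
  exact mem_of_smul_aux hS hε (hN m hm n hn)

theorem LimIn.map {S : Set V} {x : ℕ → V} {y : V} (h : LimIn S x y) (l : V →ₗ[ℂ] W) :
    LimIn (l '' S) (fun n => l (x n)) (l y) := fun ε hε => by
  obtain ⟨N, hN⟩ := h ε hε
  refine ⟨N, fun n hn => ?_⟩
  obtain ⟨z, hz, h⟩ := hN n hn
  exact ⟨l z, ⟨z, hz, rfl⟩, by simp only at h ⊢; rw [← map_smul, h, map_sub]⟩

theorem CauchyIn.map {S : Set V} {x : ℕ → V} (h : CauchyIn S x) (l : V →ₗ[ℂ] W) :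
    CauchyIn (l '' S) (fun n => l (x n)) := fun ε hε => by
  obtain ⟨N, hN⟩ := h ε hε
  refine ⟨N, fun m hm n hn => ?_⟩
  obtain ⟨z, hz, h⟩ := hN m hm n hn
  exact ⟨l z, ⟨z, hz, rfl⟩, by simp only at h ⊢; rw [← map_smul, h, map_sub]⟩

theorem limIn_const {S : Set V} (hS : (0 : V) ∈ S) (y : V) : LimIn S (fun _ => y) y :=
  fun _ _ => ⟨0, fun _ _ => ⟨0, hS, by simp⟩⟩

theorem cauchyIn_const {S : Set V} (hS : (0 : V) ∈ S) (y : V) : CauchyIn S (fun _ => y) :=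
  fun _ _ => ⟨0, fun _ _ _ _ => ⟨0, hS, by simp⟩⟩

theorem LimIn.unique {S : Set V} (hS : IsCompletantDisk S) {x : ℕ → V} {y y' : V}
    (h : LimIn S x y) (h' : LimIn S x y') : y = y' := by
  rw [← sub_eq_zero]
  refine hS.2.1 _ fun ε hε => ?_
  obtain ⟨N, hN⟩ := h (ε / 2) (by positivity)
  obtain ⟨N', hN'⟩ := h' (ε / 2) (by positivity)
  have := hS.1.sub_mem (by positivity) (by positivity) (hN' _ (le_max_right N N'))
    (hN _ (le_max_left N N'))
  rw [add_halves] at this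
  convert this using 1
  abel

section
variable [Bornology V] [ConvexBornology V] [Bornology W] [ConvexBornology W]

theorem isBounded_smul {S : Set V} (hS : IsBounded S) (c : ℂ) : IsBounded (c • S) := by
  obtain ⟨n, hn⟩ := exists_nat_gt ‖c‖
  have key : ∀ n : ℕ, IsBounded ((n : ℂ) • diskHull S) := by
    intro n
    induction n with
    | zero =>
      refine (isBounded_singleton (x := (0 : V))).subset ?_
      rintro _ ⟨x, -, rfl⟩
      simp
    | succ n ih =>
      refine (ConvexBornology.isBounded_add _ _ ih
        (ConvexBornology.isBounded_diskHull S hS)).subset ?_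
      rintro _ ⟨x, hx, rfl⟩
      exact ⟨(n : ℂ) • x, ⟨x, hx, rfl⟩, x, hx, by simp [add_smul]⟩
  refine (key n).subset ((smul_set_mono (subset_diskHull S)).trans
    ((isDisk_diskHull S).smul_subset ?_))
  simpa using hn.le

theorem exists_disk {S : Set V} (hS : IsBounded S) :
    ∃ T : Set V, IsBounded T ∧ IsDisk T ∧ (0 : V) ∈ T ∧ S ⊆ T := by
  have h : IsBounded (S ∪ {0}) := hS.union isBounded_singleton
  exact ⟨diskHull (S ∪ {0}), ConvexBornology.isBounded_diskHull _ h, isDisk_diskHull _,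
    subset_diskHull _ (by simp), subset_union_left.trans (subset_diskHull _)⟩

theorem BornTendsto.add {x x' : ℕ → V} {y y' : V} (h : BornTendsto x y)
    (h' : BornTendsto x' y') : BornTendsto (x + x') (y + y') := by
  obtain ⟨S, hS, -, h⟩ := h
  obtain ⟨S', hS', -, h'⟩ := h'
  obtain ⟨T, hT, hTd, -, hST⟩ := exists_disk (hS.union hS')
  exact ⟨T, hT, hTd, (h.mono (subset_union_left.trans hST)).add hTd
    (h'.mono (subset_union_right.trans hST))⟩

theorem BornTendsto.smul {x : ℕ → V} {y : V} (h : BornTendsto x y) (c : ℂ) :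
    BornTendsto (c • x) (c • y) := by
  obtain ⟨S, hS, hSd, h⟩ := h
  exact ⟨S, hS, hSd, h.smul hSd c⟩

theorem BornTendsto.map {x : ℕ → V} {y : V} (h : BornTendsto x y) (l : V →ₗ[ℂ] W)
    (hl : IsBoundedMap l) : BornTendsto (fun n => l (x n)) (l y) := by
  obtain ⟨S, hS, hSd, h⟩ := h
  exact ⟨l '' S, hl S hS, hSd.image l, h.map l⟩

theorem bornTendsto_const (y : V) : BornTendsto (fun _ => y) y := by
  obtain ⟨T, hT, hTd, h0, -⟩ := exists_disk (isBounded_singleton (x := y))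
  exact ⟨T, hT, hTd, limIn_const h0 y⟩

theorem BornTendsto.unique [CompleteBornology V] {x : ℕ → V} {y y' : V} (h : BornTendsto x y)
    (h' : BornTendsto x y') : y = y' := by
  obtain ⟨S, hS, -, h⟩ := h
  obtain ⟨S', hS', -, h'⟩ := h'
  obtain ⟨T, -, hTc, hST⟩ := CompleteBornology.exists_completant _ (hS.union hS')
  exact (h.mono (subset_union_left.trans hST)).unique hTc
    (h'.mono (subset_union_right.trans hST))

theorem isBoundedMap_comp {X Y Z : Type*} [Bornology X] [Bornology Y] [Bornology Z] {g : Y → Z}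
    {f : X → Y} (hg : IsBoundedMap g) (hf : IsBoundedMap f) : IsBoundedMap (g ∘ f) := by
  intro S hS
  rw [image_comp]
  exact hg _ (hf S hS)

theorem isBoundedMap_linear_comp {U : Type*} [AddCommGroup U] [Module ℂ U] [Bornology U]
    {g : V →ₗ[ℂ] W} {f : U →ₗ[ℂ] V} (hg : IsBoundedMap g) (hf : IsBoundedMap f) :
    IsBoundedMap (g.comp f) := by
  intro S hS
  rw [LinearMap.coe_comp, image_comp]
  exact hg _ (hf S hS)

theorem isBornClosed_eq [CompleteBornology W] (f g : V →ₗ[ℂ] W) (hf : IsBoundedMap f)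
    (hg : IsBoundedMap g) : IsBornClosed {x | f x = g x} := by
  intro x y hx hxy
  have h1 := hxy.map f hf
  have h2 := hxy.map g hg
  have : (fun n => f (x n)) = fun n => g (x n) := funext hx
  rw [this] at h1
  exact h1.unique h2

end

end Basic

/-- A convex bornological algebra (associative, not necessarily unital): the multiplication is
bilinear and bounded. -/
class BornAlgebra (A : Type*) [NonUnitalRing A] [Module ℂ A] [Bornology A] : Prop
    extends ConvexBornology A, IsScalarTower ℂ A A, SMulCommClass ℂ A A where
  isBounded_mul : ∀ S T : Set A, IsBounded S → IsBounded T → IsBounded (S * T)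

/-! ### The completion of a convex bornological vector space

The completion is the separated inductive limit of the Hausdorff completions of the seminormed
spaces spanned by the small disks `S`.  These Hausdorff completions are realized by Cauchy
sequences. -/

section Completion

section Space

variable (V : Type u) [AddCommGroup V] [Module ℂ V] [Bornology V] [ConvexBornology V]

/-- The smallest bornologically closed subspace, that is, the closure of `{0}`. -/
def closureZero : Submodule ℂ V := sInf {N | IsBornClosed (N : Set V)}

/-- The bornological Cauchy sequences. -/
def cauchySubmodule : Submodule ℂ (ℕ → V) where
  carrier := {x | ∃ S : Set V, IsBounded S ∧ IsDisk S ∧ CauchyIn S x}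
  zero_mem' := by
    obtain ⟨T, hT, hTd, h0, -⟩ := exists_disk (isBounded_singleton (x := (0 : V)))
    exact ⟨T, hT, hTd, cauchyIn_const h0 0⟩
  add_mem' := by
    rintro x y ⟨S, hS, -, h⟩ ⟨S', hS', -, h'⟩
    obtain ⟨T, hT, hTd, -, hST⟩ := exists_disk (hS.union hS')
    exact ⟨T, hT, hTd, (h.mono (subset_union_left.trans hST)).add hTd
      (h'.mono (subset_union_right.trans hST))⟩
  smul_mem' := by
    rintro c x ⟨S, hS, hSd, h⟩
    exact ⟨S, hS, hSd, h.smul hSd c⟩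

/-- The space of bornological Cauchy sequences in `V`. -/
def CauchySeqs : Type u := cauchySubmodule V

instance : AddCommGroup (CauchySeqs V) := inferInstanceAs (AddCommGroup (cauchySubmodule V))
instance : Module ℂ (CauchySeqs V) := inferInstanceAs (Module ℂ (cauchySubmodule V))

variable {V}

/-- The Cauchy sequences for the seminorm of the disk `S` that are eventually in `S`. -/
def cauchyBall (S : Set V) : Set (CauchySeqs V) :=
  {x | CauchyIn S x.1 ∧ ∃ N, ∀ n, N ≤ n → x.1 n ∈ S}

theorem cauchyBall_mono {S T : Set V} (h : S ⊆ T) : cauchyBall S ⊆ cauchyBall T := by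
  rintro x ⟨hx, N, hN⟩
  exact ⟨hx.mono h, N, fun n hn => h (hN n hn)⟩

theorem isDisk_cauchyBall {S : Set V} (hS : IsDisk S) : IsDisk (cauchyBall S) := by
  rintro x ⟨hx, N, hN⟩ y ⟨hy, N', hN'⟩ a b hab
  exact ⟨(hx.smul hS a).add hS (hy.smul hS b), max N N', fun n hn =>
    hS (hN n (le_trans (le_max_left _ _) hn)) (hN' n (le_trans (le_max_right _ _) hn)) a b hab⟩

theorem exists_mem_cauchyBall (x : CauchySeqs V) :
    ∃ S : Set V, IsBounded S ∧ IsDisk S ∧ x ∈ cauchyBall S := by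
  obtain ⟨x, S, hS, hSd, hx⟩ := x
  obtain ⟨N, hN⟩ := hx 1 one_pos
  obtain ⟨T, hT, hTd, -, hST⟩ := exists_disk
    (hS.union (ConvexBornology.isBounded_add _ _ hS (isBounded_singleton (x := x N))))
  refine ⟨T, hT, hTd, hx.mono (subset_union_left.trans hST), N, fun n hn => hST (Or.inr ?_)⟩
  have := hN n hn N le_rfl
  simp only [Complex.ofReal_one, one_smul] at this
  exact ⟨_, this, x N, rfl, by simp⟩

instance : Bornology (CauchySeqs V) :=
  Bornology.ofBounded {B | ∃ S : Set V, IsBounded S ∧ IsDisk S ∧ B ⊆ cauchyBall S}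
    (by
      obtain ⟨T, hT, hTd, h0, -⟩ := exists_disk (isBounded_singleton (x := (0 : V)))
      exact ⟨T, hT, hTd, empty_subset _⟩)
    (by
      rintro B ⟨S, hS, hSd, h⟩ B' hB
      exact ⟨S, hS, hSd, hB.trans h⟩)
    (by
      rintro B ⟨S, hS, hSd, h⟩ B' ⟨S', hS', hSd', h'⟩
      obtain ⟨T, hT, hTd, -, hST⟩ := exists_disk (hS.union hS')
      exact ⟨T, hT, hTd, union_subset
        (h.trans (cauchyBall_mono (subset_union_left.trans hST)))
        (h'.trans (cauchyBall_mono (subset_union_right.trans hST)))⟩)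
    (by
      intro x
      obtain ⟨S, hS, hSd, h⟩ := exists_mem_cauchyBall x
      exact ⟨S, hS, hSd, singleton_subset_iff.2 h⟩)

theorem cauchySeqs_isBounded_iff {B : Set (CauchySeqs V)} :
    IsBounded B ↔ ∃ S : Set V, IsBounded S ∧ IsDisk S ∧ B ⊆ cauchyBall S :=
  isBounded_ofBounded_iff _

instance : ConvexBornology (CauchySeqs V) where
  isBounded_add := by
    intro B B' hB hB'
    rw [cauchySeqs_isBounded_iff] at *
    obtain ⟨S, hS, hSd, h⟩ := hB
    obtain ⟨S', hS', hSd', h'⟩ := hB'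
    obtain ⟨T, hT, hTd, h0, hST⟩ := exists_disk
      ((hS.union hS').union (ConvexBornology.isBounded_add _ _ hS hS'))
    refine ⟨T, hT, hTd, ?_⟩
    rintro _ ⟨x, hx, y, hy, rfl⟩
    obtain ⟨hx, N, hN⟩ := h hx
    obtain ⟨hy, N', hN'⟩ := h' hy
    refine ⟨(hx.mono fun z hz => hST (Or.inl (Or.inl hz))).add hTd
      (hy.mono fun z hz => hST (Or.inl (Or.inr hz))), max N N', fun n hn => hST (Or.inr ?_)⟩
    exact ⟨_, hN n (le_trans (le_max_left _ _) hn), _, hN' n (le_trans (le_max_right _ _) hn), rfl⟩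
  isBounded_diskHull := by
    intro B hB
    rw [cauchySeqs_isBounded_iff] at *
    obtain ⟨S, hS, hSd, h⟩ := hB
    exact ⟨S, hS, hSd, diskHull_subset (isDisk_cauchyBall hSd) h⟩

variable (V)

/-- The completion of a convex bornological vector space. -/
def Completion : Type u := CauchySeqs V ⧸ closureZero (CauchySeqs V)

instance : AddCommGroup (Completion V) :=
  inferInstanceAs (AddCommGroup (CauchySeqs V ⧸ closureZero (CauchySeqs V)))
instance : Module ℂ (Completion V) :=
  inferInstanceAs (Module ℂ (CauchySeqs V ⧸ closureZero (CauchySeqs V)))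

/-- The class of a Cauchy sequence in the completion. -/
def Completion.mk : CauchySeqs V →ₗ[ℂ] Completion V := (closureZero (CauchySeqs V)).mkQ

variable {V}

theorem Completion.mk_surjective : Function.Surjective (Completion.mk V) :=
  Submodule.mkQ_surjective _

theorem Completion.mk_eq_zero {x : CauchySeqs V} :
    Completion.mk V x = 0 ↔ x ∈ closureZero (CauchySeqs V) :=
  Submodule.Quotient.mk_eq_zero _

/-- The quotient bornology on the completion. -/
instance : Bornology (Completion V) :=
  Bornology.ofBounded {B | ∃ T : Set (CauchySeqs V), IsBounded T ∧ B ⊆ Completion.mk V '' T}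
    ⟨∅, isBounded_empty, by simp⟩
    (by
      rintro B ⟨S, hS, h⟩ B' hB
      exact ⟨S, hS, hB.trans h⟩)
    (by
      rintro B ⟨S, hS, h⟩ B' ⟨S', hS', h'⟩
      refine ⟨S ∪ S', hS.union hS', ?_⟩
      rw [image_union]
      exact union_subset_union h h')
    (by
      intro x
      obtain ⟨x, rfl⟩ := Completion.mk_surjective x
      exact ⟨{x}, isBounded_singleton, by simp⟩)

theorem Completion.isBounded_iff {B : Set (Completion V)} :
    IsBounded B ↔ ∃ T : Set (CauchySeqs V), IsBounded T ∧ B ⊆ Completion.mk V '' T :=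
  isBounded_ofBounded_iff _

instance : ConvexBornology (Completion V) where
  isBounded_add := by
    intro B B' hB hB'
    rw [Completion.isBounded_iff] at *
    obtain ⟨S, hS, h⟩ := hB
    obtain ⟨S', hS', h'⟩ := hB'
    refine ⟨S + S', ConvexBornology.isBounded_add _ _ hS hS', ?_⟩
    rw [image_add]
    exact add_subset_add h h'
  isBounded_diskHull := by
    intro B hB
    rw [Completion.isBounded_iff] at *
    obtain ⟨S, hS, h⟩ := hB
    exact ⟨diskHull S, ConvexBornology.isBounded_diskHull _ hS,
      diskHull_subset ((isDisk_diskHull S).image _) (h.trans (image_mono (subset_diskHull S)))⟩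

theorem isBornClosed_closureZero : IsBornClosed (closureZero V : Set V) := by
  intro x y hx hxy
  simp only [closureZero, SetLike.mem_coe, Submodule.mem_sInf] at hx ⊢
  exact fun N hN => hN x y (fun n => hx n N hN) hxy

/-- Diagonal argument: the Cauchy sequences for a fixed disk are complete. -/
theorem exists_lim_cauchySeqs {S : Set V} (hS : IsBounded S) (hSd : IsDisk S)
    (z : ℕ → CauchySeqs V)
    (hz : ∀ j, z j ∈ cauchyBall S)
    (hzz : ∀ j, z (j + 1) - z j ∈ (((1 / 2 : ℝ) ^ j : ℝ) : ℂ) • cauchyBall S) :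
    ∃ w : CauchySeqs V, ∃ c : ℝ, 0 < c ∧
      ∀ j, w - z j ∈ ((c * (1 / 2 : ℝ) ^ j : ℝ) : ℂ) • cauchyBall S := by
  have hhalf : ∀ j : ℕ, (0 : ℝ) < (1 / 2 : ℝ) ^ j := fun j => by positivity
  -- telescoping estimates
  have tele : ∀ j k, z (j + k) - z j ∈
      ((2 * (1 / 2 : ℝ) ^ j : ℝ) : ℂ) • cauchyBall S := by
    have aux : ∀ k j, z (j + k + 1) - z j ∈
        ((2 * (1 / 2 : ℝ) ^ j - (1 / 2 : ℝ) ^ (j + k) : ℝ) : ℂ) • cauchyBall S := by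
      intro k
      induction k with
      | zero =>
        intro j
        have h := hzz j
        have e : (2 * (1 / 2 : ℝ) ^ j - (1 / 2 : ℝ) ^ (j + 0)) = (1 / 2 : ℝ) ^ j := by
          rw [add_zero]; ring
        rw [e]
        exact h
      | succ k ih =>
        intro j
        have h1 := ih j
        have h2 := hzz (j + k + 1)
        have hpos : 0 < 2 * (1 / 2 : ℝ) ^ j - (1 / 2 : ℝ) ^ (j + k) := by
          have : (1 / 2 : ℝ) ^ (j + k) ≤ (1 / 2 : ℝ) ^ j :=
            pow_le_pow_of_le_one (by norm_num) (by norm_num) (by omega)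
          have := hhalf j
          linarith
        have h3 := (isDisk_cauchyBall hSd).add_mem (hhalf _) hpos h2 h1
        have e : (1 / 2 : ℝ) ^ (j + k + 1) + (2 * (1 / 2 : ℝ) ^ j - (1 / 2 : ℝ) ^ (j + k)) =
            2 * (1 / 2 : ℝ) ^ j - (1 / 2 : ℝ) ^ (j + (k + 1)) := by
          rw [← add_assoc j k 1, pow_succ]; ring
        rw [e] at h3
        convert h3 using 1
        rw [← add_assoc j k 1]
        abel
    intro j k
    cases k with
    | zero =>
      refine ⟨0, ?_, by simp⟩
      exact (isDisk_cauchyBall hSd).zero_mem (hz 0)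
    | succ k =>
      have hpos : 0 ≤ 2 * (1 / 2 : ℝ) ^ j - (1 / 2 : ℝ) ^ (j + k) := by
        have : (1 / 2 : ℝ) ^ (j + k) ≤ (1 / 2 : ℝ) ^ j :=
          pow_le_pow_of_le_one (by norm_num) (by norm_num) (by omega)
        have := hhalf j
        linarith
      exact (isDisk_cauchyBall hSd).mono hpos (by have := hhalf (j + k); linarith) (aux k j)
  -- choose diagonal indices
  have hN : ∀ j, ∃ N, ∀ m, N ≤ m → ∀ n, N ≤ n →
      (z j).1 m - (z j).1 n ∈ (((1 / 2 : ℝ) ^ j : ℝ) : ℂ) • S :=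
    fun j => (hz j).1 _ (hhalf j)
  choose N hN using hN
  -- for `j ≤ k`, eventual estimate
  have hM : ∀ j k, ∃ M, ∀ n, M ≤ n →
      (z (j + k)).1 n - (z j).1 n ∈ ((2 * (1 / 2 : ℝ) ^ j : ℝ) : ℂ) • S := by
    intro j k
    obtain ⟨u, ⟨-, M, hM⟩, hu⟩ := tele j k
    refine ⟨M, fun n hn => ⟨u.1 n, hM n hn, ?_⟩⟩
    have : ((((2 * (1 / 2 : ℝ) ^ j : ℝ) : ℂ) • u : CauchySeqs V)).1 n
        = (z (j + k) - z j).1 n := by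
      simp only at hu
      rw [hu]
    exact this
  choose M hM using hM
  let w : ℕ → V := fun j => (z j).1 (N j)
  have hw : ∀ j k, ∀ n, N j ≤ n →
      w (j + k) - (z j).1 n ∈ ((4 * (1 / 2 : ℝ) ^ j : ℝ) : ℂ) • S := by
    intro j k n hn
    set m := max (N j) (max (N (j + k)) (M j k)) with hm
    have m1 : N j ≤ m := le_max_left _ _
    have m2 : N (j + k) ≤ m := (le_max_left _ _).trans (le_max_right _ _)
    have m3 : M j k ≤ m := (le_max_right _ _).trans (le_max_right _ _)
    have e1 := hN (j + k) (N (j + k)) le_rfl m m2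
    have e2 := hM j k m m3
    have e3 := hN j m m1 n hn
    have e1' := hSd.mono (hhalf _).le
      (pow_le_pow_of_le_one (by norm_num) (by norm_num) (by omega : j ≤ j + k) :
        (1 / 2 : ℝ) ^ (j + k) ≤ (1 / 2 : ℝ) ^ j) e1
    have h2 : (0 : ℝ) < 2 * (1 / 2 : ℝ) ^ j := by have := hhalf j; positivity
    have := hSd.add_mem (by have := hhalf j; positivity) (hhalf j)
      (hSd.add_mem (hhalf j) h2 e1' e2) e3
    have e : (1 / 2 : ℝ) ^ j + 2 * (1 / 2 : ℝ) ^ j + (1 / 2 : ℝ) ^ j = 4 * (1 / 2 : ℝ) ^ j := by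
      ring
    rw [e] at this
    convert this using 1
    simp only [w]; abel
  have hlim : ∀ ε : ℝ, 0 < ε → ∃ j : ℕ, 8 * (1 / 2 : ℝ) ^ j < ε := by
    intro ε hε
    obtain ⟨j, hj⟩ := exists_pow_lt_of_lt_one (by positivity : (0 : ℝ) < ε / 8)
      (by norm_num : (1 / 2 : ℝ) < 1)
    exact ⟨j, by linarith⟩
  have hwc : CauchyIn S w := by
    intro ε hε
    obtain ⟨j, hj⟩ := hlim ε hε
    refine ⟨j, fun m hm n hn => ?_⟩
    obtain ⟨m, rfl⟩ := Nat.exists_eq_add_of_le hm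
    obtain ⟨n, rfl⟩ := Nat.exists_eq_add_of_le hn
    have h4 : (0 : ℝ) < 4 * (1 / 2 : ℝ) ^ j := by have := hhalf j; positivity
    have := hSd.sub_mem h4 h4 (hw j m (N j) le_rfl) (hw j n (N j) le_rfl)
    refine hSd.mono (a := 4 * (1 / 2 : ℝ) ^ j + 4 * (1 / 2 : ℝ) ^ j) (by positivity)
      (by linarith) ?_
    convert this using 1
    abel
  refine ⟨⟨w, S, hS, hSd, hwc⟩, 4, by norm_num, fun j => ?_⟩
  have h4 : (0 : ℝ) < 4 * (1 / 2 : ℝ) ^ j := by have := hhalf j; positivity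
  have h4' : ((4 * (1 / 2 : ℝ) ^ j : ℝ) : ℂ) ≠ 0 := by exact_mod_cast h4.ne'
  refine (mem_smul_set_iff_inv_smul_mem₀ h4' _ _).2 ⟨?_, max j (N j), fun n hn => ?_⟩
  · have h1 := hwc.add hSd ((hz j).1.smul hSd (-1))
    have h2 := h1.smul hSd (((4 * (1 / 2 : ℝ) ^ j : ℝ) : ℂ)⁻¹)
    convert h2 using 1
    funext n
    change ((4 * (1 / 2 : ℝ) ^ j : ℝ) : ℂ)⁻¹ • (w n - (z j).1 n) =
      ((4 * (1 / 2 : ℝ) ^ j : ℝ) : ℂ)⁻¹ • (w n + (-1 : ℂ) • (z j).1 n)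
    rw [neg_one_smul, sub_eq_add_neg]
  · obtain ⟨k, rfl⟩ := Nat.exists_eq_add_of_le ((le_max_left _ _).trans hn)
    exact (mem_smul_set_iff_inv_smul_mem₀ h4' _ _).1
      (hw j k _ ((le_max_right _ _).trans hn))

theorem limIn_of_subseq {S : Set V} (hSd : IsDisk S) {x : ℕ → V} (hx : CauchyIn S x) {y : V}
    {k : ℕ → ℕ} (hk : ∀ j, j ≤ k j) (h : LimIn S (fun j => x (k j)) y) : LimIn S x y := by
  intro ε hε
  obtain ⟨N, hN⟩ := hx (ε / 2) (by positivity)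
  obtain ⟨N', hN'⟩ := h (ε / 2) (by positivity)
  refine ⟨N, fun n hn => ?_⟩
  have h1 := hN n hn (k (max N N')) ((le_max_left _ _).trans (hk _))
  have := hSd.add_mem (by positivity) (by positivity) h1 (hN' _ (le_max_right N N'))
  rw [add_halves] at this
  convert this using 1
  abel

theorem isCompletantDisk_image_cauchyBall {S : Set V} (hS : IsBounded S) (hSd : IsDisk S)
    (h0 : (0 : V) ∈ S) :
    IsCompletantDisk (Completion.mk V '' cauchyBall S) := by
  have hBd := isDisk_cauchyBall hSd
  have hB : IsBounded (cauchyBall S) := cauchySeqs_isBounded_iff.2 ⟨S, hS, hSd, subset_rfl⟩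
  have hB0 : (0 : CauchySeqs V) ∈ cauchyBall S := ⟨cauchyIn_const h0 0, 0, fun _ _ => h0⟩
  refine ⟨hBd.image _, ?_, ?_⟩
  · intro x hx
    obtain ⟨x, rfl⟩ := Completion.mk_surjective x
    rw [Completion.mk_eq_zero]
    have hhalf : ∀ j : ℕ, (0 : ℝ) < (1 / 2 : ℝ) ^ j := fun j => by positivity
    have : ∀ j : ℕ, ∃ b ∈ cauchyBall S,
        x - (((1 / 2 : ℝ) ^ j : ℝ) : ℂ) • b ∈ closureZero (CauchySeqs V) := by
      intro j
      obtain ⟨_, ⟨b, hb, rfl⟩, h⟩ := hx _ (hhalf j)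
      refine ⟨b, hb, ?_⟩
      rw [← Completion.mk_eq_zero, map_sub, map_smul, sub_eq_zero]
      exact h.symm
    choose b hb hxb using this
    refine isBornClosed_closureZero _ x hxb ⟨cauchyBall S, hB, hBd, fun ε hε => ?_⟩
    obtain ⟨N, hN⟩ := exists_pow_lt_of_lt_one hε (by norm_num : (1 / 2 : ℝ) < 1)
    refine ⟨N, fun n hn => ?_⟩
    have h1 : (1 / 2 : ℝ) ^ n ≤ ε :=
      (pow_le_pow_of_le_one (by norm_num) (by norm_num) hn).trans hN.le
    refine hBd.mono (hhalf n).le h1 ?_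
    convert hBd.neg_mem_smul (smul_smul_mem (c := (((1 / 2 : ℝ) ^ n : ℝ) : ℂ)) (hb n)) using 1
    exact sub_sub_cancel_left _ _
  · intro y hy
    -- a fast Cauchy subsequence
    have hhalf : ∀ j : ℕ, (0 : ℝ) < (1 / 2 : ℝ) ^ (j + 1) := fun j => by positivity
    have hK := fun j : ℕ => hy _ (hhalf j)
    choose K hK using hK
    let k : ℕ → ℕ := fun j => (Finset.range (j + 1)).sup K + j
    have hkK : ∀ j, K j ≤ k j := fun j =>
      (Finset.le_sup (f := K) (Finset.self_mem_range_succ j)).trans (Nat.le_add_right _ _)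
    have hkmono : ∀ j, k j ≤ k (j + 1) := fun j =>
      add_le_add (Finset.sup_mono (Finset.range_mono (by omega))) (by omega)
    have hd : ∀ j, ∃ b ∈ cauchyBall S,
        Completion.mk V ((((1 / 2 : ℝ) ^ (j + 1) : ℝ) : ℂ) • b) = y (k (j + 1)) - y (k j) := by
      intro j
      obtain ⟨_, ⟨b, hb, rfl⟩, h⟩ := hK j (k (j + 1)) ((hkK j).trans (hkmono j)) (k j) (hkK j)
      exact ⟨b, hb, by rw [map_smul]; exact h⟩
    choose b hb hby using hd
    let z : ℕ → CauchySeqs V := fun j =>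
      ∑ i ∈ Finset.range j, (((1 / 2 : ℝ) ^ (i + 1) : ℝ) : ℂ) • b i
    have hzs : ∀ j, z (j + 1) - z j = (((1 / 2 : ℝ) ^ (j + 1) : ℝ) : ℂ) • b j := fun j => by
      simp only [z, Finset.sum_range_succ]; abel
    have hz : ∀ j, z j ∈ ((1 - (1 / 2 : ℝ) ^ j : ℝ) : ℂ) • cauchyBall S := by
      intro j
      induction j with
      | zero => exact ⟨0, hB0, by simp [z]⟩
      | succ j ih =>
        have e : z (j + 1) = z j + (((1 / 2 : ℝ) ^ (j + 1) : ℝ) : ℂ) • b j := by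
          rw [← hzs]; abel
        rw [e]
        rcases Nat.eq_zero_or_pos j with rfl | hj
        · refine ⟨b 0, hb 0, ?_⟩
          simp only [z, Finset.range_zero, Finset.sum_empty, zero_add]
          norm_num
        · have hp : (0 : ℝ) < 1 - (1 / 2 : ℝ) ^ j := by
            have := pow_lt_one₀ (by norm_num : (0 : ℝ) ≤ 1 / 2) (by norm_num) hj.ne'
            linarith
          have := hBd.add_mem hp (hhalf j) ih
            (smul_smul_mem (c := (((1 / 2 : ℝ) ^ (j + 1) : ℝ) : ℂ)) (hb j))
          have e2 : 1 - (1 / 2 : ℝ) ^ j + (1 / 2 : ℝ) ^ (j + 1) = 1 - (1 / 2 : ℝ) ^ (j + 1) := by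
            rw [pow_succ]; ring
          rwa [e2] at this
    have hz1 : ∀ j, z j ∈ cauchyBall S := fun j => by
      have h1 : (1 / 2 : ℝ) ^ j ≤ 1 := pow_le_one₀ (by norm_num) (by norm_num)
      have h2 : (0 : ℝ) ≤ (1 / 2 : ℝ) ^ j := by positivity
      have := hBd.mono (by linarith) (by linarith : 1 - (1 / 2 : ℝ) ^ j ≤ 1) (hz j)
      simpa using this
    obtain ⟨w, c, hc, hw⟩ := exists_lim_cauchySeqs hS hSd z hz1 (fun j => by
      rw [hzs]
      refine hBd.mono (hhalf j).le ?_ (smul_smul_mem (hb j))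
      exact pow_le_pow_of_le_one (by norm_num) (by norm_num) (by omega))
    have hyz : ∀ j, y (k j) = y (k 0) + Completion.mk V (z j) := by
      intro j
      induction j with
      | zero => simp [z]
      | succ j ih =>
        have e : z (j + 1) = z j + (((1 / 2 : ℝ) ^ (j + 1) : ℝ) : ℂ) • b j := by
          rw [← hzs]; abel
        rw [e, map_add, hby, ← add_assoc, ← ih]; abel
    refine ⟨y (k 0) + Completion.mk V w,
      limIn_of_subseq (k := k) (hBd.image _) hy (fun j => Nat.le_add_left _ _) fun ε hε => ?_⟩
    obtain ⟨J, hJ⟩ := exists_pow_lt_of_lt_one (by positivity : 0 < ε / c)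
      (by norm_num : (1 / 2 : ℝ) < 1)
    refine ⟨J, fun j hj => ?_⟩
    have h1 : c * (1 / 2 : ℝ) ^ j ≤ ε := by
      have := (pow_le_pow_of_le_one (by norm_num) (by norm_num) hj).trans hJ.le
      rw [le_div_iff₀ hc] at this
      linarith
    have h2 := hBd.neg_mem_smul (hBd.mono (by positivity) h1 (hw j))
    obtain ⟨v, hv, hvw⟩ := h2
    refine ⟨Completion.mk V v, ⟨v, hv, rfl⟩, ?_⟩
    simp only at hvw ⊢
    rw [← map_smul, hvw, hyz j, map_neg, map_sub]
    abel

instance : CompleteBornology (Completion V) where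
  exists_completant := by
    intro B hB
    obtain ⟨T, hT, hBT⟩ := Completion.isBounded_iff.1 hB
    obtain ⟨S, hS, hSd, hTS⟩ := cauchySeqs_isBounded_iff.1 hT
    obtain ⟨R, hR, hRd, h0, hSR⟩ := exists_disk hS
    refine ⟨Completion.mk V '' cauchyBall R, Completion.isBounded_iff.2
      ⟨_, cauchySeqs_isBounded_iff.2 ⟨R, hR, hRd, subset_rfl⟩, subset_rfl⟩,
      isCompletantDisk_image_cauchyBall hR hRd h0,
      hBT.trans (image_mono (hTS.trans (cauchyBall_mono hSR)))⟩

/-- Constant sequences. -/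
def CauchySeqs.const : V →ₗ[ℂ] CauchySeqs V where
  toFun x := ⟨fun _ => x, by
    obtain ⟨T, hT, hTd, h0, -⟩ := exists_disk (isBounded_singleton (x := (0 : V)))
    exact ⟨T, hT, hTd, cauchyIn_const h0 x⟩⟩
  map_add' _ _ := Subtype.ext rfl
  map_smul' _ _ := Subtype.ext rfl

/-- The canonical map to the completion, by constant sequences. -/
def Completion.of : V →ₗ[ℂ] Completion V := (Completion.mk V).comp CauchySeqs.const

theorem Completion.isBoundedMap_of : IsBoundedMap (Completion.of : V →ₗ[ℂ] Completion V) := by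
  intro S hS
  obtain ⟨T, hT, hTd, h0, hST⟩ := exists_disk hS
  refine Completion.isBounded_iff.2
    ⟨_, cauchySeqs_isBounded_iff.2 ⟨T, hT, hTd, subset_rfl⟩, ?_⟩
  rintro _ ⟨x, hx, rfl⟩
  exact ⟨CauchySeqs.const x, ⟨cauchyIn_const h0 x, 0, fun _ _ => hST hx⟩, rfl⟩

section Lift

variable {W : Type v} [AddCommGroup W] [Module ℂ W] [Bornology W] [ConvexBornology W]
  [CompleteBornology W]

theorem exists_bornLim (l : V →ₗ[ℂ] W) (hl : IsBoundedMap l) (x : CauchySeqs V) :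
    ∃ y, BornTendsto (fun n => l (x.1 n)) y := by
  obtain ⟨x, S, hS, hSd, hx⟩ := x
  obtain ⟨T, hT, hTc, hST⟩ := CompleteBornology.exists_completant _ (hl S hS)
  obtain ⟨y, hy⟩ := hTc.2.2 _ ((hx.map l).mono hST)
  exact ⟨y, T, hT, hTc.1, hy⟩

/-- `x ↦ lim l (x n)` on Cauchy sequences. -/
noncomputable def limMap (l : V →ₗ[ℂ] W) (hl : IsBoundedMap l) : CauchySeqs V →ₗ[ℂ] W where
  toFun x := (exists_bornLim l hl x).choose
  map_add' x y := by
    refine (exists_bornLim l hl (x + y)).choose_spec.unique ?_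
    have := (exists_bornLim l hl x).choose_spec.add (exists_bornLim l hl y).choose_spec
    convert this using 1
    funext n
    exact map_add l _ _
  map_smul' c x := by
    refine (exists_bornLim l hl (c • x)).choose_spec.unique ?_
    have := (exists_bornLim l hl x).choose_spec.smul c
    simp only [RingHom.id_apply]
    convert this using 1
    funext n
    exact map_smul l _ _

theorem limMap_spec (l : V →ₗ[ℂ] W) (hl : IsBoundedMap l) (x : CauchySeqs V) :
    BornTendsto (fun n => l (x.1 n)) (limMap l hl x) :=
  (exists_bornLim l hl x).choose_spec

theorem isBoundedMap_limMap (l : V →ₗ[ℂ] W) (hl : IsBoundedMap l) :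
    IsBoundedMap (limMap l hl) := by
  intro B hB
  obtain ⟨S, hS, hSd, hBS⟩ := cauchySeqs_isBounded_iff.1 hB
  obtain ⟨T, hT, hTc, hST⟩ := CompleteBornology.exists_completant _ (hl S hS)
  refine (isBounded_smul hT 2).subset ?_
  rintro _ ⟨x, hx, rfl⟩
  obtain ⟨hx, N, hN⟩ := hBS hx
  obtain ⟨y, hy⟩ := hTc.2.2 _ ((hx.map l).mono hST)
  have : limMap l hl x = y := (limMap_spec l hl x).unique ⟨T, hT, hTc.1, hy⟩
  rw [this]
  obtain ⟨M, hM⟩ := hy 1 one_pos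
  have h1 := hM (max N M) (le_max_right _ _)
  have h2 : l (x.1 (max N M)) ∈ ((1 : ℝ) : ℂ) • T := by
    simpa using hST ⟨_, hN _ (le_max_left _ _), rfl⟩
  have := hTc.1.sub_mem one_pos one_pos h2 h1
  rw [sub_sub_cancel] at this
  convert this using 2
  norm_num

/-- The extension of a bounded linear map with complete target to the completion. -/
noncomputable def Completion.lift (l : V →ₗ[ℂ] W) (hl : IsBoundedMap l) :
    Completion V →ₗ[ℂ] W :=
  Submodule.liftQ (closureZero (CauchySeqs V)) (limMap l hl) <| by
    refine sInf_le ?_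
    have := isBornClosed_eq (limMap l hl) (0 : CauchySeqs V →ₗ[ℂ] W) (isBoundedMap_limMap l hl) (by
      intro S _
      refine (isBounded_singleton (x := (0 : W))).subset ?_
      rintro _ ⟨x, -, rfl⟩
      rfl)
    exact this

theorem Completion.lift_mk (l : V →ₗ[ℂ] W) (hl : IsBoundedMap l) (x : CauchySeqs V) :
    Completion.lift l hl (Completion.mk V x) = limMap l hl x := rfl

theorem Completion.isBoundedMap_lift (l : V →ₗ[ℂ] W) (hl : IsBoundedMap l) :
    IsBoundedMap (Completion.lift l hl) := by
  intro B hB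
  obtain ⟨T, hT, hBT⟩ := Completion.isBounded_iff.1 hB
  refine (isBoundedMap_limMap l hl T hT).subset ?_
  rintro _ ⟨x, hx, rfl⟩
  obtain ⟨z, hz, rfl⟩ := hBT hx
  exact ⟨z, hz, rfl⟩

end Lift

end Space

section Algebra

variable {A : Type u} [NonUnitalRing A] [Module ℂ A] [Bornology A] [BornAlgebra A]

theorem CauchyIn.mul_mem {S T D : Set A} (hD : IsDisk D) (hST : S * T ⊆ D) {x y : ℕ → A}
    (hx : CauchyIn S x) (hy : CauchyIn T y) (hxS : ∃ N, ∀ n, N ≤ n → x n ∈ S)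
    (hyT : ∃ N, ∀ n, N ≤ n → y n ∈ T) : CauchyIn D (x * y) := by
  intro ε hε
  obtain ⟨N₁, h₁⟩ := hx (ε / 2) (by positivity)
  obtain ⟨N₂, h₂⟩ := hy (ε / 2) (by positivity)
  obtain ⟨N₃, h₃⟩ := hxS
  obtain ⟨N₄, h₄⟩ := hyT
  refine ⟨max (max N₁ N₂) (max N₃ N₄), fun m hm n hn => ?_⟩
  simp only [max_le_iff] at hm hn
  obtain ⟨s, hs, hs'⟩ := h₁ m hm.1.1 n hn.1.1
  obtain ⟨t, ht, ht'⟩ := h₂ m hm.1.2 n hn.1.2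
  have e₁ : (x m - x n) * y m ∈ ((ε / 2 : ℝ) : ℂ) • D := by
    rw [← hs']
    exact ⟨s * y m, hST (mul_mem_mul hs (h₄ m hm.2.2)), by simp [smul_mul_assoc]⟩
  have e₂ : x n * (y m - y n) ∈ ((ε / 2 : ℝ) : ℂ) • D := by
    rw [← ht']
    exact ⟨x n * t, hST (mul_mem_mul (h₃ n hn.2.1) ht), by simp [mul_smul_comm]⟩
  have := hD.add_mem (by positivity) (by positivity) e₁ e₂
  rw [add_halves] at this
  convert this using 1
  simp only [Pi.mul_apply, sub_mul, mul_sub]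
  abel

theorem mul_mem_cauchyBall {S T D : Set A} (hD : IsDisk D) (hST : S * T ⊆ D)
    {x y : CauchySeqs A} (hx : x ∈ cauchyBall S) (hy : y ∈ cauchyBall T) :
    CauchyIn D (x.1 * y.1) ∧ ∃ N, ∀ n, N ≤ n → (x.1 * y.1) n ∈ D := by
  refine ⟨hx.1.mul_mem hD hST hy.1 hx.2 hy.2, ?_⟩
  obtain ⟨N₃, h₃⟩ := hx.2
  obtain ⟨N₄, h₄⟩ := hy.2
  exact ⟨max N₃ N₄, fun n hn => hST (mul_mem_mul (h₃ n ((le_max_left _ _).trans hn))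
    (h₄ n ((le_max_right _ _).trans hn)))⟩

/-- Cauchy sequences are multiplied termwise. -/
instance : Mul (CauchySeqs A) where
  mul x y := ⟨x.1 * y.1, by
    obtain ⟨S, hS, -, hx⟩ := exists_mem_cauchyBall x
    obtain ⟨T, hT, -, hy⟩ := exists_mem_cauchyBall y
    obtain ⟨D, hD, hDd, -, hSD⟩ := exists_disk (BornAlgebra.isBounded_mul _ _ hS hT)
    exact ⟨D, hD, hDd, (mul_mem_cauchyBall hDd hSD hx hy).1⟩⟩

instance : NonUnitalRing (CauchySeqs A) where
  toAddCommGroup := inferInstance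
  left_distrib _ _ _ := Subtype.ext (mul_add _ _ _)
  right_distrib _ _ _ := Subtype.ext (add_mul _ _ _)
  zero_mul _ := Subtype.ext (zero_mul _)
  mul_zero _ := Subtype.ext (mul_zero _)
  mul_assoc _ _ _ := Subtype.ext (mul_assoc _ _ _)

instance : BornAlgebra (CauchySeqs A) where
  smul_assoc c x y := Subtype.ext (smul_mul_assoc c x.1 y.1)
  smul_comm c x y := Subtype.ext (mul_smul_comm c x.1 y.1).symm
  isBounded_mul := by
    intro B B' hB hB'
    obtain ⟨S, hS, -, h⟩ := cauchySeqs_isBounded_iff.1 hB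
    obtain ⟨T, hT, -, h'⟩ := cauchySeqs_isBounded_iff.1 hB'
    obtain ⟨D, hD, hDd, -, hSD⟩ := exists_disk (BornAlgebra.isBounded_mul _ _ hS hT)
    refine cauchySeqs_isBounded_iff.2 ⟨D, hD, hDd, ?_⟩
    rintro _ ⟨x, hx, y, hy, rfl⟩
    exact mul_mem_cauchyBall hDd hSD (h hx) (h' hy)

theorem isBoundedMap_mulLeft (x : A) : IsBoundedMap (LinearMap.mulLeft ℂ x) := by
  intro S hS
  refine (BornAlgebra.isBounded_mul _ _ (isBounded_singleton (x := x)) hS).subset ?_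
  rintro _ ⟨y, hy, rfl⟩
  exact mul_mem_mul rfl hy

theorem isBoundedMap_mulRight (x : A) : IsBoundedMap (LinearMap.mulRight ℂ x) := by
  intro S hS
  refine (BornAlgebra.isBounded_mul _ _ hS (isBounded_singleton (x := x))).subset ?_
  rintro _ ⟨y, hy, rfl⟩
  exact mul_mem_mul hy rfl

theorem isBornClosed_comap {V W : Type*} [AddCommGroup V] [Module ℂ V] [Bornology V]
    [ConvexBornology V] [AddCommGroup W] [Module ℂ W] [Bornology W] [ConvexBornology W]
    (l : V →ₗ[ℂ] W) (hl : IsBoundedMap l) {N : Submodule ℂ W} (hN : IsBornClosed (N : Set W)) :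
    IsBornClosed (N.comap l : Set V) :=
  fun _ y hx hxy => hN _ (l y) hx (hxy.map l hl)

theorem closureZero_le {V : Type*} [AddCommGroup V] [Module ℂ V] [Bornology V]
    {N : Submodule ℂ V} (hN : IsBornClosed (N : Set V)) : closureZero V ≤ N :=
  sInf_le hN

theorem mul_mem_closureZero_left (x : A) {y : A} (hy : y ∈ closureZero A) :
    x * y ∈ closureZero A :=
  closureZero_le (isBornClosed_comap (LinearMap.mulLeft ℂ x) (isBoundedMap_mulLeft x)
    isBornClosed_closureZero) hy

theorem mul_mem_closureZero_right {x : A} (hx : x ∈ closureZero A) (y : A) :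
    x * y ∈ closureZero A :=
  closureZero_le (isBornClosed_comap (LinearMap.mulRight ℂ y) (isBoundedMap_mulRight y)
    isBornClosed_closureZero) hx

/-- The multiplication on the completion, induced by the termwise multiplication. -/
instance : Mul (Completion A) where
  mul := Quotient.map₂ (· * ·) <| by
    intro x x' hx y y' hy
    have hx' : x - x' ∈ closureZero (CauchySeqs A) := (Submodule.quotientRel_def _).1 hx
    have hy' : y - y' ∈ closureZero (CauchySeqs A) := (Submodule.quotientRel_def _).1 hy
    refine (Submodule.quotientRel_def _).2 ?_
    have e : x * y - x' * y' = (x - x') * y + x' * (y - y') := by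
      rw [sub_mul, mul_sub]; abel
    rw [e]
    exact add_mem (mul_mem_closureZero_right hx' y) (mul_mem_closureZero_left x' hy')

theorem Completion.mk_mul (x y : CauchySeqs A) :
    Completion.mk A (x * y) = Completion.mk A x * Completion.mk A y := rfl

instance : NonUnitalRing (Completion A) where
  toAddCommGroup := inferInstance
  left_distrib x y z := by
    obtain ⟨x, rfl⟩ := Completion.mk_surjective x
    obtain ⟨y, rfl⟩ := Completion.mk_surjective y
    obtain ⟨z, rfl⟩ := Completion.mk_surjective z
    exact congrArg (Completion.mk A) (mul_add x y z)
  right_distrib x y z := by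
    obtain ⟨x, rfl⟩ := Completion.mk_surjective x
    obtain ⟨y, rfl⟩ := Completion.mk_surjective y
    obtain ⟨z, rfl⟩ := Completion.mk_surjective z
    exact congrArg (Completion.mk A) (add_mul x y z)
  zero_mul x := by
    obtain ⟨x, rfl⟩ := Completion.mk_surjective x
    exact congrArg (Completion.mk A) (zero_mul x)
  mul_zero x := by
    obtain ⟨x, rfl⟩ := Completion.mk_surjective x
    exact congrArg (Completion.mk A) (mul_zero x)
  mul_assoc x y z := by
    obtain ⟨x, rfl⟩ := Completion.mk_surjective x
    obtain ⟨y, rfl⟩ := Completion.mk_surjective y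
    obtain ⟨z, rfl⟩ := Completion.mk_surjective z
    exact congrArg (Completion.mk A) (mul_assoc x y z)

instance : BornAlgebra (Completion A) where
  smul_assoc c x y := by
    obtain ⟨x, rfl⟩ := Completion.mk_surjective x
    obtain ⟨y, rfl⟩ := Completion.mk_surjective y
    exact congrArg (Completion.mk A) (smul_mul_assoc c x y)
  smul_comm c x y := by
    obtain ⟨x, rfl⟩ := Completion.mk_surjective x
    obtain ⟨y, rfl⟩ := Completion.mk_surjective y
    exact congrArg (Completion.mk A) (mul_smul_comm c x y).symm
  isBounded_mul := by
    intro B B' hB hB'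
    obtain ⟨S, hS, h⟩ := Completion.isBounded_iff.1 hB
    obtain ⟨S', hS', h'⟩ := Completion.isBounded_iff.1 hB'
    refine Completion.isBounded_iff.2 ⟨S * S', BornAlgebra.isBounded_mul _ _ hS hS', ?_⟩
    rintro _ ⟨x, hx, y, hy, rfl⟩
    obtain ⟨x, hxS, rfl⟩ := h hx
    obtain ⟨y, hyS, rfl⟩ := h' hy
    exact ⟨x * y, mul_mem_mul hxS hyS, rfl⟩

theorem BornTendsto.mul {x y : ℕ → A} {a b : A} (hx : BornTendsto x a) (hy : BornTendsto y b) :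
    BornTendsto (x * y) (a * b) := by
  obtain ⟨S, hS, -, hx⟩ := hx
  obtain ⟨S', hS', -, hy⟩ := hy
  obtain ⟨T, hT, hTd, -, hST⟩ := exists_disk (hS.union
    (ConvexBornology.isBounded_add _ _ hS (isBounded_singleton (x := a))))
  obtain ⟨T', hT', hTd', h0', hST'⟩ := exists_disk (hS'.union (isBounded_singleton (x := b)))
  obtain ⟨D, hD, hDd, -, hTD⟩ := exists_disk (BornAlgebra.isBounded_mul _ _ hT hT')
  refine ⟨D, hD, hDd, fun ε hε => ?_⟩
  obtain ⟨N₁, h₁⟩ := hx (ε / 2) (by positivity)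
  obtain ⟨N₂, h₂⟩ := hy (ε / 2) (by positivity)
  obtain ⟨N₃, h₃⟩ := hx 1 one_pos
  refine ⟨max N₁ (max N₂ N₃), fun n hn => ?_⟩
  simp only [max_le_iff] at hn
  obtain ⟨s, hs, hs'⟩ := h₁ n hn.1
  obtain ⟨t, ht, ht'⟩ := h₂ n hn.2.1
  have hxn : x n ∈ T := by
    have := h₃ n hn.2.2
    simp only [Complex.ofReal_one, one_smul] at this
    exact hST (Or.inr ⟨_, this, a, rfl, by simp⟩)
  have e₁ : (x n - a) * b ∈ ((ε / 2 : ℝ) : ℂ) • D := by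
    rw [← hs']
    exact ⟨s * b, hTD (mul_mem_mul (hST (Or.inl hs)) (hST' (Or.inr rfl))),
      by simp [smul_mul_assoc]⟩
  have e₂ : x n * (y n - b) ∈ ((ε / 2 : ℝ) : ℂ) • D := by
    rw [← ht']
    exact ⟨x n * t, hTD (mul_mem_mul hxn (hST' (Or.inl ht))), by simp [mul_smul_comm]⟩
  have := hDd.add_mem (by positivity) (by positivity) e₁ e₂
  rw [add_halves] at this
  convert this using 1
  simp only [Pi.mul_apply, sub_mul, mul_sub]
  abel

theorem Completion.of_mul (x y : A) :
    (Completion.of (x * y) : Completion A) = Completion.of x * Completion.of y := rfl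

theorem Completion.lift_mul {B : Type v} [NonUnitalRing B] [Module ℂ B] [Bornology B]
    [BornAlgebra B] [CompleteBornology B] (l : A →ₗ[ℂ] B) (hl : IsBoundedMap l)
    (hm : ∀ x y, l (x * y) = l x * l y) (x y : Completion A) :
    Completion.lift l hl (x * y) = Completion.lift l hl x * Completion.lift l hl y := by
  obtain ⟨x, rfl⟩ := Completion.mk_surjective x
  obtain ⟨y, rfl⟩ := Completion.mk_surjective y
  rw [← Completion.mk_mul, Completion.lift_mk, Completion.lift_mk, Completion.lift_mk]
  refine (limMap_spec l hl (x * y)).unique ?_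
  have := (limMap_spec l hl x).mul (limMap_spec l hl y)
  convert this using 1
  funext n
  exact hm _ _

end Algebra

end Completion

/-! ### Generated bornologies -/

section Generated

variable {V : Type*} [AddCommGroup V] [Module ℂ V]

/-- The smallest convex vector bornology that contains the sets in `G`. -/
@[reducible]
def generatedBornology (G : Set (Set V)) : Bornology V :=
  Bornology.ofBounded {S | ∀ b : Bornology V, @ConvexBornology V _ _ b →
      (∀ T ∈ G, @IsBounded V b T) → @IsBounded V b S}
    (fun b _ _ => @isBounded_empty V b)
    (fun _ hS _ hT b hb hG => @IsBounded.subset V b _ _ (hS b hb hG) hT)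
    (fun _ hS _ hT b hb hG => @IsBounded.union V b _ _ (hS b hb hG) (hT b hb hG))
    (fun x b _ _ => @isBounded_singleton V b x)

theorem generatedBornology_isBounded_iff {G : Set (Set V)} {S : Set V} :
    @IsBounded V (generatedBornology G) S ↔
      ∀ b : Bornology V, @ConvexBornology V _ _ b → (∀ T ∈ G, @IsBounded V b T) →
        @IsBounded V b S :=
  isBounded_ofBounded_iff _

theorem convexBornology_generated (G : Set (Set V)) :
    @ConvexBornology V _ _ (generatedBornology G) :=
  @ConvexBornology.mk V _ _ (generatedBornology G)
    (fun S T hS hT => generatedBornology_isBounded_iff.2 fun b hb hG =>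
      hb.isBounded_add S T (generatedBornology_isBounded_iff.1 hS b hb hG)
        (generatedBornology_isBounded_iff.1 hT b hb hG))
    (fun S hS => generatedBornology_isBounded_iff.2 fun b hb hG =>
      hb.isBounded_diskHull S (generatedBornology_isBounded_iff.1 hS b hb hG))

theorem isBounded_generator {G : Set (Set V)} {S : Set V} (hS : S ∈ G) :
    @IsBounded V (generatedBornology G) S :=
  generatedBornology_isBounded_iff.2 fun _ _ hG => hG S hS

variable {W : Type*} [AddCommGroup W] [Module ℂ W] [Bornology W] [ConvexBornology W]

/-- Induction principle for generated bornologies. -/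
theorem generatedBornology_induction {G : Set (Set V)} {P : Set V → Prop}
    (hG : ∀ T ∈ G, P T) (hsingle : ∀ x, P {x}) (hsub : ∀ S T, P S → T ⊆ S → P T)
    (hunion : ∀ S T, P S → P T → P (S ∪ T)) (hadd : ∀ S T, P S → P T → P (S + T))
    (hdisk : ∀ S, P S → P (diskHull S)) {S : Set V}
    (hS : @IsBounded V (generatedBornology G) S) : P S := by
  let b : Bornology V := Bornology.ofBounded {S | P S}
    (hsub _ _ (hsingle 0) (empty_subset _)) (fun S hS T hT => hsub S T hS hT)
    (fun S hS T hT => hunion S T hS hT) hsingle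
  have hb : ∀ S, @IsBounded V b S ↔ P S := fun S => isBounded_ofBounded_iff _
  have := generatedBornology_isBounded_iff.1 hS b
    (@ConvexBornology.mk V _ _ b (fun S T hS hT => (hb _).2 (hadd S T ((hb _).1 hS) ((hb _).1 hT)))
      (fun S hS => (hb _).2 (hdisk S ((hb _).1 hS)))) (fun T hT => (hb _).2 (hG T hT))
  exact (hb S).1 this

theorem isBounded_image_generated {G : Set (Set V)} (l : V →ₗ[ℂ] W)
    (hl : ∀ T ∈ G, IsBounded (l '' T)) {S : Set V}
    (hS : @IsBounded V (generatedBornology G) S) : IsBounded (l '' S) := by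
  refine generatedBornology_induction (P := fun S => IsBounded (l '' S)) hl ?_ ?_ ?_ ?_ ?_ hS
  · intro x
    simp [isBounded_singleton]
  · intro S T hS hT
    exact hS.subset (image_mono hT)
  · intro S T hS hT
    rw [image_union]
    exact hS.union hT
  · intro S T hS hT
    rw [image_add]
    exact ConvexBornology.isBounded_add _ _ hS hT
  · intro S hS
    exact (ConvexBornology.isBounded_diskHull _ hS).subset (image_diskHull_subset l S)

theorem isBounded_image2_generated {G : Set (Set V)} (hspan : Submodule.span ℂ (⋃₀ G) = ⊤)
    (m : V →ₗ[ℂ] V →ₗ[ℂ] W)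
    (hm : ∀ S ∈ G, ∀ T ∈ G, IsBounded (image2 (fun x y => m x y) S T)) {S T : Set V}
    (hS : @IsBounded V (generatedBornology G) S) (hT : @IsBounded V (generatedBornology G) T) :
    IsBounded (image2 (fun x y => m x y) S T) := by
  -- a general step: from generators to all small sets in one variable
  have step : ∀ (Q : Set V) (f : V →ₗ[ℂ] V →ₗ[ℂ] W),
      (∀ T ∈ G, IsBounded (image2 (fun x y => f x y) Q T)) →
      ∀ T, @IsBounded V (generatedBornology G) T → IsBounded (image2 (fun x y => f x y) Q T) := by
    intro Q f hf T hT
    have hpt : ∀ y : V, IsBounded ((fun x => f x y) '' Q) := by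
      intro y
      have hy : y ∈ Submodule.span ℂ (⋃₀ G) := hspan ▸ Submodule.mem_top
      induction hy using Submodule.span_induction with
      | mem y hy =>
        obtain ⟨T, hT, hyT⟩ := hy
        refine (hf T hT).subset ?_
        rintro _ ⟨x, hx, rfl⟩
        exact ⟨x, hx, y, hyT, rfl⟩
      | zero =>
        refine (isBounded_singleton (x := (0 : W))).subset ?_
        rintro _ ⟨x, hx, rfl⟩
        simp
      | add y z _ _ hy hz =>
        refine (ConvexBornology.isBounded_add _ _ hy hz).subset ?_
        rintro _ ⟨x, hx, rfl⟩
        exact ⟨_, ⟨x, hx, rfl⟩, _, ⟨x, hx, rfl⟩, by simp⟩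
      | smul c y _ hy =>
        refine (isBounded_smul hy c).subset ?_
        rintro _ ⟨x, hx, rfl⟩
        exact ⟨_, ⟨x, hx, rfl⟩, by simp⟩
    refine generatedBornology_induction
      (P := fun T => IsBounded (image2 (fun x y => f x y) Q T)) hf ?_ ?_ ?_ ?_ ?_ hT
    · intro y
      simpa [image2_singleton_right] using hpt y
    · intro S T hS hT
      exact hS.subset (image2_subset_left hT)
    · intro S T hS hT
      rw [image2_union_right]
      exact hS.union hT
    · intro S T hS hT
      refine (ConvexBornology.isBounded_add _ _ hS hT).subset ?_
      rintro _ ⟨x, hx, _, ⟨y, hy, z, hz, rfl⟩, rfl⟩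
      exact ⟨_, ⟨x, hx, y, hy, rfl⟩, _, ⟨x, hx, z, hz, rfl⟩, by simp⟩
    · intro S hS
      refine (ConvexBornology.isBounded_diskHull _ hS).subset ?_
      rintro _ ⟨x, hx, y, hy, rfl⟩
      have h1 : f x y ∈ f x '' diskHull S := ⟨y, hy, rfl⟩
      refine diskHull_mono ?_ (image_diskHull_subset (f x) S h1)
      rintro _ ⟨z, hz, rfl⟩
      exact ⟨x, hx, z, hz, rfl⟩
  have h1 : ∀ S ∈ G, IsBounded (image2 (fun x y => m x y) S T) := fun S hS => step S m (hm S hS) T hT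
  have h2 := step T m.flip (fun S hS => by
    rw [image2_swap]
    exact h1 S hS) S hS
  rw [image2_swap]
  exact h2

end Generated

/-! ### Noncommutative differential forms and the analytic tensor algebra -/

section Omega

variable (A : Type u) [NonUnitalRing A] [Module ℂ A]

/-- The relations of the differential envelope, for generators `(a, b)` that stand for
`a + d b`: the map `a ↦ a` is multiplicative and `d (a b) = d a · b + a · d b`. -/
inductive OmegaRel : TensorAlgebra ℂ (A × A) → TensorAlgebra ℂ (A × A) → Prop
  | mul (a b : A) : OmegaRel (TensorAlgebra.ι ℂ (a * b, 0))
      (TensorAlgebra.ι ℂ (a, 0) * TensorAlgebra.ι ℂ (b, 0))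
  | d_mul (a b : A) : OmegaRel (TensorAlgebra.ι ℂ (0, a * b))
      (TensorAlgebra.ι ℂ (0, a) * TensorAlgebra.ι ℂ (b, 0) +
        TensorAlgebra.ι ℂ (a, 0) * TensorAlgebra.ι ℂ (0, b))

/-- The differential envelope `Ω A` of `A` with a unit adjoined: the unital algebra generated by
symbols `a` and `d a` for `a ∈ A`, linear in `a`, subject to the relations above. -/
def OmegaUnital : Type u := RingQuot (OmegaRel A)

noncomputable instance : Ring (OmegaUnital A) := inferInstanceAs (Ring (RingQuot (OmegaRel A)))
noncomputable instance : Algebra ℂ (OmegaUnital A) :=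
  inferInstanceAs (Algebra ℂ (RingQuot (OmegaRel A)))

namespace OmegaUnital

variable {A}

/-- The degree zero form `a`. -/
noncomputable def inc : A →ₗ[ℂ] OmegaUnital A :=
  (RingQuot.mkAlgHom ℂ (OmegaRel A)).toLinearMap.comp
    ((TensorAlgebra.ι ℂ).comp (LinearMap.inl ℂ A A))

/-- The generator `d a`. -/
noncomputable def dgen : A →ₗ[ℂ] OmegaUnital A :=
  (RingQuot.mkAlgHom ℂ (OmegaRel A)).toLinearMap.comp
    ((TensorAlgebra.ι ℂ).comp (LinearMap.inr ℂ A A))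

theorem inc_mul (a b : A) : inc (a * b) = inc a * inc b :=
  (RingQuot.mkAlgHom_rel ℂ (OmegaRel.mul a b)).trans (map_mul _ _ _)

theorem dgen_mul (a b : A) : dgen (a * b) = dgen a * inc b + inc a * dgen b :=
  (RingQuot.mkAlgHom_rel ℂ (OmegaRel.d_mul a b)).trans
    ((map_add _ _ _).trans (congrArg₂ _ (map_mul _ _ _) (map_mul _ _ _)))

/-- The universal property of the presentation. -/
noncomputable def lift {B : Type*} [Ring B] [Algebra ℂ B] (f D : A →ₗ[ℂ] B)
    (hf : ∀ a b, f (a * b) = f a * f b) (hD : ∀ a b, D (a * b) = D a * f b + f a * D b) :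
    OmegaUnital A →ₐ[ℂ] B :=
  RingQuot.liftAlgHom ℂ ⟨TensorAlgebra.lift ℂ (f.coprod D), by
    rintro _ _ (⟨a, b⟩ | ⟨a, b⟩)
    · simp [hf]
    · simp [hD]⟩

section
variable {B : Type*} [Ring B] [Algebra ℂ B] (f D : A →ₗ[ℂ] B)
    (hf : ∀ a b, f (a * b) = f a * f b) (hD : ∀ a b, D (a * b) = D a * f b + f a * D b)

@[simp] theorem lift_inc (a : A) : lift f D hf hD (inc a) = f a := by
  refine (RingQuot.liftAlgHom_mkAlgHom_apply ℂ _ _ _).trans ?_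
  simp

@[simp] theorem lift_dgen (a : A) : lift f D hf hD (dgen a) = D a := by
  refine (RingQuot.liftAlgHom_mkAlgHom_apply ℂ _ _ _).trans ?_
  simp
end

theorem induction {P : OmegaUnital A → Prop} (hc : ∀ c : ℂ, P (algebraMap ℂ _ c))
    (hinc : ∀ a, P (inc a)) (hd : ∀ a, P (dgen a)) (hadd : ∀ x y, P x → P y → P (x + y))
    (hmul : ∀ x y, P x → P y → P (x * y)) (x : OmegaUnital A) : P x := by
  obtain ⟨x, rfl⟩ := RingQuot.mkAlgHom_surjective ℂ (OmegaRel A) x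
  induction x using TensorAlgebra.induction with
  | algebraMap c =>
    rw [AlgHom.commutes]
    exact hc c
  | ι v =>
    have : RingQuot.mkAlgHom ℂ (OmegaRel A) (TensorAlgebra.ι ℂ v) = inc v.1 + dgen v.2 := by
      change _ = RingQuot.mkAlgHom ℂ (OmegaRel A) (TensorAlgebra.ι ℂ (v.1, 0)) +
        RingQuot.mkAlgHom ℂ (OmegaRel A) (TensorAlgebra.ι ℂ (0, v.2))
      rw [← map_add, ← map_add]
      simp
    rw [this]
    exact hadd _ _ (hinc _) (hd _)
  | mul x y hx hy =>
    rw [map_mul]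
    exact hmul _ _ hx hy
  | add x y hx hy =>
    rw [map_add]
    exact hadd _ _ hx hy

/-- The augmentation, with kernel `Ω A`. -/
noncomputable def aug : OmegaUnital A →ₐ[ℂ] ℂ := lift 0 0 (by simp) (by simp)

/-- The grading automorphism: multiplication by `(-1) ^ n` on forms of degree `n`. -/
noncomputable def grade : OmegaUnital A →ₐ[ℂ] OmegaUnital A :=
  lift inc (-dgen) inc_mul (by
    intro a b
    simp only [LinearMap.neg_apply, dgen_mul]
    noncomm_ring)

/-- The homomorphism `x ↦ !![grade x, d x; 0, x]` that is used to define `d`. -/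
noncomputable def matHom : OmegaUnital A →ₐ[ℂ] Matrix (Fin 2) (Fin 2) (OmegaUnital A) :=
  lift
    { toFun := fun a => !![inc a, dgen a; 0, inc a]
      map_add' := fun a b => by ext i j; fin_cases i <;> fin_cases j <;> simp
      map_smul' := fun c a => by ext i j; fin_cases i <;> fin_cases j <;> simp }
    { toFun := fun a => !![-dgen a, 0; 0, dgen a]
      map_add' := fun a b => by ext i j; fin_cases i <;> fin_cases j <;> simp [add_comm]
      map_smul' := fun c a => by ext i j; fin_cases i <;> fin_cases j <;> simp }
    (by
      intro a b
      ext i j; fin_cases i <;> fin_cases j <;> simp [inc_mul, dgen_mul, Matrix.mul_apply, add_comm])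
    (by
      intro a b
      ext i j; fin_cases i <;> fin_cases j <;>
        simp [dgen_mul, add_comm])

theorem matHom_eq (x : OmegaUnital A) :
    matHom x 0 0 = grade x ∧ matHom x 1 0 = 0 ∧ matHom x 1 1 = x := by
  induction x using induction with
  | hc c => simp [Matrix.algebraMap_matrix_apply]
  | hinc a => simp [matHom, grade]
  | hd a => simp [matHom, grade]
  | hadd x y hx hy => simp [hx, hy]
  | hmul x y hx hy => simp [hx, hy, Matrix.mul_apply]

/-- The differential `d`, the graded derivation with `d (inc a) = dgen a`, `d (dgen a) = 0`. -/
noncomputable def d : OmegaUnital A →ₗ[ℂ] OmegaUnital A where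
  toFun x := matHom x 0 1
  map_add' x y := by simp
  map_smul' c x := by simp

theorem d_mul (x y : OmegaUnital A) : d (x * y) = d x * y + grade x * d y := by
  simp [d, Matrix.mul_apply, matHom_eq, add_comm]

@[simp] theorem d_inc (a : A) : d (inc a) = dgen a := by simp [d, matHom]
@[simp] theorem d_dgen (a : A) : d (dgen a) = 0 := by simp [d, matHom]
@[simp] theorem d_algebraMap (c : ℂ) : d (algebraMap ℂ (OmegaUnital A) c) = 0 := by
  simp [d, Matrix.algebraMap_matrix_apply]
@[simp] theorem grade_inc (a : A) : grade (inc a) = inc a := by simp [grade]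
@[simp] theorem grade_dgen (a : A) : grade (dgen a) = -dgen a := by simp [grade]

theorem grade_d (x : OmegaUnital A) : grade (d x) = -d (grade x) := by
  induction x using induction with
  | hc c => simp
  | hinc a => simp
  | hd a => simp
  | hadd x y hx hy => simp [hx, hy, add_comm]
  | hmul x y hx hy => simp only [d_mul, map_add, map_mul, hx, hy]; noncomm_ring

theorem grade_grade (x : OmegaUnital A) : grade (grade x) = x := by
  induction x using induction with
  | hc c => simp
  | hinc a => simp
  | hd a => simp
  | hadd x y hx hy => simp [hx, hy]
  | hmul x y hx hy => simp [hx, hy]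

theorem d_d (x : OmegaUnital A) : d (d x) = 0 := by
  induction x using induction with
  | hc c => simp
  | hinc a => simp
  | hd a => simp
  | hadd x y hx hy => simp [hx, hy]
  | hmul x y hx hy => simp only [d_mul, map_add, hx, hy, grade_d]; noncomm_ring

theorem aug_d (x : OmegaUnital A) : aug (d x) = 0 := by
  induction x using induction with
  | hc c => simp
  | hinc a => simp [aug]
  | hd a => simp
  | hadd x y hx hy => simp [hx, hy]
  | hmul x y hx hy => simp [d_mul, hx, hy]

theorem aug_grade (x : OmegaUnital A) : aug (grade x) = aug x := by
  induction x using induction with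
  | hc c => simp
  | hinc a => simp
  | hd a => simp [aug]
  | hadd x y hx hy => simp [hx, hy]
  | hmul x y hx hy => simp [hx, hy]

end OmegaUnital

open OmegaUnital

/-- The differential envelope `Ω A` (without unit), as the kernel of the augmentation of
`OmegaUnital A`.  As a type with multiplication, it carries the Fedosov product. -/
def FedosovOmega : Type u := LinearMap.ker (aug (A := A)).toLinearMap

noncomputable instance : AddCommGroup (FedosovOmega A) :=
  inferInstanceAs (AddCommGroup (LinearMap.ker (aug (A := A)).toLinearMap))
noncomputable instance : Module ℂ (FedosovOmega A) :=
  inferInstanceAs (Module ℂ (LinearMap.ker (aug (A := A)).toLinearMap))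

variable {A}

namespace FedosovOmega

/-- The inclusion of `Ω A` into `OmegaUnital A`. -/
noncomputable def val : FedosovOmega A →ₗ[ℂ] OmegaUnital A :=
  (LinearMap.ker (aug (A := A)).toLinearMap).subtype

theorem val_injective : Function.Injective (val : FedosovOmega A → OmegaUnital A) :=
  Subtype.val_injective

theorem aug_val (x : FedosovOmega A) : aug (val x) = 0 := x.2

/-- The Fedosov product `x ⊙ y = x y - (-1) ^ (deg x) dx dy`. -/
noncomputable instance : Mul (FedosovOmega A) where
  mul x y := ⟨val x * val y - d (grade (val x)) * d (val y), by
    simp [aug_val, aug_d]⟩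

theorem val_mul (x y : FedosovOmega A) :
    val (x * y) = val x * val y - d (grade (val x)) * d (val y) := rfl

noncomputable instance : NonUnitalRing (FedosovOmega A) where
  toAddCommGroup := inferInstance
  left_distrib x y z := val_injective <| by
    simp only [val_mul, map_add]; noncomm_ring
  right_distrib x y z := val_injective <| by
    simp only [val_mul, map_add]; noncomm_ring
  zero_mul x := val_injective <| by simp [val_mul]
  mul_zero x := val_injective <| by simp [val_mul]
  mul_assoc x y z := val_injective <| by
    simp only [val_mul, map_sub, map_mul, map_neg, d_mul, d_d, grade_d, grade_grade, neg_zero,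
      zero_mul, mul_zero]
    noncomm_ring

end FedosovOmega

namespace OmegaUnital

variable [IsScalarTower ℂ A A] [SMulCommClass ℂ A A]

/-- The form `d a₁ ⋯ d aₙ`. -/
noncomputable def dprod (l : List A) : OmegaUnital A := (l.map dgen).prod

theorem dprod_append (l l' : List A) : dprod (l ++ l') = dprod l * dprod l' := by
  simp [dprod]

theorem dprod_cons (a : A) (l : List A) : dprod (a :: l) = dgen a * dprod l := by
  simp [dprod]

theorem d_dprod (l : List A) : d (dprod l) = 0 := by
  induction l with
  | nil =>
    have := d_algebraMap (A := A) 1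
    simpa [dprod] using this
  | cons a l ih => simp [dprod_cons, d_mul, ih]

theorem grade_dprod (l : List A) : grade (dprod l) = dprod (l.map (fun a => -a)) := by
  induction l with
  | nil => simp [dprod]
  | cons a l ih => simp [dprod_cons, ih]

theorem dprod_two (l : List A) :
    dprod (l.map (fun a => (2 : ℂ) • a)) = (2 : ℂ) ^ l.length • dprod l := by
  induction l with
  | nil => simp [dprod]
  | cons a l ih => simp [dprod_cons, ih, smul_smul, pow_succ, mul_comm]

theorem aug_dprod {l : List A} (hl : l ≠ []) : aug (dprod l) = 0 := by
  cases l with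
  | nil => exact absurd rfl hl
  | cons a l => simp [dprod_cons, aug]

theorem key_mem {Q : Set (OmegaUnital A)} (hQ : IsDisk Q) {S R : Set A} (hSR : S ⊆ R)
    (hSS : S * S ⊆ R) {p : OmegaUnital A}
    (h1 : ∀ l : List A, l ≠ [] → (∀ a ∈ l, a ∈ R) → p * dprod l ∈ Q)
    (h2 : ∀ b ∈ S, ∀ l : List A, (∀ a ∈ l, a ∈ R) → p * inc b * dprod l ∈ Q) (l : List A) :
    (∀ a ∈ l, a ∈ S) → ∀ b ∈ S, ∀ l' : List A, (∀ a ∈ l', a ∈ R) →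
      ((1 / 2 : ℂ) ^ l.length) • (p * dprod l * inc b * dprod l') ∈ Q := by
  induction l using List.reverseRecOn with
  | nil =>
    intro _ b hb l' hl'
    simpa [dprod] using h2 b hb l' hl'
  | append_singleton l a ih =>
    intro hl b hb l' hl'
    have ha : a ∈ S := hl a (by simp)
    have hl0 : ∀ c ∈ l, c ∈ S := fun c hc => hl c (by simp [hc])
    have e1 := ih hl0 a ha (b :: l') (by
      intro c hc
      rcases List.mem_cons.1 hc with rfl | hc
      · exact hSR hb
      · exact hl' c hc)
    have e2 : p * dprod (l ++ [a * b] ++ l') ∈ Q := h1 _ (by simp) (by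
      intro c hc
      simp only [List.append_assoc, List.cons_append, List.nil_append, List.mem_append,
        List.mem_cons] at hc
      rcases hc with hc | rfl | hc
      · exact hSR (hl0 c hc)
      · exact hSS (mul_mem_mul ha hb)
      · exact hl' c hc)
    have e3 : ((1 / 2 : ℂ) ^ l.length) • (p * dprod (l ++ [a * b] ++ l')) ∈ Q :=
      hQ.smul_mem e2 (by
        rw [norm_pow]
        exact pow_le_one₀ (norm_nonneg _) (by norm_num))
    have := hQ e3 e1 (1 / 2) (-(1 / 2)) (by norm_num)
    convert this using 1
    have hd : dgen a * inc b = dgen (a * b) - inc a * dgen b := by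
      rw [dgen_mul]; abel
    have e : p * dprod (l ++ [a]) * inc b * dprod l' =
        p * dprod (l ++ [a * b] ++ l') - p * dprod l * inc a * dprod (b :: l') := by
      have : p * dprod (l ++ [a]) * inc b * dprod l' =
          p * dprod l * (dgen a * inc b) * dprod l' := by
        simp only [dprod_append, dprod_cons, mul_assoc]
        simp [dprod]
      rw [this, hd]
      simp only [dprod_append, dprod_cons, mul_sub, sub_mul, mul_assoc]
      simp [dprod]
    rw [e, List.length_append, List.length_singleton, pow_succ]
    module

/-- The linear span of the forms `⟨a₀⟩ d a₁ ⋯ d aₙ`. -/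
noncomputable def formSpan (A : Type u) [NonUnitalRing A] [Module ℂ A] :
    Submodule ℂ (OmegaUnital A) :=
  Submodule.span ℂ ({x | ∃ l : List A, x = dprod l} ∪ {x | ∃ (a : A) (l : List A),
    x = inc a * dprod l})

theorem formSpan_eq_top : formSpan A = ⊤ := by
  have hQ : IsDisk (formSpan A : Set (OmegaUnital A)) := fun x hx y hy a b _ =>
    add_mem (Submodule.smul_mem _ a hx) (Submodule.smul_mem _ b hy)
  have m1 : ∀ l : List A, dprod l ∈ formSpan A := fun l =>
    Submodule.subset_span (Or.inl ⟨l, rfl⟩)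
  have m2 : ∀ (a : A) (l : List A), inc a * dprod l ∈ formSpan A := fun a l =>
    Submodule.subset_span (Or.inr ⟨a, l, rfl⟩)
  have scale : ∀ (n : ℕ) (x : OmegaUnital A), (1 / 2 : ℂ) ^ n • x ∈ formSpan A →
      x ∈ formSpan A := fun n x hx =>
    (Submodule.smul_mem_iff _ (pow_ne_zero _ (by norm_num))).1 hx
  have k1 : ∀ (l : List A) (b : A), dprod l * inc b ∈ formSpan A := fun l b => by
    have := key_mem hQ (S := univ) (R := univ) (subset_univ _) (subset_univ _) (p := 1)
      (fun l _ _ => by simpa using m1 l) (fun b _ l _ => by simpa using m2 b l) l (by simp) b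
      (mem_univ b) [] (by simp)
    simpa [dprod] using scale _ _ this
  have k2 : ∀ (a : A) (l : List A) (b : A), inc a * dprod l * inc b ∈ formSpan A :=
    fun a l b => by
    have := key_mem hQ (S := univ) (R := univ) (subset_univ _) (subset_univ _) (p := inc a)
      (fun l _ _ => m2 a l) (fun b _ l _ => by rw [← inc_mul]; exact m2 (a * b) l) l (by simp) b
      (mem_univ b) [] (by simp)
    simpa [dprod] using scale _ _ this
  have main : ∀ u x : OmegaUnital A, x ∈ formSpan A → x * u ∈ formSpan A := by
    intro u
    induction u using induction with
    | hc c =>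
      intro x hx
      rw [← Algebra.commutes, ← Algebra.smul_def]
      exact Submodule.smul_mem _ _ hx
    | hadd u v hu hv =>
      intro x hx
      rw [mul_add]
      exact add_mem (hu x hx) (hv x hx)
    | hmul u v hu hv =>
      intro x hx
      rw [← mul_assoc]
      exact hv _ (hu x hx)
    | hinc b =>
      intro x hx
      induction hx using Submodule.span_induction with
      | mem x hx =>
        rcases hx with ⟨l, rfl⟩ | ⟨a, l, rfl⟩
        · exact k1 l b
        · exact k2 a l b
      | zero => simp
      | add x y _ _ hx hy => rw [add_mul]; exact add_mem hx hy
      | smul c x _ hx => rw [smul_mul_assoc]; exact Submodule.smul_mem _ _ hx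
    | hd b =>
      intro x hx
      have e : ∀ l : List A, dprod l * dgen b = dprod (l ++ [b]) := fun l => by
        simp [dprod]
      induction hx using Submodule.span_induction with
      | mem x hx =>
        rcases hx with ⟨l, rfl⟩ | ⟨a, l, rfl⟩
        · rw [e]; exact m1 _
        · rw [mul_assoc, e]; exact m2 _ _
      | zero => simp
      | add x y _ _ hx hy => rw [add_mul]; exact add_mem hx hy
      | smul c x _ hx => rw [smul_mul_assoc]; exact Submodule.smul_mem _ _ hx
  rw [eq_top_iff]
  intro u _
  have h1 : (1 : OmegaUnital A) ∈ formSpan A := by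
    have := m1 []
    simpa [dprod] using this
  simpa using main u 1 h1

/-- The degree zero component, as a homomorphism to the unitization of `A`. -/
noncomputable def degZero : OmegaUnital A →ₐ[ℂ] Unitization ℂ A :=
  lift (Unitization.inrHom ℂ ℂ A) 0 (fun a b => Unitization.inr_mul ℂ a b) (by simp)

theorem degZero_inc (a : A) : degZero (inc a) = (Unitization.inr a : Unitization ℂ A) :=
  lift_inc _ _ _ _ a

theorem degZero_dgen (a : A) : degZero (dgen a) = 0 :=
  lift_dgen _ _ _ _ a

theorem degZero_d (x : OmegaUnital A) : degZero (d x) = 0 := by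
  induction x using induction with
  | hc c => simp
  | hinc a => simp [degZero_dgen]
  | hd a => simp
  | hadd x y hx hy => simp [hx, hy]
  | hmul x y hx hy => simp [d_mul, hx, hy]

theorem degZero_fst (x : OmegaUnital A) : (degZero x).fst = aug x := by
  induction x using induction with
  | hc c => simp [Unitization.algebraMap_eq_inl]
  | hinc a => simp [degZero_inc, aug]
  | hd a => simp [degZero_dgen, aug]
  | hadd x y hx hy => simp [hx, hy]
  | hmul x y hx hy => simp [hx, hy]

end OmegaUnital

end Omega

section OmegaBornology

open OmegaUnital

variable {A : Type u} [NonUnitalRing A] [Module ℂ A] [Bornology A] [BornAlgebra A]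

namespace FedosovOmega

/-- The set `⟨S⟩(dS)^∞ = S (dS)^∞ ∪ (dS)^∞ ∪ S` of the forms `a₀ da₁ ⋯ daₙ` with `n ≥ 0` and
`da₁ ⋯ daₙ` with `n ≥ 1`, where all `aᵢ ∈ S`. -/
def forms (S : Set A) : Set (FedosovOmega A) :=
  {x | ∃ l : List A, (∀ a ∈ l, a ∈ S) ∧
    ((∃ a₀ ∈ S, val x = inc a₀ * dprod l) ∨ (l ≠ [] ∧ val x = dprod l))}

/-- The bornology `𝔖_an` on `Ω A`, generated by the sets `⟨S⟩(dS)^∞` for small `S`. -/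
noncomputable instance : Bornology (FedosovOmega A) :=
  generatedBornology {G | ∃ S : Set A, IsBounded S ∧ G = forms S}

instance : ConvexBornology (FedosovOmega A) := convexBornology_generated _

theorem isBounded_forms {S : Set A} (hS : IsBounded S) : IsBounded (forms S) :=
  isBounded_generator ⟨S, hS, rfl⟩

theorem forms_mono {S T : Set A} (h : S ⊆ T) : forms S ⊆ forms T := by
  rintro x ⟨l, hl, h' | h'⟩
  · obtain ⟨a, ha, h'⟩ := h'
    exact ⟨l, fun b hb => h (hl b hb), Or.inl ⟨a, h ha, h'⟩⟩
  · exact ⟨l, fun b hb => h (hl b hb), Or.inr h'⟩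

theorem inc_dprod_mem_forms {S : Set A} {a : A} (ha : a ∈ S) {l : List A}
    (hl : ∀ a ∈ l, a ∈ S) : inc a * dprod l ∈ val '' forms S :=
  ⟨⟨inc a * dprod l, by simp [aug]⟩, ⟨l, hl, Or.inl ⟨a, ha, rfl⟩⟩, rfl⟩

theorem dprod_mem_forms {S : Set A} {l : List A} (h : l ≠ []) (hl : ∀ a ∈ l, a ∈ S) :
    dprod l ∈ val '' forms S :=
  ⟨⟨dprod l, aug_dprod h⟩, ⟨l, hl, Or.inr ⟨h, rfl⟩⟩, rfl⟩

theorem span_forms : Submodule.span ℂ (⋃₀ {G | ∃ S : Set A, IsBounded S ∧ G = forms S}) = ⊤ := by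
  rw [eq_top_iff]
  intro x _
  set M := Submodule.span ℂ (⋃₀ {G | ∃ S : Set A, IsBounded S ∧ G = forms S}) with hM
  have hfin : ∀ l : List A, IsBounded {a | a ∈ l} := fun l =>
    l.finite_toSet.isBounded
  have key : ∀ u ∈ formSpan A, u - algebraMap ℂ _ (aug u) ∈ M.map val := by
    intro u hu
    induction hu using Submodule.span_induction with
    | mem u hu =>
      rcases hu with ⟨l, rfl⟩ | ⟨a, l, rfl⟩
      · rcases eq_or_ne l [] with rfl | hl
        · simp [dprod]
        · rw [aug_dprod hl, map_zero, sub_zero]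
          obtain ⟨y, hy, hy'⟩ := dprod_mem_forms (S := {a | a ∈ l}) hl (fun _ h => h)
          exact ⟨y, Submodule.subset_span ⟨_, ⟨_, hfin l, rfl⟩, hy⟩, hy'⟩
      · have : aug (inc a * dprod l) = 0 := by simp [aug]
        rw [this, map_zero, sub_zero]
        obtain ⟨y, hy, hy'⟩ := inc_dprod_mem_forms (S := {b | b ∈ a :: l}) (a := a) (l := l)
          (by simp) (fun b hb => by simp [hb])
        exact ⟨y, Submodule.subset_span ⟨_, ⟨_, hfin _, rfl⟩, hy⟩, hy'⟩
    | zero => simp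
    | add u v _ _ hu hv =>
      have := add_mem hu hv
      convert this using 1
      simp only [map_add]; abel
    | smul c u _ hu =>
      have := Submodule.smul_mem _ c hu
      convert this using 1
      simp [Algebra.smul_def, mul_sub]
  have hx := key (val x) (formSpan_eq_top (A := A) ▸ Submodule.mem_top)
  rw [aug_val, map_zero, sub_zero] at hx
  obtain ⟨y, hy, hyx⟩ := hx
  rwa [← val_injective hyx]

/-- The product of differential forms (before the Fedosov deformation) of two generators. -/
theorem mul_forms_aux {S : Set A} {x y : FedosovOmega A} (hx : x ∈ forms S)
    (hy : y ∈ forms S) {R : Set A} (h2 : (2 : ℂ) • S ⊆ R) (h1 : S ⊆ R)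
    (hm : (S ∪ (2 : ℂ) • S) * (S ∪ (2 : ℂ) • S) ⊆ R) :
    val x * val y ∈ val '' diskHull (forms R) := by
  have hQ : IsDisk (val '' diskHull (forms R)) := (isDisk_diskHull _).image _
  have sub : val '' forms R ⊆ val '' diskHull (forms R) := image_mono (subset_diskHull _)
  have hSR : S ∪ (2 : ℂ) • S ⊆ R := union_subset h1 h2
  -- the key estimate, freed from powers of two
  have key : ∀ p : OmegaUnital A,
      (∀ l : List A, l ≠ [] → (∀ a ∈ l, a ∈ R) → p * dprod l ∈ val '' diskHull (forms R)) →
      (∀ b ∈ S ∪ (2 : ℂ) • S, ∀ l : List A, (∀ a ∈ l, a ∈ R) →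
        p * inc b * dprod l ∈ val '' diskHull (forms R)) →
      ∀ l : List A, (∀ a ∈ l, a ∈ S) → ∀ b ∈ S, ∀ l' : List A, (∀ a ∈ l', a ∈ S) →
        p * dprod l * (inc b * dprod l') ∈ val '' diskHull (forms R) := by
    intro p hp1 hp2 l hl b hb l' hl'
    have := key_mem hQ hSR hm hp1 hp2 (l.map fun a => (2 : ℂ) • a) (by
      intro a ha
      obtain ⟨c, hc, rfl⟩ := List.mem_map.1 ha
      exact Or.inr ⟨c, hl c hc, rfl⟩) b (Or.inl hb) l' (fun a ha => h1 (hl' a ha))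
    rw [dprod_two, List.length_map] at this
    simp only [mul_smul_comm, smul_mul_assoc, smul_smul, ← mul_pow] at this
    norm_num at this
    simpa [mul_assoc] using this
  obtain ⟨l, hl, hx⟩ := hx
  obtain ⟨l', hl', hy⟩ := hy
  have hlR : ∀ a ∈ l, a ∈ R := fun a ha => h1 (hl a ha)
  have hlR' : ∀ a ∈ l', a ∈ R := fun a ha => h1 (hl' a ha)
  have happ : ∀ a ∈ l ++ l', a ∈ R := fun a ha =>
    (List.mem_append.1 ha).elim (hlR a) (hlR' a)
  rcases hy with ⟨b, hb, hy⟩ | ⟨hne', hy⟩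
  · rcases hx with ⟨a, ha, hx⟩ | ⟨hne, hx⟩
    · rw [hx, hy]
      refine key (inc a) (fun l _ hl => sub (inc_dprod_mem_forms (h1 ha) hl)) ?_ l hl b hb l' hl'
      intro b hb l hl
      rw [← inc_mul]
      exact sub (inc_dprod_mem_forms (hm (mul_mem_mul (Or.inl ha) hb)) hl)
    · rw [hx, hy]
      have := key 1 (fun l hne hl => by rw [one_mul]; exact sub (dprod_mem_forms hne hl))
        (fun b hb l hl => by rw [one_mul]; exact sub (inc_dprod_mem_forms (hSR hb) hl))
        l hl b hb l' hl'
      rwa [one_mul] at this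
  · rcases hx with ⟨a, ha, hx⟩ | ⟨hne, hx⟩
    · rw [hx, hy, mul_assoc, ← dprod_append]
      exact sub (inc_dprod_mem_forms (h1 ha) happ)
    · rw [hx, hy, ← dprod_append]
      exact sub (dprod_mem_forms (by simp [hne]) happ)

theorem d_forms_aux {S : Set A} {x : FedosovOmega A} (hx : x ∈ forms S) :
    d (val x) = 0 ∨ ∃ l : List A, l ≠ [] ∧ (∀ a ∈ l, a ∈ S) ∧ d (val x) = dprod l := by
  obtain ⟨l, hl, ⟨a, ha, hx⟩ | ⟨-, hx⟩⟩ := hx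
  · right
    refine ⟨a :: l, by simp, ?_, ?_⟩
    · intro b hb
      rcases List.mem_cons.1 hb with rfl | hb
      · exact ha
      · exact hl b hb
    · rw [hx, d_mul, d_dprod, d_inc, dprod_cons]
      simp
  · left
    rw [hx, d_dprod]

theorem grade_forms {S : Set A} {x : FedosovOmega A} (hx : x ∈ forms S) :
    grade (val x) ∈ val '' forms (S ∪ (-1 : ℂ) • S) := by
  have hneg : ∀ l : List A, (∀ a ∈ l, a ∈ S) → ∀ a ∈ l.map (fun a => -a),
      a ∈ S ∪ (-1 : ℂ) • S := by
    intro l hl a ha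
    obtain ⟨b, hb, rfl⟩ := List.mem_map.1 ha
    exact Or.inr ⟨b, hl b hb, by simp⟩
  obtain ⟨l, hl, ⟨a, ha, hx⟩ | ⟨hne, hx⟩⟩ := hx
  · rw [hx, map_mul, grade_inc, grade_dprod]
    exact inc_dprod_mem_forms (S := S ∪ (-1 : ℂ) • S) (Or.inl ha) (hneg l hl)
  · rw [hx, grade_dprod]
    exact dprod_mem_forms (S := S ∪ (-1 : ℂ) • S) (by simpa using hne) (hneg l hl)

theorem mul_forms {S T : Set A} (hS : IsBounded S) (hT : IsBounded T) :
    IsBounded (image2 (fun x y : FedosovOmega A => x * y) (forms S) (forms T)) := by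
  obtain ⟨P, hP, hPd, -, hST⟩ := exists_disk (hS.union hT)
  have hP2 : IsBounded ((2 : ℂ) • P) := isBounded_smul hP 2
  set R := (P ∪ (2 : ℂ) • P) ∪ (P ∪ (2 : ℂ) • P) * (P ∪ (2 : ℂ) • P) with hR
  have hRb : IsBounded R := (hP.union hP2).union
    (BornAlgebra.isBounded_mul _ _ (hP.union hP2) (hP.union hP2))
  have hH : IsBounded (diskHull (forms R ∪ {0})) :=
    ConvexBornology.isBounded_diskHull _ ((isBounded_forms hRb).union isBounded_singleton)
  have hHd := isDisk_diskHull (forms R ∪ {0})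
  have hPR : P ⊆ R := fun a ha => Or.inl (Or.inl ha)
  refine (ConvexBornology.isBounded_add _ _ hH hH).subset ?_
  rintro _ ⟨x, hx, y, hy, rfl⟩
  have hx := forms_mono (subset_union_left.trans hST) hx
  have hy := forms_mono (subset_union_right.trans hST) hy
  obtain ⟨z, hz, hz'⟩ := mul_forms_aux hx hy (R := R) (fun a ha => Or.inl (Or.inr ha)) hPR
    (fun a ha => Or.inr ha)
  have hw : ∃ w ∈ diskHull (forms R ∪ {0}), val w = d (grade (val x)) * d (val y) := by
    have zero : (0 : FedosovOmega A) ∈ diskHull (forms R ∪ {0}) :=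
      subset_diskHull _ (Or.inr rfl)
    obtain ⟨x', hx', hxx'⟩ := grade_forms hx
    rw [← hxx']
    have hPP : P ∪ (-1 : ℂ) • P ⊆ R := by
      refine union_subset hPR ?_
      rintro _ ⟨a, ha, rfl⟩
      exact hPR (hPd.smul_mem ha (by simp))
    rcases d_forms_aux hx' with h | ⟨l, hne, hl, h⟩
    · exact ⟨0, zero, by rw [h]; simp⟩
    · rcases d_forms_aux hy with h' | ⟨l', hne', hl', h'⟩
      · exact ⟨0, zero, by rw [h']; simp⟩
      · obtain ⟨w, hw, hw'⟩ := dprod_mem_forms (S := R) (l := l ++ l') (by simp [hne])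
          (fun a ha => (List.mem_append.1 ha).elim (fun ha => hPP (hl a ha))
            (fun ha => hPR (hl' a ha)))
        exact ⟨w, subset_diskHull _ (Or.inl hw), by rw [hw', h, h', dprod_append]⟩
  obtain ⟨w, hw, hw'⟩ := hw
  refine ⟨z, diskHull_mono subset_union_left hz, -w, hHd.neg_mem hw, val_injective ?_⟩
  simp only [map_add, map_neg, val_mul, hz', hw', sub_eq_add_neg]

/-- Multiplication of `Ω A` with the Fedosov product is bounded for `𝔖_an`. -/
instance : BornAlgebra (FedosovOmega A) where
  smul_assoc c x y := val_injective <| by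
    simp [val_mul, smul_sub]
  smul_comm c x y := val_injective <| by
    simp [val_mul, smul_sub]
  isBounded_mul := by
    intro S T hS hT
    have := isBounded_image2_generated (W := FedosovOmega A) span_forms
      (LinearMap.mk₂ ℂ (fun x y : FedosovOmega A => x * y) add_mul
        (fun c x y => val_injective <| by simp [val_mul, smul_sub]) mul_add
        (fun c x y => val_injective <| by simp [val_mul, smul_sub]))
      (by
        rintro _ ⟨S, hS, rfl⟩ _ ⟨T, hT, rfl⟩
        exact mul_forms hS hT) hS hT
    exact this

/-- The grading operator on `Ω A`, an automorphism for the Fedosov product. -/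
noncomputable def gradeMap : FedosovOmega A →ₗ[ℂ] FedosovOmega A :=
  grade.toLinearMap.restrict fun x hx => by
    simp only [LinearMap.mem_ker, AlgHom.toLinearMap_apply] at hx ⊢
    rw [aug_grade, hx]

theorem val_gradeMap (x : FedosovOmega A) : val (gradeMap x) = grade (val x) := rfl

theorem gradeMap_mul (x y : FedosovOmega A) : gradeMap (x * y) = gradeMap x * gradeMap y :=
  val_injective <| by
    simp only [val_gradeMap, val_mul, map_sub, map_mul, grade_d]
    noncomm_ring

theorem isBoundedMap_gradeMap : IsBoundedMap (gradeMap (A := A)) := by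
  intro S hS
  refine isBounded_image_generated gradeMap ?_ hS
  rintro _ ⟨S, hS, rfl⟩
  refine (isBounded_forms (hS.union (isBounded_smul hS (-1)))).subset ?_
  rintro _ ⟨x, hx, rfl⟩
  obtain ⟨y, hy, h⟩ := grade_forms hx
  have e : y = gradeMap x := val_injective h
  rwa [← e]

/-- The projection of `Ω A` to its degree zero component `A`. -/
noncomputable def degZeroMap : FedosovOmega A →ₗ[ℂ] A where
  toFun x := (degZero (val x)).snd
  map_add' x y := by simp
  map_smul' c x := by simp

theorem degZeroMap_mul (x y : FedosovOmega A) :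
    degZeroMap (x * y) = degZeroMap x * degZeroMap y := by
  change (degZero (val (x * y))).snd = (degZero (val x)).snd * (degZero (val y)).snd
  rw [val_mul]
  simp [degZero_d, degZero_fst, aug_val]

theorem isBoundedMap_degZeroMap : IsBoundedMap (degZeroMap (A := A)) := by
  intro S hS
  refine isBounded_image_generated degZeroMap ?_ hS
  rintro _ ⟨S, hS, rfl⟩
  refine (hS.union (isBounded_singleton (x := (0 : A)))).subset ?_
  rintro _ ⟨x, ⟨l, hl, h⟩, rfl⟩
  change (degZero (val x)).snd ∈ _
  have hnil : ∀ l : List A, l ≠ [] → degZero (dprod l) = 0 := by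
    intro l hl
    cases l with
    | nil => exact absurd rfl hl
    | cons a l => simp [dprod_cons, degZero_dgen]
  rcases h with ⟨a, ha, h⟩ | ⟨hne, h⟩
  · rcases eq_or_ne l [] with rfl | hne
    · left
      simpa [h, dprod, degZero_inc] using ha
    · right
      simp [h, hnil l hne]
  · right
    simp [h, hnil l hne]

end FedosovOmega

end OmegaBornology

/-! ### Complete bornological algebras and bounded homomorphisms -/

/-- A complete bornological algebra (complex, associative, not necessarily unital). -/
structure CBAlg : Type (u + 1) where
  carrier : Type u
  [ring : NonUnitalRing carrier]
  [module : Module ℂ carrier]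
  [bornology : Bornology carrier]
  [algebra : BornAlgebra carrier]
  [complete : CompleteBornology carrier]

instance : CoeSort CBAlg.{u} (Type u) := ⟨CBAlg.carrier⟩

section
variable (A : CBAlg.{u})
instance : NonUnitalRing A := A.ring
instance : Module ℂ A := A.module
instance : Bornology A := A.bornology
instance : BornAlgebra A := A.algebra
instance : CompleteBornology A := A.complete
end

/-- Bounded homomorphisms. -/
@[ext]
structure BHom (A : CBAlg.{u}) (B : CBAlg.{v}) extends A →ₙₐ[ℂ] B where
  bounded : IsBoundedMap toFun

namespace BHom

instance (A : CBAlg.{u}) (B : CBAlg.{v}) : CoeFun (BHom A B) fun _ => A → B :=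
  ⟨fun f => f.toFun⟩

/-- A bounded linear multiplicative map as a bounded homomorphism. -/
def ofLinear {A : CBAlg.{u}} {B : CBAlg.{v}} (l : A →ₗ[ℂ] B) (hl : IsBoundedMap l)
    (hm : ∀ x y, l (x * y) = l x * l y) : BHom A B where
  toFun := l
  map_smul' := map_smul l
  map_zero' := map_zero l
  map_add' := map_add l
  map_mul' := hm
  bounded := hl

/-- A bounded homomorphism as a linear map. -/
def linear {A : CBAlg.{u}} {B : CBAlg.{v}} (f : BHom A B) : A →ₗ[ℂ] B where
  toFun := f
  map_add' := f.map_add'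
  map_smul' := f.map_smul'

/-- The identity homomorphism. -/
def id (A : CBAlg.{u}) : BHom A A := ofLinear LinearMap.id
  (fun _ hS => by simpa using hS) (fun _ _ => rfl)

/-- The composition `g ∘ f`. -/
def comp {A : CBAlg.{u}} {B : CBAlg.{v}} {C : CBAlg.{w}} (g : BHom B C) (f : BHom A B) :
    BHom A C :=
  ofLinear (g.linear.comp f.linear) (isBoundedMap_linear_comp g.bounded f.bounded)
    fun x y => (congrArg g (f.map_mul' x y)).trans (g.map_mul' _ _)

end BHom

/-- The completion of a convex bornological algebra. -/
noncomputable def CBAlg.completion (A : Type u) [NonUnitalRing A] [Module ℂ A] [Bornology A]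
    [BornAlgebra A] : CBAlg.{u} := ⟨Completion A⟩

/-- The extension of a bounded homomorphism to the completion. -/
noncomputable def CBAlg.completionLift {A : Type u} [NonUnitalRing A] [Module ℂ A] [Bornology A]
    [BornAlgebra A] {B : CBAlg.{v}} (l : A →ₗ[ℂ] B) (hl : IsBoundedMap l)
    (hm : ∀ x y, l (x * y) = l x * l y) : BHom (CBAlg.completion A) B :=
  .ofLinear (A := CBAlg.completion A) (Completion.lift l hl) (Completion.isBoundedMap_lift l hl)
    (Completion.lift_mul l hl hm)

/-- The functoriality of the completion. -/
noncomputable def CBAlg.completionMap {A : Type u} [NonUnitalRing A] [Module ℂ A] [Bornology A]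
    [BornAlgebra A] {B : Type v} [NonUnitalRing B] [Module ℂ B] [Bornology B]
    [BornAlgebra B] (l : A →ₗ[ℂ] B) (hl : IsBoundedMap l)
    (hm : ∀ x y, l (x * y) = l x * l y) : BHom (CBAlg.completion A) (CBAlg.completion B) :=
  .ofLinear (A := CBAlg.completion A) (B := CBAlg.completion B)
    (Completion.lift (W := Completion B) (Completion.of.comp l)
      (isBoundedMap_linear_comp Completion.isBoundedMap_of hl))
    (Completion.isBoundedMap_lift (W := Completion B) _ _)
    (Completion.lift_mul (B := Completion B) _ _ fun x y => congrArg Completion.of (hm x y))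

section Sub

variable {A : CBAlg.{u}} (B : NonUnitalSubalgebra ℂ A)

theorem isBounded_sub_iff {S : Set B} : IsBounded S ↔ IsBounded (((↑) : B → A) '' S) :=
  isBounded_image_subtype_val.symm

instance : BornAlgebra B where
  smul_assoc c x y := Subtype.ext (smul_mul_assoc c (x : A) (y : A))
  smul_comm c x y := Subtype.ext (mul_smul_comm c (x : A) (y : A)).symm
  isBounded_add S T hS hT := by
    rw [isBounded_sub_iff] at *
    refine (ConvexBornology.isBounded_add _ _ hS hT).subset ?_
    rintro _ ⟨_, ⟨x, hx, y, hy, rfl⟩, rfl⟩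
    exact add_mem_add (mem_image_of_mem _ hx) (mem_image_of_mem _ hy)
  isBounded_diskHull S hS := by
    rw [isBounded_sub_iff] at *
    exact (ConvexBornology.isBounded_diskHull _ hS).subset
      (image_diskHull_subset B.toSubmodule.subtype S)
  isBounded_mul S T hS hT := by
    rw [isBounded_sub_iff] at *
    refine (BornAlgebra.isBounded_mul _ _ hS hT).subset ?_
    rintro _ ⟨_, ⟨x, hx, y, hy, rfl⟩, rfl⟩
    exact mul_mem_mul (mem_image_of_mem _ hx) (mem_image_of_mem _ hy)

theorem completeBornology_sub (hB : IsBornClosed (B : Set A)) : CompleteBornology B where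
  exists_completant S hS := by
    obtain ⟨T, hT, ⟨hTd, hT0, hTc⟩, hST⟩ :=
      CompleteBornology.exists_completant _ ((isBounded_sub_iff B).1 hS)
    have key : ∀ (ε : ℝ), 0 < ε → ∀ x : B, (x : A) ∈ (ε : ℂ) • T →
        x ∈ (ε : ℂ) • (((↑) : B → A) ⁻¹' T) := by
      rintro ε hε x ⟨t, ht, htx⟩
      have hε' : (ε : ℂ) ≠ 0 := by exact_mod_cast hε.ne'
      have e : (((ε : ℂ)⁻¹ • x : B) : A) = t := by
        change (ε : ℂ)⁻¹ • (x : A) = t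
        rw [← htx]
        exact inv_smul_smul₀ hε' t
      refine ⟨(ε : ℂ)⁻¹ • x, ?_, smul_inv_smul₀ hε' x⟩
      rw [mem_preimage, e]
      exact ht
    have key' : ∀ (ε : ℝ) (x : B), x ∈ (ε : ℂ) • (((↑) : B → A) ⁻¹' T) →
        (x : A) ∈ (ε : ℂ) • T := by
      rintro ε _ ⟨t, ht, rfl⟩
      exact ⟨t, ht, rfl⟩
    refine ⟨((↑) : B → A) ⁻¹' T, ?_, ⟨hTd.preimage B.toSubmodule.subtype, ?_, ?_⟩,
      image_subset_iff.1 hST⟩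
    · exact (isBounded_sub_iff B).2 (hT.subset (image_preimage_subset _ _))
    · intro x hx
      exact Subtype.ext (hT0 _ fun ε hε => key' ε x (hx ε hε))
    · intro x hx
      obtain ⟨y, hy⟩ := hTc (fun n => (x n : A)) fun ε hε => by
        obtain ⟨N, hN⟩ := hx ε hε
        exact ⟨N, fun m hm n hn => key' ε _ (hN m hm n hn)⟩
      have hyB : y ∈ B := hB _ y (fun n => (x n).2) ⟨T, hT, hTd, hy⟩
      refine ⟨⟨y, hyB⟩, fun ε hε => ?_⟩
      obtain ⟨N, hN⟩ := hy ε hε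
      exact ⟨N, fun n hn => key ε hε _ (hN n hn)⟩

/-- A closed subalgebra with the subspace bornology. -/
def CBAlg.sub (hB : IsBornClosed (B : Set A)) : CBAlg.{u} :=
  letI := completeBornology_sub B hB
  ⟨B⟩

/-- The inclusion of a closed subalgebra. -/
def CBAlg.incl (hB : IsBornClosed (B : Set A)) : BHom (CBAlg.sub B hB) A :=
  BHom.ofLinear (A := CBAlg.sub B hB) B.toSubmodule.subtype
    (fun _ hS => (isBounded_sub_iff B).1 hS) (fun _ _ => rfl)

end Sub

/-- The subalgebra on which two bounded homomorphisms agree. -/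
def BHom.equalizer {A : CBAlg.{u}} {B : CBAlg.{v}} (f g : BHom A B) : NonUnitalSubalgebra ℂ A where
  carrier := {x | f x = g x}
  add_mem' {x y} hx hy := by
    change f.linear (x + y) = g.linear (x + y)
    rw [map_add, map_add]
    exact congrArg₂ _ hx hy
  zero_mem' := (map_zero f.linear).trans (map_zero g.linear).symm
  mul_mem' {x y} hx hy :=
    (f.map_mul' x y).trans ((congrArg₂ _ hx hy).trans (g.map_mul' x y).symm)
  smul_mem' c x hx := by
    change f.linear (c • x) = g.linear (c • x)
    rw [map_smul, map_smul]
    exact congrArg _ hx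

theorem BHom.isBornClosed_equalizer {A : CBAlg.{u}} {B : CBAlg.{v}} (f g : BHom A B) :
    IsBornClosed (f.equalizer g : Set A) :=
  isBornClosed_eq f.linear g.linear f.bounded g.bounded

/-- The zero homomorphism. -/
def BHom.zero (A : CBAlg.{u}) (B : CBAlg.{v}) : BHom A B :=
  .ofLinear 0 (fun _ _ => (isBounded_singleton (x := (0 : B))).subset (by
    rintro _ ⟨x, -, rfl⟩; rfl)) (fun _ _ => (mul_zero 0).symm)

/-- The kernel of a bounded homomorphism, with the subspace bornology. -/
def BHom.ker {A : CBAlg.{u}} {B : CBAlg.{v}} (f : BHom A B) : CBAlg.{u} :=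
  CBAlg.sub _ (f.isBornClosed_equalizer (.zero A B))

/-- The inclusion of the kernel. -/
def BHom.kerIncl {A : CBAlg.{u}} {B : CBAlg.{v}} (f : BHom A B) : BHom f.ker A :=
  CBAlg.incl _ (f.isBornClosed_equalizer (.zero A B))

/-! ### The analytic tensor algebra -/

section Tensor

variable (A : CBAlg.{u})

/-- `Ω_an A`: the completion of `Ω A` with the bornology `𝔖_an`, with the Fedosov product. -/
noncomputable def OmegaAn : CBAlg.{u} := CBAlg.completion (FedosovOmega A)

/-- The grading automorphism of `Ω_an A`. -/
noncomputable def OmegaAn.grading : BHom (OmegaAn A) (OmegaAn A) :=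
  CBAlg.completionMap FedosovOmega.gradeMap FedosovOmega.isBoundedMap_gradeMap
    FedosovOmega.gradeMap_mul

/-- The extension of the projection to forms of degree zero to `Ω_an A`. -/
noncomputable def OmegaAn.proj : BHom (OmegaAn A) A :=
  CBAlg.completionLift FedosovOmega.degZeroMap FedosovOmega.isBoundedMap_degZeroMap
    FedosovOmega.degZeroMap_mul

/-- The analytic tensor algebra `𝒯 A`: the even part of `Ω_an A` with the Fedosov product. -/
noncomputable def Tan : CBAlg.{u} :=
  CBAlg.sub _ ((OmegaAn.grading A).isBornClosed_equalizer (.id _))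

/-- The canonical projection `τ_A : 𝒯 A → A`. -/
noncomputable def Tan.τ : BHom (Tan A) A :=
  (OmegaAn.proj A).comp (CBAlg.incl _ ((OmegaAn.grading A).isBornClosed_equalizer (.id _)))

/-- The ideal `𝒥 A`, the kernel of `τ_A`. -/
noncomputable def Jan : CBAlg.{u} := (Tan.τ A).ker

end Tensor

/-! ### Analytically nilpotent extensions -/

/-- Analytically nilpotent algebras: `⋃_{n ≥ 1} S ^ n` is small for each small set `S`. -/
def IsANilpotent (N : CBAlg.{u}) : Prop :=
  ∀ S : Set N, IsBounded S → IsBounded (Subsemigroup.closure S : Set N)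

/-- Analytically quasi-free algebras. -/
def IsAQuasiFree (R : CBAlg.{u}) : Prop :=
  ∃ υ : BHom R (Tan R), (Tan.τ R).comp υ = .id R

set_option linter.checkUnivs false in
/-- A diagram `K → E → Q` of bounded homomorphisms, with fixed `Q`. -/
structure Diagram (Q : CBAlg.{w}) where
  K : CBAlg.{u}
  E : CBAlg.{v}
  i : BHom K E
  p : BHom E Q

/-- The diagram `𝒥 A → 𝒯 A → A`. -/
noncomputable def tensorDiagram (A : CBAlg.{u}) : Diagram.{u, u, u} A :=
  ⟨Jan A, Tan A, (Tan.τ A).kerIncl, Tan.τ A⟩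

namespace Diagram

/-- A diagram `K → E → Q` is an extension if `K → E` is a bornological isomorphism onto the kernel
of `E → Q` (with the subspace bornology) and `E → Q` is a bornological quotient map. -/
structure IsExtension {Q : CBAlg.{w}} (X : Diagram.{u, v, w} Q) : Prop where
  injective : Function.Injective X.i
  isBounded_of_image : ∀ S : Set X.K, IsBounded (X.i '' S) → IsBounded S
  exact : ∀ x : X.E, X.p x = 0 ↔ ∃ y : X.K, X.i y = x
  surjective : Function.Surjective X.p
  exists_lift : ∀ S : Set Q, IsBounded S → ∃ T : Set X.E, IsBounded T ∧ S ⊆ X.p '' T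

/-- Existence of a bounded linear section. -/
def IsAllowable {Q : CBAlg.{w}} (X : Diagram.{u, v, w} Q) : Prop :=
  ∃ s : Q →ₗ[ℂ] X.E, IsBoundedMap s ∧ ∀ q, X.p (s q) = q

/-- Analytically nilpotent extensions: allowable extensions with a-nilpotent kernel. -/
structure IsANilpotentExtension {Q : CBAlg.{w}} (X : Diagram.{u, v, w} Q) : Prop where
  isExtension : X.IsExtension
  isAllowable : X.IsAllowable
  isANilpotent : IsANilpotent X.K

/-- Universal analytically nilpotent extensions: a-nilpotent extensions with analytically
quasi-free middle term. -/
structure IsUniversal {Q : CBAlg.{w}} (X : Diagram.{u, v, w} Q) : Prop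
    extends X.IsANilpotentExtension where
  isAQuasiFree : IsAQuasiFree X.E

/-- Morphisms of extensions. -/
@[ext]
structure Hom {Q : CBAlg.{w}} {Q' : CBAlg.{w₁}} (X : Diagram.{u, v, w} Q)
    (Y : Diagram.{u₁, v₁, w₁} Q') where
  ξ : BHom X.K Y.K
  ψ : BHom X.E Y.E
  φ : BHom Q Q'
  comm_i : ψ.comp X.i = Y.i.comp ξ
  comm_p : φ.comp X.p = Y.p.comp ψ

/-- The identity morphism. -/
def Hom.id {Q : CBAlg.{w}} (X : Diagram.{u, v, w} Q) : Hom X X where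
  ξ := .id _
  ψ := .id _
  φ := .id _
  comm_i := rfl
  comm_p := rfl

/-- The composition of morphisms. -/
def Hom.comp {Q : CBAlg.{w}} {Q' : CBAlg.{w₁}} {Q'' : CBAlg.{w₂}} {X : Diagram.{u, v, w} Q}
    {Y : Diagram.{u₁, v₁, w₁} Q'} {Z : Diagram.{u₂, v₂, w₂} Q''} (g : Hom Y Z) (f : Hom X Y) :
    Hom X Z where
  ξ := g.ξ.comp f.ξ
  ψ := g.ψ.comp f.ψ
  φ := g.φ.comp f.φ
  comm_i := (congrArg g.ψ.comp f.comm_i).trans (congrArg (fun h => h.comp f.ξ) g.comm_i)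
  comm_p := (congrArg g.φ.comp f.comm_p).trans (congrArg (fun h => h.comp f.ψ) g.comm_p)

end Diagram

/-! ### Completed tensor products and homotopies -/

section TensorProduct

variable (C : Type u) [NonUnitalRing C] [Module ℂ C] [Bornology C] [BornAlgebra C]
  (B : Type v) [NonUnitalRing B] [Module ℂ B] [Bornology B] [BornAlgebra B]

/-- The bornology on `C ⊗ B` that is generated by the sets `S ⊗ T` with small `S`, `T`. -/
instance : Bornology (C ⊗[ℂ] B) :=
  generatedBornology {G | ∃ (S : Set C) (T : Set B), IsBounded S ∧ IsBounded T ∧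
    G = image2 (fun x y => x ⊗ₜ[ℂ] y) S T}

instance : ConvexBornology (C ⊗[ℂ] B) := convexBornology_generated _

variable {C B}

theorem isBounded_tmul {S : Set C} {T : Set B} (hS : IsBounded S) (hT : IsBounded T) :
    IsBounded (image2 (fun x y => x ⊗ₜ[ℂ] y) S T) :=
  isBounded_generator ⟨S, T, hS, hT, rfl⟩

theorem span_tmul : Submodule.span ℂ (⋃₀ {G | ∃ (S : Set C) (T : Set B), IsBounded S ∧
    IsBounded T ∧ G = image2 (fun x y => x ⊗ₜ[ℂ] y) S T}) = ⊤ := by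
  rw [eq_top_iff, ← TensorProduct.span_tmul_eq_top, Submodule.span_le]
  rintro _ ⟨x, y, rfl⟩
  exact Submodule.subset_span ⟨_, ⟨{x}, {y}, isBounded_singleton, isBounded_singleton, rfl⟩,
    mem_image2_of_mem rfl rfl⟩

instance : BornAlgebra (C ⊗[ℂ] B) where
  smul_assoc c x y := smul_mul_assoc c x y
  smul_comm c x y := (mul_smul_comm c x y).symm
  isBounded_mul S T hS hT := by
    refine isBounded_image2_generated (W := C ⊗[ℂ] B) span_tmul (LinearMap.mul ℂ (C ⊗[ℂ] B)) ?_ hS hT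
    rintro _ ⟨S, T, hS, hT, rfl⟩ _ ⟨S', T', hS', hT', rfl⟩
    refine (isBounded_tmul (BornAlgebra.isBounded_mul _ _ hS hS')
      (BornAlgebra.isBounded_mul _ _ hT hT')).subset ?_
    rintro _ ⟨_, ⟨x, hx, y, hy, rfl⟩, _, ⟨x', hx', y', hy', rfl⟩, rfl⟩
    exact ⟨x * x', mul_mem_mul hx hx', y * y', mul_mem_mul hy hy', by simp⟩

end TensorProduct

/-- An algebra of functions on `[0,1]`: a convex bornological algebra with evaluation
homomorphisms. -/
structure PathAlg where
  carrier : Type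
  [ring : NonUnitalRing carrier]
  [module : Module ℂ carrier]
  [bornology : Bornology carrier]
  [algebra : BornAlgebra carrier]
  ev : unitInterval → carrier →ₗ[ℂ] ℂ
  ev_bounded : ∀ t, IsBoundedMap (ev t)
  ev_mul : ∀ t x y, ev t (x * y) = ev t x * ev t y

namespace PathAlg

instance : CoeSort PathAlg Type := ⟨PathAlg.carrier⟩

variable (P : PathAlg)

instance : NonUnitalRing P := P.ring
instance : Module ℂ P := P.module
instance : Bornology P := P.bornology
instance : BornAlgebra P := P.algebra

/-- The completed tensor product `P ⊗̂ B`. -/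
noncomputable def paths (B : CBAlg.{u}) : CBAlg.{u} := CBAlg.completion (P ⊗[ℂ] B)

/-- The linear map `ev t ⊗ id`. -/
noncomputable def evLin (B : CBAlg.{u}) (t : unitInterval) : P ⊗[ℂ] B →ₗ[ℂ] B :=
  TensorProduct.lift ((LinearMap.lsmul ℂ B).comp (P.ev t))

theorem isBoundedMap_evLin (B : CBAlg.{u}) (t : unitInterval) : IsBoundedMap (P.evLin B t) := by
  intro S hS
  refine isBounded_image_generated _ ?_ hS
  rintro _ ⟨S, T, hS, hT, rfl⟩
  obtain ⟨r, hr⟩ := (P.ev_bounded t S hS).exists_norm_le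
  obtain ⟨D, hD, hDd, -, hTD⟩ := exists_disk hT
  refine (isBounded_smul hD (r : ℂ)).subset ?_
  rintro _ ⟨_, ⟨x, hx, y, hy, rfl⟩, rfl⟩
  refine hDd.smul_subset (a := P.ev t x) ?_ ⟨y, hTD hy, by simp [evLin]⟩
  have := hr _ ⟨x, hx, rfl⟩
  rw [Complex.norm_real, Real.norm_of_nonneg ((norm_nonneg _).trans this)]
  exact this

theorem evLin_mul (B : CBAlg.{u}) (t : unitInterval) (x y : P ⊗[ℂ] B) :
    P.evLin B t (x * y) = P.evLin B t x * P.evLin B t y := by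
  induction x using TensorProduct.induction_on with
  | zero => simp
  | add x x' hx hx' => simp only [add_mul, map_add, hx, hx']
  | tmul c b =>
    induction y using TensorProduct.induction_on with
    | zero => simp
    | add y y' hy hy' => simp only [mul_add, map_add, hy, hy']
    | tmul c' b' =>
      simp [evLin, P.ev_mul, smul_mul_assoc, mul_smul_comm, smul_smul, mul_comm]

/-- The evaluation homomorphism `P ⊗̂ B → B` at `t`. -/
noncomputable def eval (B : CBAlg.{u}) (t : unitInterval) : BHom (P.paths B) B :=
  CBAlg.completionLift (P.evLin B t) (P.isBoundedMap_evLin B t) (P.evLin_mul B t)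

theorem isBoundedMap_lTensor {A : CBAlg.{u}} {B : CBAlg.{v}} (f : BHom A B) :
    IsBoundedMap (f.linear.lTensor P) := by
  intro S hS
  refine isBounded_image_generated _ ?_ hS
  rintro _ ⟨S, T, hS, hT, rfl⟩
  refine (isBounded_tmul hS (f.bounded T hT)).subset ?_
  rintro _ ⟨_, ⟨x, hx, y, hy, rfl⟩, rfl⟩
  exact ⟨x, hx, f y, ⟨y, hy, rfl⟩, rfl⟩

theorem lTensor_mul {A : CBAlg.{u}} {B : CBAlg.{v}} (f : BHom A B) (x y : P ⊗[ℂ] A) :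
    f.linear.lTensor P (x * y) = f.linear.lTensor P x * f.linear.lTensor P y := by
  induction x using TensorProduct.induction_on with
  | zero => simp
  | add x x' hx hx' => simp only [add_mul, map_add, hx, hx']
  | tmul c b =>
    induction y using TensorProduct.induction_on with
    | zero => simp
    | add y y' hy hy' => simp only [mul_add, map_add, hy, hy']
    | tmul c' b' =>
      have : f.linear (b * b') = f.linear b * f.linear b' := f.map_mul' b b'
      simp [this]

/-- The homomorphism `id ⊗̂ f : P ⊗̂ A → P ⊗̂ B`. -/
noncomputable def map {A : CBAlg.{u}} {B : CBAlg.{v}} (f : BHom A B) :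
    BHom (P.paths A) (P.paths B) :=
  CBAlg.completionMap (f.linear.lTensor P) (P.isBoundedMap_lTensor f) (P.lTensor_mul f)

/-- The diagram `P ⊗̂ K → P ⊗̂ E → P ⊗̂ Q`. -/
noncomputable def diagram {Q : CBAlg.{w}} (X : Diagram.{u, v, w} Q) :
    Diagram.{u, v, w} (P.paths Q) :=
  ⟨P.paths X.K, P.paths X.E, P.map X.i, P.map X.p⟩

end PathAlg

/-! ### Smooth and absolutely continuous functions on the unit interval -/

section Seminorms

variable {V : Type*} [AddCommGroup V] [Module ℂ V]

/-- The bornology of the sets on which `⨆ t, p i t` is bounded for each `i`, where `p` is a family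
of seminorms. -/
@[reducible]
def seminormBornology {ι κ : Type*} (p : ι → κ → Seminorm ℂ V)
    (hp : ∀ i f, ∃ c : ℝ, ∀ t, p i t f ≤ c) : Bornology V :=
  Bornology.ofBounded {S | ∀ i, ∃ c : ℝ, ∀ f ∈ S, ∀ t, p i t f ≤ c}
    (fun _ => ⟨0, fun _ h => h.elim⟩)
    (fun S hS T hT i => by
      obtain ⟨c, hc⟩ := hS i
      exact ⟨c, fun f hf => hc f (hT hf)⟩)
    (fun S hS T hT i => by
      obtain ⟨c, hc⟩ := hS i
      obtain ⟨c', hc'⟩ := hT i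
      refine ⟨max c c', fun f hf t => ?_⟩
      rcases hf with hf | hf
      · exact (hc f hf t).trans (le_max_left _ _)
      · exact (hc' f hf t).trans (le_max_right _ _))
    (fun f i => by
      obtain ⟨c, hc⟩ := hp i f
      refine ⟨c, fun g hg t => ?_⟩
      rw [mem_singleton_iff.1 hg]
      exact hc t)

theorem isBounded_seminorm_iff {ι κ : Type*} {p : ι → κ → Seminorm ℂ V}
    {hp : ∀ i f, ∃ c : ℝ, ∀ t, p i t f ≤ c} {S : Set V} :
    @IsBounded V (seminormBornology p hp) S ↔ ∀ i, ∃ c : ℝ, ∀ f ∈ S, ∀ t, p i t f ≤ c :=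
  isBounded_ofBounded_iff _

theorem convexBornology_seminorm {ι κ : Type*} (p : ι → κ → Seminorm ℂ V)
    (hp : ∀ i f, ∃ c : ℝ, ∀ t, p i t f ≤ c) : @ConvexBornology V _ _ (seminormBornology p hp) := by
  refine @ConvexBornology.mk V _ _ (seminormBornology p hp) ?_ ?_
  · intro S T hS hT
    refine isBounded_seminorm_iff.2 fun i => ?_
    obtain ⟨c, hc⟩ := isBounded_seminorm_iff.1 hS i
    obtain ⟨c', hc'⟩ := isBounded_seminorm_iff.1 hT i
    refine ⟨c + c', ?_⟩
    rintro _ ⟨f, hf, g, hg, rfl⟩ t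
    exact (map_add_le_add _ f g).trans (add_le_add (hc f hf t) (hc' g hg t))
  · intro S hS
    refine isBounded_seminorm_iff.2 fun i => ?_
    obtain ⟨c, hc⟩ := isBounded_seminorm_iff.1 hS i
    refine ⟨max c 0, fun f hf t => ?_⟩
    have hD : IsDisk {f : V | p i t f ≤ max c 0} := by
      intro x hx y hy a b hab
      have hx : p i t x ≤ max c 0 := hx
      have hy : p i t y ≤ max c 0 := hy
      have h0 : 0 ≤ max c 0 := le_max_right _ _
      change p i t (a • x + b • y) ≤ max c 0
      refine (map_add_le_add _ _ _).trans ?_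
      rw [map_smul_eq_mul, map_smul_eq_mul]
      nlinarith [norm_nonneg a, norm_nonneg b, mul_le_mul_of_nonneg_left hx (norm_nonneg a),
        mul_le_mul_of_nonneg_left hy (norm_nonneg b)]
    exact diskHull_subset hD (fun g hg => (hc g hg t).trans (le_max_left _ _)) hf

end Seminorms

section Smooth

open scoped ContDiff

/-- The smooth functions on `[0,1]`. -/
def SmoothFun : Subalgebra ℂ (unitInterval → ℂ) where
  carrier := {f | ContDiffOn ℝ ∞ (IccExtend zero_le_one f) (Icc 0 1)}
  mul_mem' hf hg := ContDiffOn.mul hf hg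
  add_mem' hf hg := ContDiffOn.add hf hg
  algebraMap_mem' c := contDiffOn_const (c := c)

namespace SmoothFun

/-- The `k`-th derivative at a point of `[0,1]` (one-sided at the end points). -/
noncomputable def D (k : ℕ) (t : unitInterval) : SmoothFun →ₗ[ℂ] ℂ where
  toFun f := iteratedDerivWithin k (IccExtend zero_le_one f.1) (Icc 0 1) t
  map_add' f g := by
    have hf : ContDiffOn ℝ ∞ (IccExtend zero_le_one f.1) (Icc 0 1) := f.2
    have hg : ContDiffOn ℝ ∞ (IccExtend zero_le_one g.1) (Icc 0 1) := g.2
    exact iteratedDerivWithin_add t.2 (uniqueDiffOn_Icc zero_lt_one)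
      ((hf t t.2).of_le (mod_cast le_top)) ((hg t t.2).of_le (mod_cast le_top))
  map_smul' c f := iteratedDerivWithin_const_smul_field c _

theorem continuousOn_iteratedDerivWithin (k : ℕ) (f : SmoothFun) :
    ContinuousOn (iteratedDerivWithin k (IccExtend zero_le_one f.1) (Icc 0 1)) (Icc 0 1) := by
  have hf : ContDiffOn ℝ ∞ (IccExtend zero_le_one f.1) (Icc 0 1) := f.2
  exact hf.continuousOn_iteratedDerivWithin (mod_cast le_top) (uniqueDiffOn_Icc zero_lt_one)

theorem exists_bound (k : ℕ) (f : SmoothFun) : ∃ c : ℝ, ∀ t, ‖D k t f‖ ≤ c := by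
  obtain ⟨c, hc⟩ := isCompact_Icc.exists_bound_of_continuousOn (continuousOn_iteratedDerivWithin k f)
  exact ⟨c, fun t => hc t t.2⟩

theorem D_zero (t : unitInterval) (f : SmoothFun) : D 0 t f = f.1 t := by
  change iteratedDerivWithin 0 (IccExtend zero_le_one f.1) (Icc 0 1) t = f.1 t
  rw [iteratedDerivWithin_zero]
  exact IccExtend_val _ _ _

theorem norm_D_mul_le (k : ℕ) (t : unitInterval) (f g : SmoothFun) :
    ‖D k t (f * g)‖ ≤
      ∑ i ∈ Finset.range (k + 1), (k.choose i : ℝ) * ‖D i t f‖ * ‖D (k - i) t g‖ := by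
  have hf : ContDiffOn ℝ ∞ (IccExtend zero_le_one f.1) (Icc 0 1) := f.2
  have hg : ContDiffOn ℝ ∞ (IccExtend zero_le_one g.1) (Icc 0 1) := g.2
  have := norm_iteratedFDerivWithin_mul_le hf hg (uniqueDiffOn_Icc zero_lt_one) t.2 (n := k)
    (mod_cast le_top)
  simp only [norm_iteratedFDerivWithin_eq_norm_iteratedDerivWithin] at this
  exact this

/-- The bounded bornology on the Fréchet algebra `C^∞([0,1])`: a set is small if each derivative
is uniformly bounded on it. -/
noncomputable instance : Bornology SmoothFun :=
  seminormBornology (fun k t => (normSeminorm ℂ ℂ).comp (D k t)) exists_bound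

theorem isBounded_iff {S : Set SmoothFun} :
    IsBounded S ↔ ∀ k, ∃ c : ℝ, ∀ f ∈ S, ∀ t, ‖D k t f‖ ≤ c :=
  isBounded_seminorm_iff (hp := exists_bound)

instance : BornAlgebra SmoothFun where
  toConvexBornology := convexBornology_seminorm _ exists_bound
  isBounded_mul S T hS hT := by
    choose c hc using isBounded_iff.1 hS
    choose c' hc' using isBounded_iff.1 hT
    refine isBounded_iff.2 fun k =>
      ⟨∑ i ∈ Finset.range (k + 1), (k.choose i : ℝ) * c i * c' (k - i), ?_⟩
    rintro _ ⟨f, hf, g, hg, rfl⟩ t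
    refine (norm_D_mul_le k t f g).trans (Finset.sum_le_sum fun i _ => ?_)
    have h1 := hc i f hf t
    have h2 := hc' (k - i) g hg t
    have h0 : 0 ≤ c i := (norm_nonneg _).trans h1
    gcongr

/-- Evaluation at `t`. -/
def ev (t : unitInterval) : SmoothFun →ₗ[ℂ] ℂ where
  toFun f := f.1 t
  map_add' _ _ := rfl
  map_smul' _ _ := rfl

theorem isBoundedMap_ev (t : unitInterval) : IsBoundedMap (ev t) := by
  intro S hS
  obtain ⟨c, hc⟩ := isBounded_iff.1 hS 0
  refine isBounded_iff_forall_norm_le.2 ⟨c, ?_⟩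
  rintro _ ⟨f, hf, rfl⟩
  have := hc f hf t
  rwa [D_zero] at this

end SmoothFun

/-- `C^∞([0,1])` with its evaluation homomorphisms. -/
noncomputable def smoothPaths : PathAlg where
  carrier := SmoothFun
  ev := SmoothFun.ev
  ev_bounded := SmoothFun.isBoundedMap_ev
  ev_mul _ _ _ := rfl

end Smooth

section AC

/-- The algebra `C^∞([0,1])` with the norm `‖f‖_ac = |f 0| + ∫ |f'|`. -/
def ACFun : Type := SmoothFun

noncomputable instance : CommRing ACFun := inferInstanceAs (CommRing SmoothFun)
noncomputable instance : Algebra ℂ ACFun := inferInstanceAs (Algebra ℂ SmoothFun)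

namespace ACFun

open MeasureTheory

/-- The underlying smooth function. -/
noncomputable def val : ACFun →ₐ[ℂ] SmoothFun := AlgHom.id ℂ SmoothFun

/-- The derivative of a smooth function (one-sided at the end points, zero outside `[0,1]`). -/
noncomputable def der (f : ACFun) : ℝ → ℂ :=
  derivWithin (IccExtend zero_le_one (val f).1) (Icc 0 1)

theorem continuousOn_der (f : ACFun) : ContinuousOn (der f) (Icc 0 1) := by
  have := SmoothFun.continuousOn_iteratedDerivWithin 1 (val f)
  rwa [iteratedDerivWithin_one] at this

theorem differentiableOn_ext (f : ACFun) :
    DifferentiableOn ℝ (IccExtend zero_le_one (val f).1) (Icc 0 1) :=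
  ContDiffOn.differentiableOn (val f).2 (by simp)

theorem intervalIntegrable_norm_der (f : ACFun) {t : ℝ} (ht : t ∈ Icc (0 : ℝ) 1) :
    IntervalIntegrable (fun s => ‖der f s‖) volume 0 t := by
  refine ContinuousOn.intervalIntegrable ?_
  rw [uIcc_of_le ht.1]
  exact (continuousOn_der f).norm.mono (Icc_subset_Icc_right ht.2)

theorem ext_add (f g : ACFun) : IccExtend zero_le_one (val (f + g)).1 =
    IccExtend zero_le_one (val f).1 + IccExtend (zero_le_one (α := ℝ)) (val g).1 := rfl

theorem ext_smul (c : ℂ) (f : ACFun) : IccExtend zero_le_one (val (c • f)).1 =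
    c • IccExtend (zero_le_one (α := ℝ)) (val f).1 := rfl

theorem ext_mul (f g : ACFun) : IccExtend zero_le_one (val (f * g)).1 =
    IccExtend zero_le_one (val f).1 * IccExtend (zero_le_one (α := ℝ)) (val g).1 := rfl

theorem der_add (f g : ACFun) {t : ℝ} (ht : t ∈ Icc (0 : ℝ) 1) :
    der (f + g) t = der f t + der g t := by
  rw [der, ext_add]
  exact derivWithin_add (differentiableOn_ext f t ht) (differentiableOn_ext g t ht)

theorem der_smul (c : ℂ) (f : ACFun) (t : ℝ) : der (c • f) t = c • der f t := by
  rw [der, ext_smul]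
  exact derivWithin_const_smul_field c _

theorem der_mul (f g : ACFun) {t : ℝ} (ht : t ∈ Icc (0 : ℝ) 1) :
    der (f * g) t = der f t * (val g).1 ⟨t, ht⟩ + (val f).1 ⟨t, ht⟩ * der g t := by
  rw [der, ext_mul, derivWithin_mul (differentiableOn_ext f t ht) (differentiableOn_ext g t ht)]
  rw [IccExtend_of_mem _ _ ht, IccExtend_of_mem _ _ ht]
  rfl

/-- The seminorm `‖f‖_ac = |f 0| + ∫ |f'|` (which is a norm). -/
noncomputable def acNorm : Seminorm ℂ ACFun :=
  Seminorm.of (fun f => ‖(val f).1 0‖ + ∫ t in (0 : ℝ)..1, ‖der f t‖)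
    (fun f g => by
      have h1 : ‖(val (f + g)).1 0‖ ≤ ‖(val f).1 0‖ + ‖(val g).1 0‖ := norm_add_le _ _
      have hm : (1 : ℝ) ∈ Icc (0 : ℝ) 1 := ⟨zero_le_one, le_rfl⟩
      have h2 : ∫ t in (0 : ℝ)..1, ‖der (f + g) t‖ ≤
          ∫ t in (0 : ℝ)..1, (‖der f t‖ + ‖der g t‖) := by
        refine intervalIntegral.integral_mono_on zero_le_one (intervalIntegrable_norm_der _ hm)
          ((intervalIntegrable_norm_der f hm).add (intervalIntegrable_norm_der g hm)) fun t ht => ?_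
        rw [der_add f g ht]
        exact norm_add_le _ _
      rw [intervalIntegral.integral_add (intervalIntegrable_norm_der f hm)
        (intervalIntegrable_norm_der g hm)] at h2
      linarith)
    (fun c f => by
      have h1 : ‖(val (c • f)).1 0‖ = ‖c‖ * ‖(val f).1 0‖ := norm_mul _ _
      have h2 : ∀ t, ‖der (c • f) t‖ = ‖c‖ * ‖der f t‖ := fun t => by
        rw [der_smul, norm_smul]
      simp only [h1, h2, intervalIntegral.integral_const_mul, mul_add])

theorem acNorm_eq (f : ACFun) :
    acNorm f = ‖(val f).1 0‖ + ∫ t in (0 : ℝ)..1, ‖der f t‖ := rfl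

theorem norm_apply_le (f : ACFun) (t : unitInterval) : ‖(val f).1 t‖ ≤ acNorm f := by
  have hsub : Icc (0 : ℝ) t ⊆ Icc 0 1 := Icc_subset_Icc_right t.2.2
  have key : ∫ s in (0 : ℝ)..t, der f s = (val f).1 t - (val f).1 0 := by
    have e : ∀ s : unitInterval, IccExtend zero_le_one (val f).1 (s : ℝ) = (val f).1 s :=
      fun s => IccExtend_val _ _ s
    have h := intervalIntegral.integral_eq_sub_of_hasDerivAt_of_le t.2.1
      (f := IccExtend zero_le_one (val f).1) (f' := der f)
      ((differentiableOn_ext f).continuousOn.mono hsub)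
      (fun s hs => ((differentiableOn_ext f s (hsub ⟨hs.1.le, hs.2.le⟩)).hasDerivWithinAt).hasDerivAt
        (Icc_mem_nhds hs.1 (hs.2.trans_le t.2.2)))
      (by
        refine ContinuousOn.intervalIntegrable ?_
        rw [uIcc_of_le t.2.1]
        exact (continuousOn_der f).mono hsub)
    rw [h, e t, ← e 0]
    rfl
  have h1 : ‖(val f).1 t - (val f).1 0‖ ≤ ∫ s in (0 : ℝ)..t, ‖der f s‖ := by
    rw [← key]
    exact intervalIntegral.norm_integral_le_integral_norm t.2.1
  have h2 : ∫ s in (0 : ℝ)..t, ‖der f s‖ ≤ ∫ s in (0 : ℝ)..1, ‖der f s‖ :=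
    intervalIntegral.integral_mono_interval le_rfl t.2.1 t.2.2
      (Filter.Eventually.of_forall fun s => norm_nonneg _)
      (intervalIntegrable_norm_der f ⟨zero_le_one, le_rfl⟩)
  have h3 : (val f).1 t = (val f).1 0 + ((val f).1 t - (val f).1 0) := by ring
  rw [acNorm_eq, h3]
  exact (norm_add_le _ _).trans (by linarith)

theorem acNorm_mul_le (f g : ACFun) : acNorm (f * g) ≤ 2 * (acNorm f * acNorm g) := by
  have hm : (1 : ℝ) ∈ Icc (0 : ℝ) 1 := ⟨zero_le_one, le_rfl⟩
  have h1 : ‖(val (f * g)).1 0‖ = ‖(val f).1 0‖ * ‖(val g).1 0‖ := norm_mul _ _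
  have h2 : ∫ t in (0 : ℝ)..1, ‖der (f * g) t‖ ≤
      ∫ t in (0 : ℝ)..1, (‖der f t‖ * acNorm g + acNorm f * ‖der g t‖) := by
    refine intervalIntegral.integral_mono_on zero_le_one (intervalIntegrable_norm_der _ hm)
      (((intervalIntegrable_norm_der f hm).mul_const _).add
        ((intervalIntegrable_norm_der g hm).const_mul _)) fun t ht => ?_
    rw [der_mul f g ht]
    refine (norm_add_le _ _).trans ?_
    rw [norm_mul, norm_mul]
    have h3 := norm_apply_le f ⟨t, ht⟩
    have h4 := norm_apply_le g ⟨t, ht⟩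
    gcongr
  rw [intervalIntegral.integral_add ((intervalIntegrable_norm_der f hm).mul_const _)
    ((intervalIntegrable_norm_der g hm).const_mul _), intervalIntegral.integral_mul_const,
    intervalIntegral.integral_const_mul] at h2
  have h5 := norm_apply_le g 0
  have h6 := acNorm_eq f
  have h7 := acNorm_eq g
  rw [acNorm_eq (f * g), h1]
  nlinarith [norm_nonneg ((val f).1 0), norm_nonneg ((val g).1 0), apply_nonneg acNorm f,
    mul_le_mul_of_nonneg_left h5 (norm_nonneg ((val f).1 0)),
    mul_nonneg (apply_nonneg acNorm f) (norm_nonneg ((val g).1 0))]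

/-- The bounded bornology of the norm `acNorm`. -/
noncomputable instance : Bornology ACFun :=
  seminormBornology (fun _ _ : Unit => acNorm) fun _ f => ⟨acNorm f, fun _ => le_rfl⟩

theorem isBounded_iff {S : Set ACFun} : IsBounded S ↔ ∃ c : ℝ, ∀ f ∈ S, acNorm f ≤ c := by
  refine (isBounded_seminorm_iff (hp := fun _ f => ⟨acNorm f, fun _ => le_rfl⟩)).trans ?_
  exact ⟨fun h => (h ()).imp fun c hc f hf => hc f hf (), fun h _ => h.imp fun c hc f hf _ => hc f hf⟩

instance : BornAlgebra ACFun where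
  toConvexBornology := convexBornology_seminorm _ fun _ f => ⟨acNorm f, fun _ => le_rfl⟩
  isBounded_mul S T hS hT := by
    obtain ⟨c, hc⟩ := isBounded_iff.1 hS
    obtain ⟨c', hc'⟩ := isBounded_iff.1 hT
    refine isBounded_iff.2 ⟨2 * (c * c'), ?_⟩
    rintro _ ⟨f, hf, g, hg, rfl⟩
    refine (acNorm_mul_le f g).trans ?_
    have h1 := hc f hf
    have h2 := hc' g hg
    have h0 : 0 ≤ c := (apply_nonneg acNorm f).trans h1
    gcongr

/-- Evaluation at `t`. -/
noncomputable def ev (t : unitInterval) : ACFun →ₗ[ℂ] ℂ where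
  toFun f := (val f).1 t
  map_add' _ _ := rfl
  map_smul' _ _ := rfl

theorem isBoundedMap_ev (t : unitInterval) : IsBoundedMap (ev t) := by
  intro S hS
  obtain ⟨c, hc⟩ := isBounded_iff.1 hS
  refine isBounded_iff_forall_norm_le.2 ⟨c, ?_⟩
  rintro _ ⟨f, hf, rfl⟩
  exact (norm_apply_le f t).trans (hc f hf)

end ACFun

section Complex

theorem isDisk_closedBall (r : ℝ) : IsDisk (Metric.closedBall (0 : ℂ) r) := by
  intro x hx y hy a b hab
  rw [mem_closedBall_zero_iff] at *
  have h0 : 0 ≤ r := (norm_nonneg x).trans hx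
  refine (norm_add_le _ _).trans ?_
  rw [norm_smul, norm_smul]
  nlinarith [norm_nonneg a, norm_nonneg b, mul_le_mul_of_nonneg_left hx (norm_nonneg a),
    mul_le_mul_of_nonneg_left hy (norm_nonneg b)]

theorem mem_smul_closedBall {ε R : ℝ} (hε : 0 < ε) (hR : 0 < R) {x : ℂ} :
    x ∈ (ε : ℂ) • Metric.closedBall (0 : ℂ) R ↔ ‖x‖ ≤ ε * R := by
  rw [smul_closedBall _ _ hR.le, smul_zero, mem_closedBall_zero_iff, Complex.norm_real,
    Real.norm_of_nonneg hε.le]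

instance : BornAlgebra ℂ where
  smul_assoc := smul_assoc
  smul_comm := smul_comm
  isBounded_add _ _ hS hT := hS.add hT
  isBounded_diskHull S hS := by
    obtain ⟨r, hr⟩ := hS.exists_norm_le
    exact Metric.isBounded_closedBall.subset (diskHull_subset (isDisk_closedBall r)
      fun x hx => mem_closedBall_zero_iff.2 (hr x hx))
  isBounded_mul S T hS hT := by
    obtain ⟨r, hr⟩ := hS.exists_norm_le
    obtain ⟨r', hr'⟩ := hT.exists_norm_le
    refine isBounded_iff_forall_norm_le.2 ⟨r * r', ?_⟩
    rintro _ ⟨x, hx, y, hy, rfl⟩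
    have h1 := hr x hx
    have h2 := hr' y hy
    have h0 : 0 ≤ r := (norm_nonneg x).trans h1
    rw [norm_mul]
    gcongr

instance : CompleteBornology ℂ where
  exists_completant S hS := by
    obtain ⟨r, hr⟩ := hS.exists_norm_le
    have hR : 0 < max r 1 := zero_lt_one.trans_le (le_max_right _ _)
    refine ⟨Metric.closedBall 0 (max r 1), Metric.isBounded_closedBall, ⟨isDisk_closedBall _, ?_, ?_⟩,
      fun x hx => mem_closedBall_zero_iff.2 ((hr x hx).trans (le_max_left _ _))⟩
    · intro x hx
      by_contra hne
      have hpos : 0 < ‖x‖ := norm_pos_iff.2 hne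
      have := (mem_smul_closedBall (by positivity) hR).1 (hx (‖x‖ / (2 * max r 1)) (by positivity))
      have e : ‖x‖ / (2 * max r 1) * max r 1 = ‖x‖ / 2 := by field_simp
      rw [e] at this
      linarith
    · intro x hx
      have hc : CauchySeq x := by
        rw [Metric.cauchySeq_iff]
        intro ε hε
        obtain ⟨N, hN⟩ := hx (ε / (2 * max r 1)) (by positivity)
        refine ⟨N, fun m hm n hn => ?_⟩
        have := (mem_smul_closedBall (by positivity) hR).1 (hN m hm n hn)
        have e : ε / (2 * max r 1) * max r 1 = ε / 2 := by field_simp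
        rw [e] at this
        rw [dist_eq_norm]
        linarith
      obtain ⟨y, hy⟩ := cauchySeq_tendsto_of_complete hc
      refine ⟨y, fun ε hε => ?_⟩
      obtain ⟨N, hN⟩ := Metric.tendsto_atTop.1 hy (ε * max r 1) (by positivity)
      refine ⟨N, fun n hn => (mem_smul_closedBall hε hR).2 ?_⟩
      have := hN n hn
      rw [dist_eq_norm] at this
      exact this.le

end Complex

/-- `AC([0,1])`, the completion of `C^∞([0,1])` for the norm `‖f‖_ac`, with its evaluation
homomorphisms. -/
noncomputable def acPaths : PathAlg where
  carrier := Completion ACFun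
  ev t := Completion.lift (ACFun.ev t) (ACFun.isBoundedMap_ev t)
  ev_bounded _ := Completion.isBoundedMap_lift _ _
  ev_mul _ := Completion.lift_mul _ _ fun _ _ => rfl

end AC

/-! ### Homotopies -/

section Homotopy

variable (P : PathAlg)

/-- Homotopy of bounded homomorphisms `A → B`, through a bounded homomorphism `A → P ⊗̂ B`. -/
def BHom.Homotopic {A : CBAlg.{u}} {B : CBAlg.{v}} (f g : BHom A B) : Prop :=
  ∃ H : BHom A (P.paths B), (P.eval B 0).comp H = f ∧ (P.eval B 1).comp H = g

/-- Homotopy equivalence of complete bornological algebras. -/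
def CBAlg.HomotopyEquivalent (A : CBAlg.{u}) (B : CBAlg.{v}) : Prop :=
  ∃ (f : BHom A B) (g : BHom B A), BHom.Homotopic P (g.comp f) (.id A) ∧
    BHom.Homotopic P (f.comp g) (.id B)

namespace Diagram.Hom

variable {P} in
/-- The value at `t` of the homotopy `H = (Ξ, Ψ, Φ)` is `f = (ξ, ψ, φ)`. -/
def EvaluatesTo {Q : CBAlg.{w}} {Q' : CBAlg.{w₁}} {X : Diagram.{u, v, w} Q}
    {Y : Diagram.{u₁, v₁, w₁} Q'} (H : Hom X (P.diagram Y)) (t : unitInterval) (f : Hom X Y) :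
    Prop :=
  (P.eval Y.K t).comp H.ξ = f.ξ ∧ (P.eval Y.E t).comp H.ψ = f.ψ ∧ (P.eval Q' t).comp H.φ = f.φ

/-- Homotopy of morphisms of extensions relative to `φ`: the homotopy is constant equal to `φ` on
the quotients. -/
def HomotopicRel {Q : CBAlg.{w}} {Q' : CBAlg.{w₁}} {X : Diagram.{u, v, w} Q}
    {Y : Diagram.{u₁, v₁, w₁} Q'} (φ : BHom Q Q') (f g : Hom X Y) : Prop :=
  ∃ H : Hom X (P.diagram Y), H.EvaluatesTo 0 f ∧ H.EvaluatesTo 1 g ∧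
    ∀ t, (P.eval Q' t).comp H.φ = φ

/-- Homotopy equivalences of extensions relative to `A`. -/
def IsHomotopyEquivalenceRel {A : CBAlg.{w}} {X : Diagram.{u, v, w} A}
    {Y : Diagram.{u₁, v₁, w} A} (f : Hom X Y) : Prop :=
  f.φ = .id A ∧ ∃ g : Hom Y X, g.φ = .id A ∧
    HomotopicRel P (.id A) (g.comp f) (Hom.id X) ∧ HomotopicRel P (.id A) (f.comp g) (Hom.id Y)

end Diagram.Hom

end Homotopy

end BornologicalAlgebra

open BornologicalAlgebra

set_option linter.unusedSectionVars false

/-! ### Bornological groundwork: disks, multiplicative closures, completions, tensor products. -/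

namespace BornologicalAlgebra

/-! ### Disks and multiplicatively closed sets -/

section Disks

variable {V W U : Type*} [AddCommGroup V] [Module ℂ V] [AddCommGroup W] [Module ℂ W]
  [AddCommGroup U] [Module ℂ U]

/-! Everything rests on the universal property of `Tan A`. A bounded linear map `l : A → B` induces
a bounded homomorphism `Tan A → B` as soon as its curvature `ω(a, b) = l(ab) - l(a)l(b)` is
a-nilpotent on small sets (`IsLanilcur`). The homomorphism is `a₀ da₁ ⋯ da₂ₙ ↦ l(a₀) ω(a₁, a₂) ⋯
ω(a₂ₙ₋₁, a₂ₙ)`; nilpotency of the curvature bounds all these products at once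
(`isBoundedMap_evalMap`). It is unique, because even forms are generated by `A` under the Fedosov
product (`Tan.hom_ext`).

Lifting is then short. Let `R` be a-quasi-free with section `υ : R → Tan R`, and let `l : R → E` be
a bounded linear map that is multiplicative modulo an a-nilpotent kernel. Its curvature takes values
in that kernel, so `l` induces a homomorphism `Tan R → E`, and composition with `υ` gives `R → E`.
By uniqueness this agrees with `l` after any homomorphism that makes `l` multiplicative
(`comp_lift_comp_section`). With `l = s ∘ φ ∘ p` for a bounded linear section `s`, this lifts `φ`.

Homotopies are lifted by the same argument with `P ⊗̂ E` in place of `E`. The kernel `P ⊗̂ K`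
remains a-nilpotent because smooth and absolutely continuous functions are locally multiplicative.
One starts from the linear map `(id ⊗̂ s) Φ p + c₀ ⊗ (ψ₀ - s φ₀ p) + c₁ ⊗ (ψ₁ - s φ₁ p)`, where `c₀`
and `c₁` are functions with end values `1, 0` and `0, 1`. It lifts `Φ p`, and its end values are
already the homomorphisms `ψ₀` and `ψ₁`, so the induced homomorphism keeps them. Uniqueness up to
homotopy and homotopy equivalence follow formally: two lifts of the same map are joined by lifting a
constant homotopy.

It remains to see that the tensor algebra extension is itself universal. That `Jan A` is a-nilpotent
is an estimate for Fedosov products of forms of positive degree: leading coefficients and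
differentiated entries stay in two fixed small sets (`posForms_mul_mem`). For quasi-freeness, the
linear map `A → Tan A → Tan (Tan A)` is multiplicative modulo the kernel of `Tan (Tan A) → A`. That
kernel is an extension of `Jan A` by `Jan (Tan A)`, hence a-nilpotent by
`isBounded_closure_of_extension`; so the map induces the required section `Tan A → Tan (Tan A)`. -/

/-- With one argument fixed, the admissible values of the other form the preimage of a disk under a
linear map, which is a disk. This is applied to each variable in turn. -/
theorem bilin_mem_of_diskHull (m : V →ₗ[ℂ] W →ₗ[ℂ] U) {S : Set V} {T : Set W} {D : Set U}
    (hD : IsDisk D) (h : ∀ x ∈ S, ∀ y ∈ T, m x y ∈ D) :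
    ∀ x ∈ diskHull S, ∀ y ∈ diskHull T, m x y ∈ D := by
  have h1 : ∀ x ∈ S, ∀ y ∈ diskHull T, m x y ∈ D := fun x hx y hy =>
    diskHull_subset (hD.preimage (m x)) (h x hx) hy
  exact fun x hx y hy => diskHull_subset (hD.preimage (m.flip y)) (fun z hz => h1 z hz y hy) hx

end Disks

section Closure

/-- By associativity, the elements whose left multiplication preserves `D` are closed under
products. The point is that `D` need not be submultiplicative: stability under left multiplication
by the generators is enough. The estimates for forms, for extensions and for smooth functions all
exploit this asymmetry. -/
theorem closure_subset_of_mul_mem {M : Type*} [Semigroup M] {S D : Set M} (h : S ⊆ D)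
    (hm : ∀ x ∈ S, ∀ y ∈ D, x * y ∈ D) : (Subsemigroup.closure S : Set M) ⊆ D := by
  have key : ∀ x ∈ Subsemigroup.closure S, x ∈ D ∧ ∀ y ∈ D, x * y ∈ D := by
    intro x hx
    induction hx using Subsemigroup.closure_induction with
    | mem x hx => exact ⟨h hx, hm x hx⟩
    | mul x y _ _ hx hy =>
      exact ⟨hx.2 y hy.1, fun z hz => by rw [mul_assoc]; exact hx.2 _ (hy.2 z hz)⟩
  exact fun x hx => (key x hx).1

variable {A : Type*} [NonUnitalRing A] [Module ℂ A] [Bornology A] [BornAlgebra A]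

theorem mul_mem_of_diskHull {S T D : Set A} (hD : IsDisk D) (h : ∀ x ∈ S, ∀ y ∈ T, x * y ∈ D) :
    ∀ x ∈ diskHull S, ∀ y ∈ diskHull T, x * y ∈ D :=
  bilin_mem_of_diskHull (LinearMap.mul ℂ A) hD h

/-- A set with small multiplicative closure lies in a small submultiplicative disk. -/
theorem exists_submultiplicative_disk {S : Set A}
    (hS : IsBounded (Subsemigroup.closure S : Set A)) :
    ∃ D : Set A, IsBounded D ∧ IsDisk D ∧ (0 : A) ∈ D ∧ S ⊆ D ∧ ∀ x ∈ D, ∀ y ∈ D, x * y ∈ D := by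
  -- Zero is adjoined because the disked hull of the empty set is empty.
  refine ⟨diskHull (Subsemigroup.closure S ∪ {0}), ConvexBornology.isBounded_diskHull _
    (hS.union isBounded_singleton), isDisk_diskHull _, subset_diskHull _ (Or.inr rfl),
    (Subsemigroup.subset_closure.trans subset_union_left).trans (subset_diskHull _),
    mul_mem_of_diskHull (isDisk_diskHull _) ?_⟩
  rintro x (hx | rfl) y (hy | rfl)
  · exact subset_diskHull _ (Or.inl (mul_mem hx hy))
  · exact subset_diskHull _ (Or.inr (mul_zero x))
  · exact subset_diskHull _ (Or.inr (zero_mul y))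
  · exact subset_diskHull _ (Or.inr (mul_zero 0))

theorem isBounded_closure_of_subset {S D : Set A} (hD : IsBounded D) (h : S ⊆ D)
    (hm : ∀ x ∈ D, ∀ y ∈ D, x * y ∈ D) : IsBounded (Subsemigroup.closure S : Set A) :=
  hD.subset (closure_subset_of_mul_mem h fun x hx => hm x (h hx))

theorem isBoundedMap_add {V W : Type*} [AddCommGroup V] [Module ℂ V] [Bornology V]
    [AddCommGroup W] [Module ℂ W] [Bornology W] [ConvexBornology W] {l l' : V →ₗ[ℂ] W}
    (hl : IsBoundedMap l) (hl' : IsBoundedMap l') : IsBoundedMap (l + l') := by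
  intro S hS
  refine (ConvexBornology.isBounded_add _ _ (hl S hS) (hl' S hS)).subset ?_
  rintro _ ⟨x, hx, rfl⟩
  exact add_mem_add ⟨x, hx, rfl⟩ ⟨x, hx, rfl⟩

theorem isBoundedMap_smul {V W : Type*} [AddCommGroup V] [Module ℂ V] [Bornology V]
    [AddCommGroup W] [Module ℂ W] [Bornology W] [ConvexBornology W] {l : V →ₗ[ℂ] W}
    (hl : IsBoundedMap l) (c : ℂ) : IsBoundedMap (c • l) := by
  intro S hS
  refine (isBounded_smul (hl S hS) c).subset ?_
  rintro _ ⟨x, hx, rfl⟩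
  exact ⟨l x, ⟨x, hx, rfl⟩, rfl⟩

theorem isBoundedMap_sub {V W : Type*} [AddCommGroup V] [Module ℂ V] [Bornology V]
    [AddCommGroup W] [Module ℂ W] [Bornology W] [ConvexBornology W] {l l' : V →ₗ[ℂ] W}
    (hl : IsBoundedMap l) (hl' : IsBoundedMap l') : IsBoundedMap (l - l') := by
  have := isBoundedMap_add hl (isBoundedMap_smul hl' (-1))
  rwa [neg_one_smul, ← sub_eq_add_neg] at this

theorem isBoundedMap_id {V : Type*} [AddCommGroup V] [Module ℂ V] [Bornology V] :
    IsBoundedMap (LinearMap.id : V →ₗ[ℂ] V) := fun S hS => by simpa using hS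

end Closure

/-! ### More on completions -/

section CompletionExt

variable {V : Type*} [AddCommGroup V] [Module ℂ V] [Bornology V] [ConvexBornology V]
  {W : Type*} [AddCommGroup W] [Module ℂ W] [Bornology W] [ConvexBornology W]

/-- The terms of a Cauchy sequence converge to its class in the completion. -/
theorem Completion.bornTendsto_of (x : CauchySeqs V) :
    BornTendsto (fun n => (Completion.of (x.1 n) : Completion V)) (Completion.mk V x) := by
  obtain ⟨S, hS, hSd, hx, N, hN⟩ := exists_mem_cauchyBall x
  refine ⟨Completion.mk V '' cauchyBall S, Completion.isBounded_iff.2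
    ⟨_, cauchySeqs_isBounded_iff.2 ⟨S, hS, hSd, subset_rfl⟩, subset_rfl⟩,
    (isDisk_cauchyBall hSd).image _, fun ε hε => ?_⟩
  obtain ⟨M, hM⟩ := hx ε hε
  have hε' : (ε : ℂ) ≠ 0 := by exact_mod_cast hε.ne'
  refine ⟨M, fun n hn => ?_⟩
  -- The Cauchy condition puts `x n - x m` in `ε • S` for all large `m`, which is membership of the
  -- difference sequence in the scaled Cauchy ball.
  have h1 : CauchySeqs.const (x.1 n) - x ∈ (ε : ℂ) • cauchyBall S := by
    refine (mem_smul_set_iff_inv_smul_mem₀ hε' _ _).2 ⟨?_, M, fun m hm => ?_⟩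
    · have h0 : (0 : V) ∈ S := hSd.zero_mem (hN N le_rfl)
      exact ((cauchyIn_const h0 (x.1 n)).add hSd (hx.smul hSd (-1))).smul hSd (ε : ℂ)⁻¹ |>
        fun h => by
          convert h using 1
          funext k
          change (ε : ℂ)⁻¹ • (x.1 n - x.1 k) = (ε : ℂ)⁻¹ • (x.1 n + (-1 : ℂ) • x.1 k)
          rw [neg_one_smul, sub_eq_add_neg]
    · exact (mem_smul_set_iff_inv_smul_mem₀ hε' _ _).1 (hM n hn m hm)
  obtain ⟨z, hz, h⟩ := h1
  refine ⟨Completion.mk V z, ⟨z, hz, rfl⟩, ?_⟩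
  simp only at h ⊢
  rw [← map_smul, h, map_sub]
  rfl

/-- Bounded linear maps on the completion are determined by their values on `V`. -/
theorem Completion.ext [CompleteBornology W] {f g : Completion V →ₗ[ℂ] W} (hf : IsBoundedMap f)
    (hg : IsBoundedMap g) (h : ∀ x : V, f (Completion.of x) = g (Completion.of x)) : f = g := by
  refine LinearMap.ext fun x => ?_
  obtain ⟨x, rfl⟩ := Completion.mk_surjective x
  have h1 := (Completion.bornTendsto_of x).map f hf
  have h2 := (Completion.bornTendsto_of x).map g hg
  simp only [h] at h1
  exact h1.unique h2

theorem Completion.lift_of [CompleteBornology W] (l : V →ₗ[ℂ] W) (hl : IsBoundedMap l) (x : V) :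
    Completion.lift l hl (Completion.of x) = l x :=
  (limMap_spec l hl (CauchySeqs.const x)).unique (bornTendsto_const (l x))

/-- Bounded linear maps act on Cauchy sequences termwise. -/
def CauchySeqs.map (l : V →ₗ[ℂ] W) (hl : IsBoundedMap l) (x : CauchySeqs V) : CauchySeqs W :=
  ⟨fun n => l (x.1 n), by
    obtain ⟨S, hS, hSd, hx⟩ := x.2
    exact ⟨l '' S, hl S hS, hSd.image l, hx.map l⟩⟩

theorem CauchySeqs.map_mem_cauchyBall {l : V →ₗ[ℂ] W} (hl : IsBoundedMap l) {S : Set V}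
    {x : CauchySeqs V} (hx : x ∈ cauchyBall S) : CauchySeqs.map l hl x ∈ cauchyBall (l '' S) :=
  ⟨hx.1.map l, hx.2.imp fun _ h n hn => ⟨_, h n hn, rfl⟩⟩

/-- Both sides are limits of the same sequence `l (x n)` in the completion of `W`. The formula shows
that values of the induced map have representatives whose terms lie in the range of `l`. -/
theorem Completion.lift_of_comp_mk (l : V →ₗ[ℂ] W) (hl : IsBoundedMap l) (x : CauchySeqs V) :
    Completion.lift (Completion.of.comp l) (isBoundedMap_linear_comp Completion.isBoundedMap_of hl)
      (Completion.mk V x) = Completion.mk W (CauchySeqs.map l hl x) :=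
  (limMap_spec (Completion.of.comp l) (isBoundedMap_linear_comp Completion.isBoundedMap_of hl) x).unique
    (Completion.bornTendsto_of (CauchySeqs.map l hl x))

theorem Completion.exists_disk {B : Set (Completion V)} (hB : IsBounded B) :
    ∃ S : Set V, IsBounded S ∧ IsDisk S ∧ B ⊆ Completion.mk V '' cauchyBall S := by
  obtain ⟨T, hT, hBT⟩ := Completion.isBounded_iff.1 hB
  obtain ⟨S, hS, hSd, hTS⟩ := cauchySeqs_isBounded_iff.1 hT
  exact ⟨S, hS, hSd, hBT.trans (image_mono hTS)⟩

end CompletionExt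

section CompletionClosure

variable {A : Type*} [NonUnitalRing A] [Module ℂ A] [Bornology A] [BornAlgebra A]

/-- For a submultiplicative disk `D`, termwise products of elements of `cauchyBall D` are again in
`cauchyBall D`. Thus nilpotency estimates need only be made before completion. -/
theorem Completion.isBounded_closure {S : Set A} (hS : IsBounded (Subsemigroup.closure S : Set A))
    {B : Set (Completion A)} (hB : B ⊆ Completion.mk A '' cauchyBall S) :
    IsBounded (Subsemigroup.closure B : Set (Completion A)) := by
  obtain ⟨D, hD, hDd, h0, hSD, hDD⟩ := exists_submultiplicative_disk hS
  refine isBounded_closure_of_subset (D := Completion.mk A '' cauchyBall D)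
    (Completion.isBounded_iff.2 ⟨_, cauchySeqs_isBounded_iff.2 ⟨D, hD, hDd, subset_rfl⟩,
      subset_rfl⟩) (hB.trans (image_mono (cauchyBall_mono hSD))) ?_
  rintro _ ⟨x, hx, rfl⟩ _ ⟨y, hy, rfl⟩
  exact ⟨x * y, mul_mem_cauchyBall hDd (mul_subset_iff.2 hDD) hx hy, rfl⟩

end CompletionClosure

section CompletionAlgebra

namespace CBAlg

variable {A : Type u} [NonUnitalRing A] [Module ℂ A] [Bornology A] [BornAlgebra A]
  {W : Type*} [AddCommGroup W] [Module ℂ W] [Bornology W] [ConvexBornology W]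
  {B : Type v} [NonUnitalRing B] [Module ℂ B] [Bornology B] [BornAlgebra B]

variable (A) in
/-- The canonical map to the completion of an algebra. -/
noncomputable def of : A →ₗ[ℂ] CBAlg.completion A := Completion.of (V := A)

theorem isBoundedMap_of : IsBoundedMap (of A) := Completion.isBoundedMap_of (V := A)

theorem of_mul (x y : A) : of A (x * y) = of A x * of A y := Completion.of_mul x y

theorem linearMap_ext [CompleteBornology W] {f g : CBAlg.completion A →ₗ[ℂ] W}
    (hf : IsBoundedMap f) (hg : IsBoundedMap g) (h : ∀ x : A, f (of A x) = g (of A x)) : f = g :=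
  Completion.ext (V := A) (f := f) (g := g) hf hg h

/-- The extension of a bounded linear map to the completion of an algebra. -/
noncomputable def liftLinear [CompleteBornology W] (l : A →ₗ[ℂ] W) (hl : IsBoundedMap l) :
    CBAlg.completion A →ₗ[ℂ] W := Completion.lift l hl

theorem isBoundedMap_liftLinear [CompleteBornology W] (l : A →ₗ[ℂ] W) (hl : IsBoundedMap l) :
    IsBoundedMap (liftLinear l hl) := Completion.isBoundedMap_lift l hl

@[simp] theorem liftLinear_of [CompleteBornology W] (l : A →ₗ[ℂ] W) (hl : IsBoundedMap l) (x : A) :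
    liftLinear l hl (of A x) = l x := Completion.lift_of l hl x

theorem completionLift_of {C : CBAlg.{v}} (l : A →ₗ[ℂ] C) (hl : IsBoundedMap l)
    (hm : ∀ x y, l (x * y) = l x * l y) (x : A) : completionLift l hl hm (of A x) = l x :=
  Completion.lift_of l hl x

theorem completionMap_of (l : A →ₗ[ℂ] B) (hl : IsBoundedMap l)
    (hm : ∀ x y, l (x * y) = l x * l y) (x : A) : completionMap l hl hm (of A x) = of B (l x) :=
  Completion.lift_of ((Completion.of (V := B)).comp l) _ x

/-- The functoriality of the completion for bounded linear maps. -/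
noncomputable def mapLinear (l : A →ₗ[ℂ] B) (hl : IsBoundedMap l) :
    CBAlg.completion A →ₗ[ℂ] CBAlg.completion B :=
  liftLinear ((of B).comp l) (isBoundedMap_linear_comp isBoundedMap_of hl)

theorem isBoundedMap_mapLinear (l : A →ₗ[ℂ] B) (hl : IsBoundedMap l) :
    IsBoundedMap (mapLinear l hl) := isBoundedMap_liftLinear _ _

@[simp] theorem mapLinear_of (l : A →ₗ[ℂ] B) (hl : IsBoundedMap l) (x : A) :
    mapLinear l hl (of A x) = of B (l x) := liftLinear_of _ _ _

/-- If the extension of `l` to the completion fixes all points of a small set, and `l` maps small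
sets to sets with small multiplicative closure, then the small set has small multiplicative
closure. -/
theorem isBounded_closure_of_fixed (l : A →ₗ[ℂ] A) (hl : IsBoundedMap l)
    (hc : ∀ S : Set A, IsBounded S → IsBounded (Subsemigroup.closure (l '' S) : Set A))
    {X : Set (CBAlg.completion A)} (hX : IsBounded X) (h : ∀ x ∈ X, mapLinear l hl x = x) :
    IsBounded (Subsemigroup.closure X : Set (CBAlg.completion A)) := by
  obtain ⟨S, hS, -, hXS⟩ := Completion.exists_disk (V := A) hX
  refine Completion.isBounded_closure (A := A) (hc S hS) fun x hx => ?_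
  obtain ⟨z, hz, rfl⟩ := hXS hx
  -- A fixed point is also represented by the sequence `l (z n)`, whose terms are eventually in `l
  -- '' S`. This avoids having to describe the fixed subspace as the completion of a subspace.
  refine ⟨CauchySeqs.map l hl z, CauchySeqs.map_mem_cauchyBall hl hz, ?_⟩
  rw [← Completion.lift_of_comp_mk]
  exact h _ hx

end CBAlg

end CompletionAlgebra

/-! ### Small sets in tensor products -/

section Tensor

variable {C : Type*} [NonUnitalRing C] [Module ℂ C] [Bornology C] [BornAlgebra C]
  {B : Type*} [NonUnitalRing B] [Module ℂ B] [Bornology B] [BornAlgebra B]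

/-- The subsets of such hulls already form a convex bornology, so the generated one contains nothing
else. Only stability under sums needs an argument. -/
theorem exists_tmul_diskHull {X : Set (C ⊗[ℂ] B)} (hX : IsBounded X) :
    ∃ (S : Set C) (T : Set B), IsBounded S ∧ IsBounded T ∧
      X ⊆ diskHull (image2 (fun x y => x ⊗ₜ[ℂ] y) S T) := by
  have mono : ∀ {S S' : Set C} {T T' : Set B}, S ⊆ S' → T ⊆ T' →
      diskHull (image2 (fun x y => x ⊗ₜ[ℂ] y) S T) ⊆
        diskHull (image2 (fun x y => x ⊗ₜ[ℂ] y) S' T') := fun h h' =>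
    diskHull_mono (image2_subset h h')
  have add : ∀ X Y : Set (C ⊗[ℂ] B),
      (∃ (S : Set C) (T : Set B), IsBounded S ∧ IsBounded T ∧
        X ⊆ diskHull (image2 (fun x y => x ⊗ₜ[ℂ] y) S T)) →
      (∃ (S : Set C) (T : Set B), IsBounded S ∧ IsBounded T ∧
        Y ⊆ diskHull (image2 (fun x y => x ⊗ₜ[ℂ] y) S T)) →
      ∃ (S : Set C) (T : Set B), IsBounded S ∧ IsBounded T ∧
        X + Y ⊆ diskHull (image2 (fun x y => x ⊗ₜ[ℂ] y) S T) := by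
    rintro X Y ⟨S, T, hS, hT, hX⟩ ⟨S', T', hS', hT', hY⟩
    -- The sum `x + y` is the mean of `2x` and `2y`, and the factor `2` is absorbed by the left
    -- tensor factor.
    refine ⟨(2 : ℂ) • (S ∪ S'), T ∪ T', isBounded_smul (hS.union hS') 2, hT.union hT', ?_⟩
    have hd := isDisk_diskHull (image2 (fun x y => x ⊗ₜ[ℂ] y) ((2 : ℂ) • (S ∪ S')) (T ∪ T'))
    have key : diskHull (image2 (fun x y => x ⊗ₜ[ℂ] y) (S ∪ S') (T ∪ T')) ⊆
        (LinearMap.lsmul ℂ (C ⊗[ℂ] B) 2) ⁻¹'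
          diskHull (image2 (fun x y => x ⊗ₜ[ℂ] y) ((2 : ℂ) • (S ∪ S')) (T ∪ T')) := by
      refine diskHull_subset (hd.preimage _) ?_
      rintro _ ⟨x, hx, y, hy, rfl⟩
      exact subset_diskHull _ ⟨(2 : ℂ) • x, smul_smul_mem hx, y, hy, by
        simp [TensorProduct.smul_tmul']⟩
    rintro _ ⟨x, hx, y, hy, rfl⟩
    have h1 := key (mono subset_union_left subset_union_left (hX hx))
    have h2 := key (mono subset_union_right subset_union_right (hY hy))
    have := hd h1 h2 (1 / 2) (1 / 2) (by norm_num)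
    simpa [smul_smul] using this
  refine generatedBornology_induction
    (P := fun X => ∃ (S : Set C) (T : Set B), IsBounded S ∧ IsBounded T ∧
      X ⊆ diskHull (image2 (fun x y => x ⊗ₜ[ℂ] y) S T)) ?_ ?_ ?_ ?_ add ?_ hX
  · rintro _ ⟨S, T, hS, hT, rfl⟩
    exact ⟨S, T, hS, hT, subset_diskHull _⟩
  · intro x
    induction x using TensorProduct.induction_on with
    | zero =>
      exact ⟨{0}, {0}, isBounded_singleton, isBounded_singleton,
        singleton_subset_iff.2 (subset_diskHull _ ⟨0, rfl, 0, rfl, by simp⟩)⟩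
    | tmul x y =>
      exact ⟨{x}, {y}, isBounded_singleton, isBounded_singleton,
        singleton_subset_iff.2 (subset_diskHull _ ⟨x, rfl, y, rfl, rfl⟩)⟩
    | add x y hx hy =>
      have := add _ _ hx hy
      rwa [singleton_add_singleton] at this
  · rintro X Y ⟨S, T, hS, hT, h⟩ hY
    exact ⟨S, T, hS, hT, hY.trans h⟩
  · rintro X Y ⟨S, T, hS, hT, hX⟩ ⟨S', T', hS', hT', hY⟩
    exact ⟨S ∪ S', T ∪ T', hS.union hS', hT.union hT', union_subset
      (hX.trans (mono subset_union_left subset_union_left))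
      (hY.trans (mono subset_union_right subset_union_right))⟩
  · rintro X ⟨S, T, hS, hT, h⟩
    exact ⟨S, T, hS, hT, diskHull_subset (isDisk_diskHull _) h⟩

end Tensor

end BornologicalAlgebra
-- Estimates for Fedosov products of forms of positive degree.
namespace BornologicalAlgebra

/-! ### Analytic nilpotency of the ideal of forms of positive degree -/

section Forms

open OmegaUnital

namespace OmegaUnital

variable {A : Type*} [NonUnitalRing A] [Module ℂ A] [IsScalarTower ℂ A A] [SMulCommClass ℂ A A]

/-- Moving a degree zero factor to the left through a closed form, with an estimate that
distinguishes the leading coefficients from the other entries. -/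
theorem key_mem_pos {Q : Set (OmegaUnital A)} (hQ : IsDisk Q) {S B R : Set A} (hSB : S ⊆ B)
    (hBR : B ⊆ R) (hSR : S * B ⊆ R) {p : OmegaUnital A}
    (h1 : ∀ l : List A, l ≠ [] → (∀ a ∈ l, a ∈ R) → p * dprod l ∈ Q)
    (h2 : ∀ b ∈ S, ∀ l : List A, l ≠ [] → (∀ a ∈ l, a ∈ R) → p * inc b * dprod l ∈ Q)
    (l : List A) : (∀ a ∈ l, a ∈ S) → ∀ b ∈ B, (l = [] → b ∈ S) → ∀ l' : List A, l' ≠ [] →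
      (∀ a ∈ l', a ∈ R) →
      ((1 / 2 : ℂ) ^ l.length) • (p * dprod l * inc b * dprod l') ∈ Q := by
  -- The last differential is peeled off by `da · b = d(ab) - a · db`. This produces a term in which
  -- nothing is left to move and a term in which `a` has still to be moved through a shorter form.
  -- Each step averages two terms, hence the weight `(1/2) ^ l.length`.
  induction l using List.reverseRecOn with
  | nil =>
    intro _ b _ hb l' hne hl'
    simpa [dprod] using h2 b (hb rfl) l' hne hl'
  | append_singleton l a ih =>
    intro hl b hb _ l' hne hl'
    have ha : a ∈ S := hl a (by simp)
    have hl0 : ∀ c ∈ l, c ∈ S := fun c hc => hl c (by simp [hc])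
    -- The factor that moves on is `a ∈ S`, while `b ∈ B` becomes a differentiated entry. So
    -- elements of `B` are multiplied by `S` at most once, and the bounds do not grow along the
    -- induction.
    have e1 := ih hl0 a (hSB ha) (fun _ => ha) (b :: l') (by simp) (by
      intro c hc
      rcases List.mem_cons.1 hc with rfl | hc
      · exact hBR hb
      · exact hl' c hc)
    have e2 : p * dprod (l ++ [a * b] ++ l') ∈ Q := h1 _ (by simp) (by
      intro c hc
      simp only [List.append_assoc, List.cons_append, List.nil_append, List.mem_append,
        List.mem_cons] at hc
      rcases hc with hc | rfl | hc
      · exact hBR (hSB (hl0 c hc))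
      · exact hSR (mul_mem_mul ha hb)
      · exact hl' c hc)
    have e3 : ((1 / 2 : ℂ) ^ l.length) • (p * dprod (l ++ [a * b] ++ l')) ∈ Q :=
      hQ.smul_mem e2 (by
        rw [norm_pow]
        exact pow_le_one₀ (norm_nonneg _) (by norm_num))
    have := hQ e3 e1 (1 / 2) (-(1 / 2)) (by norm_num)
    convert this using 1
    have hd : dgen a * inc b = dgen (a * b) - inc a * dgen b := by
      rw [dgen_mul]; abel
    have e : p * dprod (l ++ [a]) * inc b * dprod l' =
        p * dprod (l ++ [a * b] ++ l') - p * dprod l * inc a * dprod (b :: l') := by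
      have : p * dprod (l ++ [a]) * inc b * dprod l' =
          p * dprod l * (dgen a * inc b) * dprod l' := by
        simp only [dprod_append, dprod_cons, mul_assoc]
        simp [dprod]
      rw [this, hd]
      simp only [dprod_append, dprod_cons, mul_sub, sub_mul, mul_assoc]
      simp [dprod]
    rw [e, List.length_append, List.length_singleton, pow_succ]
    module

theorem dprod_smul (c : ℂ) (l : List A) :
    dprod (l.map (fun a => c • a)) = c ^ l.length • dprod l := by
  induction l with
  | nil => simp [dprod]
  | cons a l ih => simp [dprod_cons, ih, smul_smul, pow_succ, mul_comm]

end OmegaUnital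

namespace FedosovOmega

variable {A : Type*} [NonUnitalRing A] [Module ℂ A] [Bornology A] [BornAlgebra A]

/-- The forms `⟨b⟩ da₁ ⋯ daₙ` with `n ≥ 1`, `b ∈ B` and all `aᵢ ∈ R`. -/
def posForms (B R : Set A) : Set (FedosovOmega A) :=
  {x | ∃ l : List A, l ≠ [] ∧ (∀ a ∈ l, a ∈ R) ∧
    ((∃ b ∈ B, val x = inc b * dprod l) ∨ val x = dprod l)}

theorem posForms_subset_forms {B R : Set A} (h : B ⊆ R) : posForms B R ⊆ forms R := by
  rintro x ⟨l, hne, hl, ⟨b, hb, hx⟩ | hx⟩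
  · exact ⟨l, hl, Or.inl ⟨b, h hb, hx⟩⟩
  · exact ⟨l, hl, Or.inr ⟨hne, hx⟩⟩

theorem posForms_mono {B R B' R' : Set A} (hB : B ⊆ B') (hR : R ⊆ R') :
    posForms B R ⊆ posForms B' R' := by
  rintro x ⟨l, hne, hl, ⟨b, hb, hx⟩ | hx⟩
  · exact ⟨l, hne, fun a ha => hR (hl a ha), Or.inl ⟨b, hB hb, hx⟩⟩
  · exact ⟨l, hne, fun a ha => hR (hl a ha), Or.inr hx⟩

theorem dprod_mem_posForms {B R : Set A} {l : List A} (h : l ≠ []) (hl : ∀ a ∈ l, a ∈ R) :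
    dprod l ∈ val '' posForms B R :=
  ⟨⟨dprod l, aug_dprod h⟩, ⟨l, h, hl, Or.inr rfl⟩, rfl⟩

theorem inc_dprod_mem_posForms {B R : Set A} {b : A} (hb : b ∈ B) {l : List A} (h : l ≠ [])
    (hl : ∀ a ∈ l, a ∈ R) : inc b * dprod l ∈ val '' posForms B R :=
  ⟨⟨inc b * dprod l, by simp [aug]⟩, ⟨l, h, hl, Or.inl ⟨b, hb, rfl⟩⟩, rfl⟩

/-- The leading coefficient of a product comes from the left factor alone: it lies in `4S` or in `S
· 4S`, so in `B`. The leading coefficient of `y` is absorbed into a differential, at worst after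
multiplication by an element of `4S`, so it ends in `R`. Hence left multiplication by `posForms S S`
can be iterated without enlarging `B` and `R`. -/
theorem posForms_mul_mem {S B R : Set A} (hS : IsDisk S) (hSB : (4 : ℂ) • S ⊆ B)
    (hSB' : S * ((4 : ℂ) • S) ⊆ B) (hBR : B ⊆ R) (hSR : ((4 : ℂ) • S) * B ⊆ R)
    {x y : FedosovOmega A} (hx : x ∈ posForms S S) (hy : y ∈ posForms B R) :
    x * y ∈ diskHull (posForms B R) := by
  have hQ : IsDisk (val '' diskHull (posForms B R)) := (isDisk_diskHull _).image _
  have sub : val '' posForms B R ⊆ val '' diskHull (posForms B R) := image_mono (subset_diskHull _)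
  have scale : ∀ c : ℂ, ‖c‖ ≤ 4 → ∀ a ∈ S, c • a ∈ (4 : ℂ) • S := fun c hc a ha =>
    hS.smul_subset (by simpa using hc) (smul_smul_mem ha)
  have hS4 : S ⊆ (4 : ℂ) • S := fun a ha => by simpa using scale 1 (by norm_num) a ha
  have hSR' : S ⊆ R := hS4.trans (hSB.trans hBR)
  suffices h : val (x * y) ∈ val '' diskHull (posForms B R) by
    obtain ⟨z, hz, h⟩ := h
    rwa [← val_injective h]
  obtain ⟨l, hne, hl, hx⟩ := hx
  obtain ⟨l', hne', hl', hy⟩ := hy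
  have happ : ∀ a ∈ l ++ l', a ∈ R := fun a ha =>
    (List.mem_append.1 ha).elim (fun h => hSR' (hl a h)) (hl' a)
  rcases hy with ⟨c, hc, hy⟩ | hy
  · have key : ∀ p : OmegaUnital A,
        (∀ l : List A, l ≠ [] → (∀ a ∈ l, a ∈ R) → p * dprod l ∈ val '' diskHull (posForms B R)) →
        (∀ b ∈ (4 : ℂ) • S, ∀ l : List A, l ≠ [] → (∀ a ∈ l, a ∈ R) →
          p * inc b * dprod l ∈ val '' diskHull (posForms B R)) →
        (2 : ℂ) • (p * dprod l * (inc c * dprod l')) ∈ val '' diskHull (posForms B R) := by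
      intro p h1 h2
      -- Scaling the entries of `l` by `4` gains `4 ^ l.length`, of which `2 ^ l.length` pays for
      -- the Leibniz expansion.
      have := key_mem_pos hQ hSB hBR hSR h1 h2 (l.map fun a => (4 : ℂ) • a) (by
        intro a ha
        obtain ⟨b, hb, rfl⟩ := List.mem_map.1 ha
        exact smul_smul_mem (hl b hb)) c hc (fun h => (hne (List.map_eq_nil_iff.1 h)).elim) l' hne' hl'
      rw [dprod_smul, List.length_map] at this
      simp only [mul_smul_comm, smul_mul_assoc, smul_smul, ← mul_pow] at this
      norm_num at this
      -- The surplus `2 ^ l.length` is at least `2` because the left factor has positive degree.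
      -- This spare factor makes room for the second summand of the Fedosov product.
      obtain ⟨n, hn⟩ := Nat.exists_eq_succ_of_ne_zero (mt List.length_eq_zero_iff.1 hne)
      have h3 := hQ.smul_mem this (a := (1 / 2 : ℂ) ^ n) (by
        rw [norm_pow]
        exact pow_le_one₀ (norm_nonneg _) (by norm_num))
      rw [smul_smul, hn, pow_succ, ← mul_assoc, ← mul_pow] at h3
      norm_num at h3
      rw [← mul_assoc]
      exact h3
    rcases hx with ⟨a, ha, hx⟩ | hx
    · have h1 := key (inc a) (fun l hne hl => sub (inc_dprod_mem_posForms
        (hSB (hS4 ha)) hne hl)) (fun b hb l hne hl => by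
          rw [← inc_mul]
          exact sub (inc_dprod_mem_posForms (hSB' (mul_mem_mul ha hb)) hne hl))
      -- The correction term is a product of differentials, so no Leibniz expansion occurs; the
      -- factor `2` is put on the former leading coefficient `a`, and `2a ∈ 4S ⊆ R`.
      have h2 : (2 : ℂ) • (d (grade (val x)) * d (val y)) ∈ val '' diskHull (posForms B R) := by
        have e : (2 : ℂ) • (d (grade (val x)) * d (val y)) =
            dprod (((2 : ℂ) • a) :: (l.map (fun a => -a) ++ (c :: l'))) := by
          rw [hx, hy, map_mul, grade_inc, grade_dprod]
          simp only [d_mul, d_dprod, d_inc, mul_zero, add_zero, dprod_cons, dprod_append, map_smul,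
            smul_mul_assoc, mul_assoc]
        rw [e]
        refine sub (dprod_mem_posForms (by simp) fun b hb => ?_)
        rcases List.mem_cons.1 hb with rfl | hb
        · exact hBR (hSB (scale 2 (by norm_num) a ha))
        rcases List.mem_append.1 hb with hb | hb
        · obtain ⟨b, hb', rfl⟩ := List.mem_map.1 hb
          exact hSR' (hS.neg_mem (hl b hb'))
        rcases List.mem_cons.1 hb with rfl | hb
        · exact hBR hc
        · exact hl' b hb
      -- Both summands were bounded after doubling, so their difference is an absolutely convex
      -- combination of elements of the hull.
      have := hQ h1 h2 (1 / 2) (-(1 / 2)) (by norm_num)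
      convert this using 1
      rw [val_mul, smul_smul, smul_smul, ← hx, ← hy]
      norm_num
      rw [sub_eq_add_neg]
    · have h1 := key 1 (fun l hne hl => by rw [one_mul]; exact sub (dprod_mem_posForms hne hl))
        (fun b hb l hne hl => by
          rw [one_mul]; exact sub (inc_dprod_mem_posForms (hSB hb) hne hl))
      have := hQ.smul_mem h1 (a := 1 / 2) (by norm_num)
      convert this using 1
      rw [val_mul, smul_smul, hx, grade_dprod, d_dprod, hy]
      norm_num
  -- If `y` is closed, the Fedosov correction vanishes and multiplication just concatenates lists of
  -- differentials.
  · refine sub ?_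
    have e : val (x * y) = val x * dprod l' := by
      rw [val_mul, hy, d_dprod, mul_zero, sub_zero]
    rw [e]
    rcases hx with ⟨a, ha, hx⟩ | hx
    · rw [hx, mul_assoc, ← dprod_append]
      exact inc_dprod_mem_posForms (hSB (hS4 ha)) (by simp [hne]) happ
    · rw [hx, ← dprod_append]
      exact dprod_mem_posForms (by simp [hne]) happ

/-- The forms of positive degree are analytically nilpotent for the Fedosov product. -/
theorem isBounded_closure_posForms {S : Set A} (hS : IsBounded S) :
    IsBounded (Subsemigroup.closure (diskHull (posForms S S)) : Set (FedosovOmega A)) := by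
  obtain ⟨P, hP, hPd, -, hSP⟩ := exists_disk hS
  have h4 : IsBounded ((4 : ℂ) • P) := isBounded_smul hP 4
  -- `B` receives the leading coefficients and `R` below the differentiated entries. They involve
  -- products of at most two and three elements of `P`, whatever the number of factors in the
  -- closure.
  set B := (4 : ℂ) • P ∪ P * ((4 : ℂ) • P) with hB
  have hBb : IsBounded B := h4.union (BornAlgebra.isBounded_mul _ _ hP h4)
  set R := B ∪ ((4 : ℂ) • P) * B with hR
  have hRb : IsBounded R := hBb.union (BornAlgebra.isBounded_mul _ _ h4 hBb)
  have hPB : P ⊆ B := fun a ha => Or.inl (by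
    have := hPd.smul_subset (a := 1) (b := 4) (by norm_num) (smul_smul_mem (c := 1) ha)
    simpa using this)
  have hbd : IsBounded (diskHull (posForms B R)) := ConvexBornology.isBounded_diskHull _
    ((isBounded_forms hRb).subset (posForms_subset_forms subset_union_left))
  refine hbd.subset (Subset.trans (SetLike.coe_subset_coe.2 (Subsemigroup.closure_mono
    (diskHull_mono (posForms_mono hSP hSP)))) (closure_subset_of_mul_mem (diskHull_mono (posForms_mono hPB
      (hPB.trans subset_union_left))) (mul_mem_of_diskHull (isDisk_diskHull _) fun x hx y hy =>
        posForms_mul_mem hPd subset_union_left subset_union_right subset_union_left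
          subset_union_right hx hy)))

/-- The inclusion of `A` as forms of degree zero. -/
noncomputable def ofDegZero : A →ₗ[ℂ] FedosovOmega A where
  toFun a := ⟨inc a, by simp [aug]⟩
  map_add' a b := val_injective (map_add inc a b)
  map_smul' c a := val_injective (map_smul inc c a)

theorem val_ofDegZero (a : A) : val (ofDegZero a) = inc a := rfl

theorem isBoundedMap_ofDegZero : IsBoundedMap (ofDegZero (A := A)) := by
  intro S hS
  refine (isBounded_forms hS).subset ?_
  rintro _ ⟨a, ha, rfl⟩
  exact ⟨[], by simp, Or.inl ⟨a, ha, by simp [dprod, val_ofDegZero]⟩⟩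

theorem degZeroMap_ofDegZero (a : A) : degZeroMap (ofDegZero a) = a := by
  change (degZero (inc a)).snd = a
  rw [degZero_inc, Unitization.snd_inr]

theorem gradeMap_ofDegZero (a : A) : gradeMap (ofDegZero a) = ofDegZero a :=
  val_injective (grade_inc a)

/-- The projection to the forms of positive degree. -/
noncomputable def posMap : FedosovOmega A →ₗ[ℂ] FedosovOmega A :=
  LinearMap.id - ofDegZero.comp degZeroMap

theorem isBoundedMap_posMap : IsBoundedMap (posMap (A := A)) :=
  isBoundedMap_sub isBoundedMap_id
    (isBoundedMap_linear_comp isBoundedMap_ofDegZero isBoundedMap_degZeroMap)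

theorem posMap_forms {S : Set A} {x : FedosovOmega A} (hx : x ∈ forms S) :
    posMap x = 0 ∨ posMap x ∈ posForms S S := by
  have hnil : ∀ l : List A, l ≠ [] → degZero (dprod l) = 0 := by
    intro l hl
    cases l with
    | nil => exact absurd rfl hl
    | cons a l => simp [dprod_cons, degZero_dgen]
  have e : posMap x = x - ofDegZero (degZero (val x)).snd := rfl
  obtain ⟨l, hl, ⟨a, ha, h⟩ | ⟨hne, h⟩⟩ := hx
  · rcases eq_or_ne l [] with rfl | hne
    · left
      have : x = ofDegZero a := val_injective (by rw [h]; simp [dprod, val_ofDegZero])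
      rw [e, h]
      simp [dprod, degZero_inc, this]
    · right
      rw [e, h, map_mul, hnil l hne, mul_zero, Unitization.snd_zero, map_zero, sub_zero]
      exact ⟨l, hne, hl, Or.inl ⟨a, ha, h⟩⟩
  · right
    rw [e, h, hnil l hne, Unitization.snd_zero, map_zero, sub_zero]
    exact ⟨l, hne, hl, Or.inr h⟩

/-- The scalar is absorbed by the first entry of the form only, so the remaining entries still need
the original set `S`. -/
theorem smul_forms_subset (S : Set A) (c : ℂ) : c • forms S ⊆ forms (S ∪ c • S) := by
  rintro _ ⟨x, ⟨l, hl, ⟨a, ha, h⟩ | ⟨hne, h⟩⟩, rfl⟩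
  · exact ⟨l, fun b hb => Or.inl (hl b hb), Or.inl ⟨c • a, Or.inr (smul_smul_mem ha), by
      simp [h]⟩⟩
  · obtain ⟨a, l, rfl⟩ := List.exists_cons_of_ne_nil hne
    refine ⟨(c • a) :: l, fun b hb => ?_, Or.inr ⟨by simp, by simp [h, dprod_cons]⟩⟩
    rcases List.mem_cons.1 hb with rfl | hb
    · exact Or.inr (smul_smul_mem (hl a (by simp)))
    · exact Or.inl (hl b (by simp [hb]))

theorem smul_diskHull_forms_subset (S : Set A) (c : ℂ) :
    c • diskHull (forms S) ⊆ diskHull (forms (S ∪ c • S)) := by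
  rintro _ ⟨x, hx, rfl⟩
  refine diskHull_subset ((isDisk_diskHull (forms (S ∪ c • S))).preimage
    (LinearMap.lsmul ℂ (FedosovOmega A) c)) (fun y hy => ?_) hx
  exact subset_diskHull _ (smul_forms_subset S c (smul_smul_mem hy))

/-- Each small set is contained in the disked hull of some `forms S`. -/
theorem exists_forms_diskHull {X : Set (FedosovOmega A)} (hX : IsBounded X) :
    ∃ S : Set A, IsBounded S ∧ X ⊆ diskHull (forms S) := by
  have mono : ∀ {S S' : Set A}, S ⊆ S' → diskHull (forms S) ⊆ diskHull (forms S') := fun h =>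
    diskHull_mono (forms_mono h)
  have add : ∀ X Y : Set (FedosovOmega A), (∃ S : Set A, IsBounded S ∧ X ⊆ diskHull (forms S)) →
      (∃ S : Set A, IsBounded S ∧ Y ⊆ diskHull (forms S)) →
      ∃ S : Set A, IsBounded S ∧ X + Y ⊆ diskHull (forms S) := by
    rintro X Y ⟨S, hS, hX⟩ ⟨S', hS', hY⟩
    -- A sum of two elements of a disk lies in twice the disk, and the scalar `2` is then moved into
    -- the entries.
    refine ⟨_, (hS.union hS').union (isBounded_smul (hS.union hS') 2),
      Subset.trans ?_ (smul_diskHull_forms_subset (S ∪ S') 2)⟩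
    rintro _ ⟨x, hx, y, hy, rfl⟩
    have := (isDisk_diskHull (forms (S ∪ S'))).add_mem one_pos one_pos
      (x := x) (y := y) (by rw [Complex.ofReal_one, one_smul]; exact mono subset_union_left (hX hx))
      (by rw [Complex.ofReal_one, one_smul]; exact mono subset_union_right (hY hy))
    norm_num at this
    exact this
  refine generatedBornology_induction
    (P := fun X => ∃ S : Set A, IsBounded S ∧ X ⊆ diskHull (forms S)) ?_ ?_ ?_ ?_ add ?_ hX
  · rintro _ ⟨S, hS, rfl⟩
    exact ⟨S, hS, subset_diskHull _⟩
  · intro x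
    have hx : x ∈ Submodule.span ℂ (⋃₀ {G | ∃ S : Set A, IsBounded S ∧ G = forms S}) :=
      (span_forms (A := A)) ▸ Submodule.mem_top
    induction hx using Submodule.span_induction with
    | mem x hx =>
      obtain ⟨_, ⟨S, hS, rfl⟩, hx⟩ := hx
      exact ⟨S, hS, singleton_subset_iff.2 (subset_diskHull _ hx)⟩
    | zero =>
      exact ⟨{0}, isBounded_singleton, singleton_subset_iff.2 (subset_diskHull _
        ⟨[], by simp, Or.inl ⟨0, rfl, by simp⟩⟩)⟩
    | add x y _ _ hx hy =>
      have := add _ _ hx hy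
      rwa [singleton_add_singleton] at this
    | smul c x _ hx =>
      obtain ⟨S, hS, hx⟩ := hx
      exact ⟨_, hS.union (isBounded_smul hS c), singleton_subset_iff.2
        (smul_diskHull_forms_subset S c (smul_smul_mem (singleton_subset_iff.1 hx)))⟩
  · rintro X Y ⟨S, hS, h⟩ hY
    exact ⟨S, hS, hY.trans h⟩
  · rintro X Y ⟨S, hS, hX⟩ ⟨S', hS', hY⟩
    exact ⟨S ∪ S', hS.union hS', union_subset (hX.trans (mono subset_union_left))
      (hY.trans (mono subset_union_right))⟩
  · rintro X ⟨S, hS, h⟩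
    exact ⟨S, hS, diskHull_subset (isDisk_diskHull _) h⟩

/-- This is the hypothesis of `CBAlg.isBounded_closure_of_fixed` for the projection `posMap`. By
linearity it suffices to project the generators `forms S`, which land in `posForms` up to zero. -/
theorem isBounded_closure_posMap {X : Set (FedosovOmega A)} (hX : IsBounded X) :
    IsBounded (Subsemigroup.closure (posMap '' X) : Set (FedosovOmega A)) := by
  obtain ⟨S, hS, hXS⟩ := exists_forms_diskHull hX
  refine (isBounded_closure_posForms (hS.union (isBounded_singleton (x := (0 : A))))).subset
    (SetLike.coe_subset_coe.2 (Subsemigroup.closure_mono ?_))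
  refine (image_mono hXS).trans ((image_diskHull_subset posMap (forms S)).trans
    (diskHull_mono ?_))
  rintro _ ⟨x, hx, rfl⟩
  rcases posMap_forms hx with h | h
  · rw [h]
    -- Zero is exhibited as the form `d 0` of degree one; this is why `0` was adjoined to `S`.
    exact ⟨[0], by simp, by simp, Or.inr (by simp [dprod])⟩
  · exact posForms_mono subset_union_left subset_union_left h

end FedosovOmega

end Forms

/-! ### The projection of `Ω_an A` to degree zero -/

section Projection

variable (A : CBAlg.{u})

/-- The canonical map from differential forms to analytic differential forms. -/
noncomputable def OmegaAn.of : FedosovOmega A →ₗ[ℂ] OmegaAn A := CBAlg.of (FedosovOmega A)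

theorem OmegaAn.linearMap_ext {W : Type*} [AddCommGroup W] [Module ℂ W] [Bornology W]
    [ConvexBornology W] [CompleteBornology W] {f g : OmegaAn A →ₗ[ℂ] W}
    (hf : IsBoundedMap f) (hg : IsBoundedMap g) (h : ∀ x, f (OmegaAn.of A x) = g (OmegaAn.of A x)) :
    f = g :=
  CBAlg.linearMap_ext (A := FedosovOmega A) (f := f) (g := g) hf hg h

variable {A} in
/-- The extension of bounded linear maps to analytic differential forms. -/
noncomputable def OmegaAn.map (l : FedosovOmega A →ₗ[ℂ] FedosovOmega A) (hl : IsBoundedMap l) :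
    OmegaAn A →ₗ[ℂ] OmegaAn A := CBAlg.mapLinear l hl

variable {A} in
theorem OmegaAn.isBoundedMap_map (l : FedosovOmega A →ₗ[ℂ] FedosovOmega A) (hl : IsBoundedMap l) :
    IsBoundedMap (OmegaAn.map l hl) := CBAlg.isBoundedMap_mapLinear l hl

variable {A} in
theorem OmegaAn.map_of (l : FedosovOmega A →ₗ[ℂ] FedosovOmega A) (hl : IsBoundedMap l)
    (x : FedosovOmega A) : OmegaAn.map l hl (OmegaAn.of A x) = OmegaAn.of A (l x) :=
  CBAlg.mapLinear_of l hl x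

theorem OmegaAn.isBoundedMap_of : IsBoundedMap (OmegaAn.of A) :=
  CBAlg.isBoundedMap_of (A := FedosovOmega A)

/-- The canonical bounded linear map `A → Ω_an A`. -/
noncomputable def OmegaAn.σ : A →ₗ[ℂ] OmegaAn A := (OmegaAn.of A).comp FedosovOmega.ofDegZero

theorem OmegaAn.isBoundedMap_σ : IsBoundedMap (OmegaAn.σ A) :=
  isBoundedMap_linear_comp (OmegaAn.isBoundedMap_of A) FedosovOmega.isBoundedMap_ofDegZero

theorem OmegaAn.proj_of (x : FedosovOmega A) :
    (OmegaAn.proj A).linear (OmegaAn.of A x) = FedosovOmega.degZeroMap x :=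
  CBAlg.completionLift_of _ FedosovOmega.isBoundedMap_degZeroMap FedosovOmega.degZeroMap_mul x

theorem OmegaAn.proj_σ (a : A) : OmegaAn.proj A (OmegaAn.σ A a) = a :=
  (OmegaAn.proj_of A _).trans (FedosovOmega.degZeroMap_ofDegZero a)

/-- The kernel of the projection of `Ω_an A` to degree zero is analytically nilpotent. -/
theorem OmegaAn.isBounded_closure_ker {X : Set (OmegaAn A)} (hX : IsBounded X)
    (h0 : ∀ x ∈ X, OmegaAn.proj A x = 0) :
    IsBounded (Subsemigroup.closure X : Set (OmegaAn A)) := by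
  refine CBAlg.isBounded_closure_of_fixed (A := FedosovOmega A) FedosovOmega.posMap
    FedosovOmega.isBoundedMap_posMap (fun S => FedosovOmega.isBounded_closure_posMap) hX
    fun (x : OmegaAn A) hx => ?_
  -- The relation between `posMap` and the degree zero part extends to the completion by density. It
  -- shows that the extended projection fixes the kernel of `OmegaAn.proj` pointwise.
  have key : OmegaAn.map (FedosovOmega.posMap (A := A)) FedosovOmega.isBoundedMap_posMap =
      LinearMap.id - (OmegaAn.σ A).comp (OmegaAn.proj A).linear := by
    refine OmegaAn.linearMap_ext A (OmegaAn.isBoundedMap_map _ _) (isBoundedMap_sub isBoundedMap_id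
      (isBoundedMap_linear_comp (OmegaAn.isBoundedMap_σ A) (OmegaAn.proj A).bounded)) fun y => ?_
    rw [OmegaAn.map_of]
    change _ = OmegaAn.of A y - OmegaAn.σ A ((OmegaAn.proj A).linear (OmegaAn.of A y))
    rw [OmegaAn.proj_of]
    exact map_sub (OmegaAn.of A) _ _
  refine (LinearMap.congr_fun key x).trans ?_
  change x - OmegaAn.σ A (OmegaAn.proj A x) = x
  rw [h0 x hx, map_zero, sub_zero]

end Projection

end BornologicalAlgebra
-- Curvature products and the evaluation of even forms.
namespace BornologicalAlgebra

/-! ### Linear maps with analytically nilpotent curvature -/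

section Curvature

variable {A : Type*} [NonUnitalRing A] [Module ℂ A] {B : Type*} [NonUnitalRing B] [Module ℂ B]

/-- The curvature `ω (a, b) = l (a b) - l a · l b` of a linear map. -/
def curvature (l : A →ₗ[ℂ] B) (a b : A) : B := l (a * b) - l a * l b

/-- Bounded linear maps with analytically nilpotent curvature. -/
structure IsLanilcur [Bornology A] [Bornology B] (l : A →ₗ[ℂ] B) : Prop where
  bounded : IsBoundedMap l
  nilpotent : ∀ S : Set A, IsBounded S →
    IsBounded (Subsemigroup.closure (image2 (curvature l) S S) : Set B)

end Curvature

/-! ### A representation of the differential envelope -/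

namespace OmegaUnital

section Action

variable {A : Type*} [NonUnitalRing A] [Module ℂ A] [IsScalarTower ℂ A A] [SMulCommClass ℂ A A]
  {N : Type*} [AddCommGroup N] [Module ℂ N] (δ : A →ₗ[ℂ] Module.End ℂ N)

/-- The action of `a` on `N ⊕ A ⊗ N`. -/
noncomputable def incEnd : A →ₗ[ℂ] Module.End ℂ (N × (A ⊗[ℂ] N)) where
  toFun a := LinearMap.prod 0 ((TensorProduct.mk ℂ A N a).comp (LinearMap.fst _ _ _) +
    ((LinearMap.mul ℂ A a).rTensor N).comp (LinearMap.snd _ _ _))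
  map_add' a b := by
    refine LinearMap.ext fun x => Prod.ext (by simp) ?_
    simp only [map_add, LinearMap.rTensor_add, LinearMap.prod_apply, LinearMap.add_apply,
      Function.prod_apply, LinearMap.comp_apply, Prod.snd_add]
    abel
  map_smul' c a := by
    refine LinearMap.ext fun x => Prod.ext (by simp) ?_
    simp [TensorProduct.smul_tmul', LinearMap.rTensor_smul]

theorem incEnd_apply (a : A) (n : N) (t : A ⊗[ℂ] N) :
    incEnd a (n, t) = (0, a ⊗ₜ n + (LinearMap.mul ℂ A a).rTensor N t) := rfl

/-- The action of `da` on `N ⊕ A ⊗ N`. -/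
noncomputable def dgenEnd : A →ₗ[ℂ] Module.End ℂ (N × (A ⊗[ℂ] N)) where
  -- Here `N` models closed forms and `b ⊗ n` models `b · n`. The rule `da · b n = d(ab) n - a · db
  -- n` dictates the action on the second summand, with `δ` giving the action of differentials on
  -- `N`.
  toFun a := LinearMap.prod
    ((TensorProduct.lift δ).comp ((LinearMap.snd _ _ _).comp (incEnd a)))
    (-((TensorProduct.mk ℂ A N a).comp ((TensorProduct.lift δ).comp (LinearMap.snd _ _ _))))
  map_add' a b := by
    refine LinearMap.ext fun x => Prod.ext (by simp) ?_
    simp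
    abel
  map_smul' c a := by
    refine LinearMap.ext fun x => Prod.ext (by simp) ?_
    simp [TensorProduct.smul_tmul']

theorem dgenEnd_apply (a : A) (n : N) (t : A ⊗[ℂ] N) :
    dgenEnd δ a (n, t) =
      (TensorProduct.lift δ (a ⊗ₜ n + (LinearMap.mul ℂ A a).rTensor N t),
        -(a ⊗ₜ TensorProduct.lift δ t)) := rfl

theorem mul_rTensor_mul (a b : A) (t : A ⊗[ℂ] N) :
    (LinearMap.mul ℂ A (a * b)).rTensor N t =
      (LinearMap.mul ℂ A a).rTensor N ((LinearMap.mul ℂ A b).rTensor N t) := by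
  rw [← LinearMap.rTensor_comp_apply]
  congr 2
  exact LinearMap.ext fun c => mul_assoc a b c

/-- The action of the differential envelope on `N ⊕ A ⊗ N`. -/
noncomputable def action : OmegaUnital A →ₐ[ℂ] Module.End ℂ (N × (A ⊗[ℂ] N)) :=
  -- No condition on `δ` is needed, because differentials satisfy no relations among themselves.
  -- Linear maps defined on forms `a₀ da₁ ⋯ daₙ` thus become well defined without a basis or normal
  -- form for the differential envelope.
  lift incEnd (dgenEnd δ)
    (fun a b => LinearMap.ext fun ⟨n, t⟩ => by
      simp only [Module.End.mul_apply, incEnd_apply, mul_rTensor_mul, map_add,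
        LinearMap.rTensor_tmul, LinearMap.mul_apply', TensorProduct.tmul_zero, zero_add])
    (fun a b => LinearMap.ext fun ⟨n, t⟩ => by
      simp only [Module.End.mul_apply, LinearMap.add_apply, incEnd_apply, dgenEnd_apply,
        mul_rTensor_mul, map_add, map_neg, LinearMap.rTensor_tmul, LinearMap.mul_apply',
        TensorProduct.tmul_zero, zero_add, Prod.mk_add_mk, TensorProduct.lift.tmul,
        TensorProduct.tmul_add, add_zero]
      refine Prod.ext rfl ?_
      simp only
      abel)

theorem action_inc (a : A) (n : N) : action δ (inc a) (n, 0) = (0, a ⊗ₜ n) := by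
  rw [action, lift_inc, incEnd_apply, map_zero, add_zero]

theorem action_dgen (a : A) (n : N) : action δ (dgen a) (n, 0) = (δ a n, 0) := by
  rw [action, lift_dgen, dgenEnd_apply, map_zero, add_zero, map_zero, TensorProduct.tmul_zero,
    neg_zero, TensorProduct.lift.tmul]

/-- Closed forms preserve the summand `N`, where they act by iterating `δ` from the right end of the
list. -/
theorem action_dprod (l : List A) (n : N) :
    action δ (dprod l) (n, 0) = (l.foldr (fun a n => δ a n) n, 0) := by
  induction l with
  | nil => simp [dprod]
  | cons a l ih =>
    rw [dprod_cons, map_mul, Module.End.mul_apply, ih, action_dgen]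
    rfl

end Action

section Eval

variable {A : Type*} [NonUnitalRing A] [Module ℂ A] [IsScalarTower ℂ A A] [SMulCommClass ℂ A A]
  {B : Type*} [NonUnitalRing B] [Module ℂ B] [IsScalarTower ℂ B B] [SMulCommClass ℂ B B]
  (l : A →ₗ[ℂ] B)

/-- The curvature of `l` as a bilinear map to the unitization. -/
noncomputable def curvatureHom : A →ₗ[ℂ] A →ₗ[ℂ] Unitization ℂ B :=
  LinearMap.mk₂ ℂ (fun a b => ((curvature l a b : B) : Unitization ℂ B))
    (fun a b c => by
      rw [← Unitization.inr_add]
      simp only [curvature, add_mul, map_add]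
      congr 1
      abel)
    (fun c a b => by
      rw [← Unitization.inr_smul]
      simp only [curvature, smul_mul_assoc, map_smul, smul_sub])
    (fun a b c => by
      rw [← Unitization.inr_add]
      simp only [curvature, mul_add, map_add]
      congr 1
      abel)
    (fun c a b => by
      rw [← Unitization.inr_smul]
      simp only [curvature, mul_smul_comm, map_smul, smul_sub])

/-- The product `ω(a₁, a₂) ⋯ ω(a₂ₙ₋₁, a₂ₙ)` for lists of even length, and `0` for lists of odd
length. -/
def curvatureProd : List A → Unitization ℂ B
  | [] => 1
  | [_] => 0
  | a :: b :: L => ((curvature l a b : B) : Unitization ℂ B) * curvatureProd L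

/-- The operators on `B⁺ ⊕ A ⊗ B⁺` by which the forms `da` act. -/
noncomputable def curvatureAct :
    A →ₗ[ℂ] Module.End ℂ (Unitization ℂ B × (A ⊗[ℂ] Unitization ℂ B)) where
  -- An element `b ⊗ u` of the second summand stores a differential `db` that waits for a partner.
  -- The next differential `da` on its left converts it into `ω(a, b) u` in the first summand.
  -- Starting from the first summand, forms of odd degree therefore end in the second one.
  toFun a := LinearMap.prod
    ((TensorProduct.lift ((LinearMap.mul ℂ (Unitization ℂ B)).comp (curvatureHom l a))).comp
      (LinearMap.snd _ _ _))
    ((TensorProduct.mk ℂ A (Unitization ℂ B) a).comp (LinearMap.fst _ _ _))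
  map_add' a b := by
    refine LinearMap.ext fun ⟨u, t⟩ => Prod.ext ?_ (by simp)
    change TensorProduct.lift ((LinearMap.mul ℂ (Unitization ℂ B)).comp (curvatureHom l (a + b))) t =
      TensorProduct.lift ((LinearMap.mul ℂ (Unitization ℂ B)).comp (curvatureHom l a)) t +
      TensorProduct.lift ((LinearMap.mul ℂ (Unitization ℂ B)).comp (curvatureHom l b)) t
    induction t using TensorProduct.induction_on with
    | zero => simp
    | tmul x y => simp
    | add x y hx hy =>
      rw [map_add, hx, hy, map_add, map_add]
      abel
  map_smul' c a := by
    refine LinearMap.ext fun ⟨u, t⟩ => Prod.ext ?_ (by simp)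
    change TensorProduct.lift ((LinearMap.mul ℂ (Unitization ℂ B)).comp (curvatureHom l (c • a))) t =
      c • TensorProduct.lift ((LinearMap.mul ℂ (Unitization ℂ B)).comp (curvatureHom l a)) t
    induction t using TensorProduct.induction_on with
    | zero => simp
    | tmul x y => simp
    | add x y hx hy => rw [map_add, hx, hy, map_add, smul_add]

theorem curvatureAct_fst (a : A) (x : Unitization ℂ B × (A ⊗[ℂ] Unitization ℂ B)) :
    (curvatureAct l a x).1 =
      TensorProduct.lift ((LinearMap.mul ℂ (Unitization ℂ B)).comp (curvatureHom l a)) x.2 := rfl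

theorem curvatureAct_snd (a : A) (x : Unitization ℂ B × (A ⊗[ℂ] Unitization ℂ B)) :
    (curvatureAct l a x).2 = a ⊗ₜ x.1 := rfl

theorem foldr_curvatureAct_fst (L : List A) :
    (L.foldr (fun a n => curvatureAct l a n) (1, 0)).1 = curvatureProd l L := by
  induction L using curvatureProd.induct with
  | case1 => rfl
  | case2 a =>
    rw [List.foldr_cons, curvatureAct_fst]
    exact map_zero _
  | case3 a b L ih =>
    rw [curvatureProd, ← ih, List.foldr_cons, List.foldr_cons, curvatureAct_fst, curvatureAct_snd,
      TensorProduct.lift.tmul]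
    rfl

/-- The linear map `⟨a₀⟩ da₁ ⋯ da₂ₙ ↦ ⟨l a₀⟩ ω(a₁, a₂) ⋯ ω(a₂ₙ₋₁, a₂ₙ)` that annihilates the forms
of odd degree. -/
noncomputable def evalForms : OmegaUnital A →ₗ[ℂ] Unitization ℂ B :=
  -- The form is applied to the vector `((1, 0), 0)`. A closed form ends in the first summand, whose
  -- even coordinate is the curvature product. A form with leading coefficient `a` ends in `A ⊗ N`,
  -- and `a ⊗ (u, t)` is read off as `l a * u`.
  (((LinearMap.fst _ _ _).coprod ((TensorProduct.lift ((LinearMap.mul ℂ (Unitization ℂ B)).comp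
    ((Unitization.inrHom ℂ ℂ B).comp l))).comp ((LinearMap.fst _ _ _).lTensor A))).comp
    (LinearMap.applyₗ (((1 : Unitization ℂ B), (0 : A ⊗[ℂ] Unitization ℂ B)),
      (0 : A ⊗[ℂ] (Unitization ℂ B × (A ⊗[ℂ] Unitization ℂ B)))))).comp
    (action (curvatureAct l)).toLinearMap

theorem evalForms_dprod (L : List A) : evalForms l (dprod L) = curvatureProd l L := by
  have : evalForms l (dprod L) = ((LinearMap.fst _ _ _).coprod ((TensorProduct.lift
    ((LinearMap.mul ℂ (Unitization ℂ B)).comp ((Unitization.inrHom ℂ ℂ B).comp l))).comp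
    ((LinearMap.fst _ _ _).lTensor A))) (action (curvatureAct l) (dprod L) ((1, 0), 0)) := rfl
  rw [this, action_dprod, LinearMap.coprod_apply, map_zero, add_zero, LinearMap.fst_apply,
    foldr_curvatureAct_fst]

theorem evalForms_inc_dprod (a : A) (L : List A) :
    evalForms l (inc a * dprod L) = (l a : Unitization ℂ B) * curvatureProd l L := by
  have : evalForms l (inc a * dprod L) = ((LinearMap.fst _ _ _).coprod ((TensorProduct.lift
    ((LinearMap.mul ℂ (Unitization ℂ B)).comp ((Unitization.inrHom ℂ ℂ B).comp l))).comp
    ((LinearMap.fst _ _ _).lTensor A)))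
      (action (curvatureAct l) (inc a * dprod L) ((1, 0), 0)) := rfl
  rw [this, map_mul, Module.End.mul_apply, action_dprod, action_inc, LinearMap.coprod_apply,
    map_zero, zero_add, ← foldr_curvatureAct_fst]
  rfl

/-- A submultiplicative set that contains all curvatures bounds their products uniformly in the
length. The empty list is exceptional because its value is the adjoined unit. -/
theorem curvatureProd_mem {S : Set A} {D : Set B} (hD : ∀ x ∈ D, ∀ y ∈ D, x * y ∈ D)
    (h0 : (0 : B) ∈ D) (hSD : ∀ a ∈ S, ∀ b ∈ S, curvature l a b ∈ D) (L : List A)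
    (hL : ∀ a ∈ L, a ∈ S) : L = [] ∨ ∃ z ∈ D, curvatureProd l L = (z : Unitization ℂ B) := by
  induction L using curvatureProd.induct with
  | case1 => exact Or.inl rfl
  | case2 a => exact Or.inr ⟨0, h0, rfl⟩
  | case3 a b L ih =>
    right
    have hab := hSD a (hL a (by simp)) b (hL b (by simp))
    rcases ih (fun c hc => hL c (by simp [hc])) with rfl | ⟨z, hz, h⟩
    · exact ⟨_, hab, by simp [curvatureProd]⟩
    · exact ⟨_, hD _ hab _ hz, by rw [curvatureProd, h, Unitization.inr_mul]⟩

/-- Only the empty form contributes a scalar part. Consequently the evaluation sends the kernel of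
the augmentation into `B` itself. -/
theorem evalForms_fst (x : OmegaUnital A) : (evalForms l x).fst = aug x := by
  have hx : x ∈ formSpan A := formSpan_eq_top (A := A) ▸ Submodule.mem_top
  induction hx using Submodule.span_induction with
  | mem x hx =>
    rcases hx with ⟨L, rfl⟩ | ⟨a, L, rfl⟩
    · rw [evalForms_dprod]
      rcases curvatureProd_mem l (S := univ) (D := univ) (by simp) (by simp) (by simp) L (by simp)
        with rfl | ⟨z, -, hz⟩
      · simp [curvatureProd, dprod]
      · rcases eq_or_ne L [] with rfl | hne
        · simp [curvatureProd, dprod]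
        · rw [hz, aug_dprod hne, Unitization.fst_inr]
    · simp [evalForms_inc_dprod, aug]
  | zero => simp
  | add x y _ _ hx hy => simp [hx, hy]
  | smul c x _ hx => simp [hx]

end Eval

end OmegaUnital

/-! ### Even forms -/

section Even

open OmegaUnital

namespace FedosovOmega

variable {A : Type*} [NonUnitalRing A] [Module ℂ A] [Bornology A] [BornAlgebra A]

/-- The identity `da db = ab - a ⊙ b` expresses two differentials by forms of degree zero. Longer
even products follow because the Fedosov product with a closed right factor is the ordinary product.
-/
theorem dform_even_induction {P : FedosovOmega A → Prop} (h0 : ∀ a, P (ofDegZero a))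
    (hadd : ∀ x y, P x → P y → P (x + y)) (hsmul : ∀ (c : ℂ) x, P x → P (c • x))
    (hmul : ∀ x y, P x → P y → P (x * y)) (L : List A) (hL : Even L.length) (hne : L ≠ []) :
    P ⟨dprod L, aug_dprod hne⟩ := by
  have two : ∀ a b : A, P ⟨dprod [a, b], aug_dprod (by simp)⟩ := by
    intro a b
    have := hadd _ _ (h0 (a * b)) (hsmul (-1) _ (hmul _ _ (h0 a) (h0 b)))
    refine (congrArg P (val_injective ?_)).mpr this
    change dprod [a, b] = val _
    rw [map_add, map_smul, val_mul, val_ofDegZero, val_ofDegZero, val_ofDegZero, inc_mul]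
    simp [dprod]
  induction L using List.twoStepInduction with
  | nil => exact (hne rfl).elim
  | singleton a => simp at hL
  | cons_cons a b L ih _ =>
    rcases eq_or_ne L [] with rfl | hne'
    · exact two a b
    · have := hmul _ _ (two a b) (ih (by simpa [Nat.even_add_one] using hL) hne')
      refine (congrArg P (val_injective ?_)).mpr this
      change dprod (a :: b :: L) = dprod [a, b] * dprod L - d (grade (dprod [a, b])) * d (dprod L)
      rw [d_dprod, mul_zero, sub_zero, ← dprod_append]
      rfl

/-- The even forms are generated by the forms of degree zero for the Fedosov product. -/
theorem even_induction {P : FedosovOmega A → Prop} (h0 : ∀ a, P (ofDegZero a))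
    (hadd : ∀ x y, P x → P y → P (x + y)) (hsmul : ∀ (c : ℂ) x, P x → P (c • x))
    (hmul : ∀ x y, P x → P y → P (x * y)) (x : FedosovOmega A) : P (x + gradeMap x) := by
  have hz : P 0 := by simpa using hsmul 0 _ (h0 0)
  have hx : x ∈ Submodule.span ℂ (⋃₀ {G | ∃ S : Set A, IsBounded S ∧ G = forms S}) :=
    (span_forms (A := A)) ▸ Submodule.mem_top
  have hg : ∀ L : List A, grade (dprod L) = (-1 : ℂ) ^ L.length • dprod L := fun L => by
    rw [grade_dprod, ← dprod_smul]
    simp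
  induction hx using Submodule.span_induction with
  | mem x hx =>
    obtain ⟨_, ⟨S, -, rfl⟩, L, -, hx⟩ := hx
    -- On a form of even degree `x + gradeMap x` is `2x`, and on a form of odd degree it is zero.
    rcases Nat.even_or_odd L.length with hL | hL
    · have e : x + gradeMap x = (2 : ℂ) • x := by
        refine val_injective ?_
        rw [map_add, val_gradeMap, map_smul, two_smul]
        congr 1
        rcases hx with ⟨a, -, h⟩ | ⟨-, h⟩ <;> rw [h] <;> simp [hg, hL]
      rw [e]
      refine hsmul _ _ ?_
      rcases hx with ⟨a, -, h⟩ | ⟨hne, h⟩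
      · rcases eq_or_ne L [] with rfl | hne
        · have : x = ofDegZero a := val_injective (by rw [h]; simp [dprod, val_ofDegZero])
          rw [this]
          exact h0 a
        -- The second factor is closed, so `a ⊙ (da₁ ⋯ daₙ)` is the ordinary product.
        · have := hmul _ _ (h0 a) (dform_even_induction h0 hadd hsmul hmul L hL hne)
          refine (congrArg P (val_injective ?_)).mpr this
          change val x = inc a * dprod L - d (grade (inc a)) * d (dprod L)
          rw [h, d_dprod, mul_zero, sub_zero]
      · have := dform_even_induction h0 hadd hsmul hmul L hL hne
        exact (congrArg P (val_injective h)).mpr this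
    · have e : x + gradeMap x = 0 := by
        refine val_injective ?_
        rw [map_add, val_gradeMap, map_zero]
        rcases hx with ⟨a, -, h⟩ | ⟨-, h⟩ <;> rw [h] <;> simp [hg, hL]
      rw [e]
      exact hz
  | zero => simpa using hz
  | add x y _ _ hx hy =>
    have := hadd _ _ hx hy
    convert this using 1
    rw [map_add]
    abel
  | smul c x _ hx =>
    have := hsmul c _ hx
    convert this using 1
    rw [map_smul, smul_add]

section EvalMap

variable {B : Type*} [NonUnitalRing B] [Module ℂ B] [Bornology B] [BornAlgebra B] (l : A →ₗ[ℂ] B)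

/-- The linear map `⟨a₀⟩ da₁ ⋯ da₂ₙ ↦ ⟨l a₀⟩ ω(a₁, a₂) ⋯ ω(a₂ₙ₋₁, a₂ₙ)` on the non-unital
differential envelope. -/
noncomputable def evalMap : FedosovOmega A →ₗ[ℂ] B where
  toFun x := (evalForms l (val x)).snd
  map_add' x y := by simp
  map_smul' c x := by simp

theorem inr_evalMap (x : FedosovOmega A) :
    (evalMap l x : Unitization ℂ B) = evalForms l (val x) := by
  refine Unitization.ext ?_ rfl
  rw [evalForms_fst, aug_val, Unitization.fst_inr]

theorem evalMap_ofDegZero (a : A) : evalMap l (ofDegZero a) = l a := by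
  refine Unitization.inr_injective (R := ℂ) ?_
  rw [inr_evalMap, val_ofDegZero]
  simpa [dprod, curvatureProd] using evalForms_inc_dprod l a []

/-- This is where the definition of the curvature enters. For `y = b η` with `η` closed, `a ⊙ y = ab
η - da db η` is evaluated with the coefficient `l(ab) - ω(a, b) = l(a) l(b)`. For closed `y` nothing
has to be corrected. -/
theorem evalMap_ofDegZero_mul (a : A) (y : FedosovOmega A) :
    evalMap l (ofDegZero a * y) = l a * evalMap l y := by
  have key : ∀ u : OmegaUnital A, evalForms l (inc a * u - dgen a * d u) =
      (l a : Unitization ℂ B) * evalForms l u := by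
    intro u
    have hu : u ∈ formSpan A := formSpan_eq_top (A := A) ▸ Submodule.mem_top
    induction hu using Submodule.span_induction with
    | mem u hu =>
      rcases hu with ⟨L, rfl⟩ | ⟨b, L, rfl⟩
      · rw [d_dprod, mul_zero, sub_zero, evalForms_inc_dprod, evalForms_dprod]
      · have e : dgen a * d (inc b * dprod L) = dprod (a :: b :: L) := by
          rw [d_mul, d_dprod, d_inc, mul_zero, add_zero, dprod_cons, dprod_cons]
        rw [e, ← mul_assoc, ← inc_mul, map_sub, evalForms_inc_dprod, evalForms_inc_dprod,
          evalForms_dprod, curvatureProd, ← sub_mul, curvature, ← mul_assoc, ← Unitization.inr_mul,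
          ← Unitization.inr_sub, sub_sub_cancel]
    | zero => simp
    | add x y _ _ hx hy =>
      rw [map_add, map_add, mul_add, mul_add, mul_add, add_sub_add_comm, map_add, hx, hy]
    | smul c x _ hx =>
      rw [map_smul, map_smul, mul_smul_comm, mul_smul_comm, mul_smul_comm, ← smul_sub, map_smul, hx]
  refine Unitization.inr_injective (R := ℂ) ?_
  rw [Unitization.inr_mul, inr_evalMap, inr_evalMap, val_mul, val_ofDegZero, grade_inc, d_inc, key]

/-- The map `evalMap l` is multiplicative on even forms. -/
theorem evalMap_mul (x y : FedosovOmega A) :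
    evalMap l ((x + gradeMap x) * y) = evalMap l (x + gradeMap x) * evalMap l y := by
  revert y
  -- The left factors that are multiplicative against every `y` form a subalgebra. It contains `A`,
  -- hence all even forms; the right factor may be any form.
  refine even_induction (P := fun z => ∀ y, evalMap l (z * y) = evalMap l z * evalMap l y)
    ?_ ?_ ?_ ?_ x
  · intro a y
    rw [evalMap_ofDegZero_mul, evalMap_ofDegZero]
  · intro x x' hx hx' y
    rw [add_mul, map_add, map_add, hx, hx', add_mul]
  · intro c x hx y
    rw [smul_mul_assoc, map_smul, map_smul, hx, smul_mul_assoc]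
  · intro x x' hx hx' y
    rw [mul_assoc, hx, hx', hx, mul_assoc]

/-- Nilpotency of the curvature yields one small submultiplicative disk `D` around `ω(S, S)`. All
forms with entries in `S`, of whatever degree, are then sent into `D ∪ l(S) ∪ l(S) D`. -/
theorem isBoundedMap_evalMap {l : A →ₗ[ℂ] B} (hl : IsLanilcur l) : IsBoundedMap (evalMap l) := by
  intro X hX
  refine isBounded_image_generated _ ?_ hX
  rintro _ ⟨S, hS, rfl⟩
  obtain ⟨D, hD, -, h0, hSD, hDD⟩ := exists_submultiplicative_disk (hl.nilpotent S hS)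
  have hlS := hl.bounded S hS
  refine ((hD.union hlS).union (BornAlgebra.isBounded_mul _ _ hlS hD)).subset ?_
  rintro _ ⟨x, ⟨L, hL, hx⟩, rfl⟩
  have key := curvatureProd_mem l hDD h0 (fun a ha b hb => hSD ⟨a, ha, b, hb, rfl⟩) L hL
  have inj := Unitization.inr_injective (R := ℂ) (A := B)
  rcases hx with ⟨a, ha, hx⟩ | ⟨hne, hx⟩
  · have e := inr_evalMap l x
    rw [hx, evalForms_inc_dprod] at e
    rcases key with rfl | ⟨z, hz, h⟩
    · refine Or.inl (Or.inr ⟨a, ha, inj ?_⟩)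
      rw [e]
      simp [curvatureProd]
    · refine Or.inr ⟨l a, ⟨a, ha, rfl⟩, z, hz, inj ?_⟩
      rw [e, h, Unitization.inr_mul]
  · rcases key with rfl | ⟨z, hz, h⟩
    · exact (hne rfl).elim
    · have e := inr_evalMap l x
      rw [hx, evalForms_dprod, h] at e
      rw [inj e]
      exact Or.inl (Or.inl hz)

end EvalMap

end FedosovOmega

end Even

end BornologicalAlgebra
-- Homomorphisms on the analytic tensor algebra and lifting modulo a-nilpotent kernels.
namespace BornologicalAlgebra

namespace BHom

variable {A : CBAlg.{u}} {B : CBAlg.{v}} {C : CBAlg.{w}}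

theorem map_mul (f : BHom A B) (x y : A) : f (x * y) = f x * f y := f.map_mul' x y
theorem map_add (f : BHom A B) (x y : A) : f (x + y) = f x + f y := f.linear.map_add x y
theorem map_sub (f : BHom A B) (x y : A) : f (x - y) = f x - f y := f.linear.map_sub x y
theorem map_smul (f : BHom A B) (c : ℂ) (x : A) : f (c • x) = c • f x := f.linear.map_smul c x
theorem map_zero (f : BHom A B) : f 0 = 0 := f.linear.map_zero
theorem linear_apply (f : BHom A B) (x : A) : f.linear x = f x := rfl
theorem comp_apply (g : BHom B C) (f : BHom A B) (x : A) : g.comp f x = g (f x) := rfl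

theorem hom_ext {f g : BHom A B} (h : ∀ x, f x = g x) : f = g := BHom.ext (funext h)

theorem image_closure_subset (f : BHom A B) (S : Set A) :
    f '' (Subsemigroup.closure S : Set A) ⊆ Subsemigroup.closure (f '' S) := by
  rintro _ ⟨x, hx, rfl⟩
  induction hx using Subsemigroup.closure_induction with
  | mem x hx => exact Subsemigroup.subset_closure ⟨x, hx, rfl⟩
  | mul x y _ _ hx hy =>
    rw [SetLike.mem_coe, f.map_mul]
    exact mul_mem hx hy

theorem closure_image_subset (f : BHom A B) (S : Set A) :
    (Subsemigroup.closure (f '' S) : Set B) ⊆ f '' (Subsemigroup.closure S : Set A) := by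
  intro x hx
  induction hx using Subsemigroup.closure_induction with
  | mem x hx =>
    obtain ⟨y, hy, rfl⟩ := hx
    exact ⟨y, Subsemigroup.subset_closure hy, rfl⟩
  | mul x y _ _ hx hy =>
    obtain ⟨x, hx, rfl⟩ := hx
    obtain ⟨y, hy, rfl⟩ := hy
    exact ⟨x * y, mul_mem hx hy, f.map_mul x y⟩

/-- Analytic nilpotency of a small set can be tested after an embedding. -/
theorem isBounded_closure_of_embedding (f : BHom A B)
    (hf : ∀ S : Set A, IsBounded (f '' S) → IsBounded S) {S : Set A}
    (h : IsBounded (Subsemigroup.closure (f '' S) : Set B)) :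
    IsBounded (Subsemigroup.closure S : Set A) :=
  hf _ (h.subset (f.image_closure_subset S))

theorem kerIncl_eq_zero (f : BHom A B) (x : f.ker) : f (f.kerIncl x) = 0 := x.2

theorem isBounded_ker_iff (f : BHom A B) {S : Set f.ker} :
    IsBounded S ↔ IsBounded (f.kerIncl '' S) :=
  isBounded_sub_iff (f.equalizer (.zero A B))

end BHom

/-! ### The universal property of the analytic tensor algebra -/

namespace Tan

variable (A : CBAlg.{u}) {B : CBAlg.{v}}

/-- The inclusion of the analytic tensor algebra into the analytic differential forms. -/
noncomputable def incl : BHom (Tan A) (OmegaAn A) :=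
  CBAlg.incl _ ((OmegaAn.grading A).isBornClosed_equalizer (.id _))

theorem incl_injective : Function.Injective (incl A) := Subtype.val_injective

theorem grading_incl (x : Tan A) : OmegaAn.grading A (incl A x) = incl A x := x.2

theorem isBounded_iff {S : Set (Tan A)} : IsBounded S ↔ IsBounded (incl A '' S) :=
  isBounded_sub_iff ((OmegaAn.grading A).equalizer (.id _))

theorem grading_of (x : FedosovOmega A) :
    (OmegaAn.grading A).linear (OmegaAn.of A x) = OmegaAn.of A (FedosovOmega.gradeMap x) :=
  CBAlg.completionMap_of _ FedosovOmega.isBoundedMap_gradeMap FedosovOmega.gradeMap_mul x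

/-- The canonical bounded linear section `A → 𝒯 A`. -/
noncomputable def σ : A →ₗ[ℂ] Tan A where
  toFun a := ⟨OmegaAn.σ A a, (grading_of A _).trans
    (congrArg (OmegaAn.of A) (FedosovOmega.gradeMap_ofDegZero a))⟩
  map_add' a b := incl_injective A ((OmegaAn.σ A).map_add a b)
  map_smul' c a := incl_injective A ((OmegaAn.σ A).map_smul c a)

theorem incl_σ (a : A) : incl A (σ A a) = OmegaAn.of A (FedosovOmega.ofDegZero a) := rfl

theorem isBoundedMap_σ : IsBoundedMap (σ A) := by
  intro S hS
  rw [isBounded_iff, image_image]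
  exact OmegaAn.isBoundedMap_σ A S hS

theorem τ_σ (a : A) : τ A (σ A a) = a := OmegaAn.proj_σ A a

/-- The projection to even forms, multiplied by two. -/
noncomputable def even : OmegaAn A →ₗ[ℂ] Tan A where
  toFun x := ⟨x + OmegaAn.grading A x, by
    -- The grading is an involution on forms, hence on the completion by density; so it fixes `x +
    -- grading x`.
    have h : OmegaAn.grading A (OmegaAn.grading A x) = x := by
      have := OmegaAn.linearMap_ext A
        (f := (OmegaAn.grading A).linear.comp (OmegaAn.grading A).linear) (g := LinearMap.id)
        (isBoundedMap_linear_comp (OmegaAn.grading A).bounded (OmegaAn.grading A).bounded)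
        isBoundedMap_id fun y => by
          rw [LinearMap.comp_apply, grading_of, grading_of, LinearMap.id_apply]
          congr 1
          exact FedosovOmega.val_injective (OmegaUnital.grade_grade _)
      exact LinearMap.congr_fun this x
    change OmegaAn.grading A (x + OmegaAn.grading A x) = x + OmegaAn.grading A x
    rw [BHom.map_add, h, add_comm]⟩
  map_add' x y := incl_injective A (by
    change x + y + OmegaAn.grading A (x + y) =
      x + OmegaAn.grading A x + (y + OmegaAn.grading A y)
    rw [BHom.map_add]
    abel)
  map_smul' c x := incl_injective A (by
    change c • x + OmegaAn.grading A (c • x) = c • (x + OmegaAn.grading A x)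
    rw [BHom.map_smul, smul_add])

theorem incl_even (x : OmegaAn A) : incl A (even A x) = x + OmegaAn.grading A x := rfl

theorem even_incl (x : Tan A) : even A (incl A x) = (2 : ℂ) • x := by
  refine incl_injective A ?_
  rw [incl_even, grading_incl, BHom.map_smul, two_smul]

theorem isBoundedMap_even : IsBoundedMap (even A) := by
  intro S hS
  rw [isBounded_iff, image_image]
  exact isBoundedMap_add (l := LinearMap.id) (l' := (OmegaAn.grading A).linear) isBoundedMap_id
    (OmegaAn.grading A).bounded S hS

variable {A}

/-- Bounded homomorphisms on the analytic tensor algebra are determined by their values on `A`. -/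
theorem hom_ext {f g : BHom (Tan A) B} (h : ∀ a, f (σ A a) = g (σ A a)) : f = g := by
  -- Density is available for `OmegaAn A`, not directly for its even part. Since `even` restricts to
  -- multiplication by `2` on even elements, it suffices to compare the maps after `even`, where
  -- uncompleted forms can be used.
  have key : f.linear.comp (even A) = g.linear.comp (even A) := by
    refine OmegaAn.linearMap_ext A (isBoundedMap_linear_comp f.bounded (isBoundedMap_even A))
      (isBoundedMap_linear_comp g.bounded (isBoundedMap_even A)) fun x => ?_
    obtain ⟨z, hz, hfg⟩ : ∃ z : Tan A,
        incl A z = OmegaAn.of A (x + FedosovOmega.gradeMap x) ∧ f z = g z := by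
      refine FedosovOmega.even_induction
        (P := fun y => ∃ z : Tan A, incl A z = OmegaAn.of A y ∧ f z = g z) ?_ ?_ ?_ ?_ x
      · exact fun a => ⟨σ A a, incl_σ A a, h a⟩
      · rintro x y ⟨z, hz, h⟩ ⟨z', hz', h'⟩
        exact ⟨z + z', by rw [BHom.map_add, hz, hz', _root_.map_add], by
          rw [BHom.map_add, BHom.map_add, h, h']⟩
      · rintro c x ⟨z, hz, h⟩
        exact ⟨c • z, by rw [BHom.map_smul, hz, _root_.map_smul], by
          rw [BHom.map_smul, BHom.map_smul, h]⟩
      · rintro x y ⟨z, hz, h⟩ ⟨z', hz', h'⟩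
        refine ⟨z * z', ?_, by rw [BHom.map_mul, BHom.map_mul, h, h']⟩
        rw [BHom.map_mul, hz, hz']
        exact (CBAlg.of_mul x y).symm
    have e : even A (OmegaAn.of A x) = z := by
      refine incl_injective A ?_
      rw [incl_even, hz, _root_.map_add, ← grading_of]
      rfl
    rw [LinearMap.comp_apply, LinearMap.comp_apply, e]
    exact hfg
  refine BHom.hom_ext fun x => ?_
  have := LinearMap.congr_fun key (incl A x)
  rw [LinearMap.comp_apply, LinearMap.comp_apply, even_incl, _root_.map_smul, _root_.map_smul] at this
  exact smul_right_injective B (two_ne_zero : (2 : ℂ) ≠ 0) this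

section Lift

variable (l : A →ₗ[ℂ] B) (hl : IsLanilcur l)

/-- The extension of `FedosovOmega.evalMap` to analytic differential forms. -/
noncomputable def liftOmega : OmegaAn A →ₗ[ℂ] B :=
  CBAlg.liftLinear (A := FedosovOmega A) (FedosovOmega.evalMap l)
    (FedosovOmega.isBoundedMap_evalMap hl)

theorem isBoundedMap_liftOmega : IsBoundedMap (liftOmega l hl) :=
  CBAlg.isBoundedMap_liftLinear (A := FedosovOmega A) _ _

theorem liftOmega_of (x : FedosovOmega A) :
    liftOmega l hl (OmegaAn.of A x) = FedosovOmega.evalMap l x :=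
  CBAlg.liftLinear_of (A := FedosovOmega A) _ _ x

/-- Multiplicativity passes from uncompleted forms to the completion by density in one variable at a
time. The left factor has to be even: `da ⊙ db = da db` is evaluated to `ω(a, b)`, although `da` and
`db` are sent to zero. -/
theorem liftOmega_even_mul (x y : OmegaAn A) :
    liftOmega l hl (incl A (even A x) * y) =
      liftOmega l hl (incl A (even A x)) * liftOmega l hl y := by
  have hF := isBoundedMap_liftOmega l hl
  have hE : IsBoundedMap ((incl A).linear.comp (even A)) :=
    isBoundedMap_linear_comp (incl A).bounded (isBoundedMap_even A)
  have h1 : ∀ x y : FedosovOmega A,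
      liftOmega l hl (incl A (even A (OmegaAn.of A x)) * OmegaAn.of A y) =
        liftOmega l hl (incl A (even A (OmegaAn.of A x))) * liftOmega l hl (OmegaAn.of A y) := by
    intro x y
    have e : incl A (even A (OmegaAn.of A x)) = OmegaAn.of A (x + FedosovOmega.gradeMap x) := by
      rw [incl_even, _root_.map_add, ← grading_of]
      rfl
    have e2 : OmegaAn.of A (x + FedosovOmega.gradeMap x) * OmegaAn.of A y =
      OmegaAn.of A ((x + FedosovOmega.gradeMap x) * y) := (CBAlg.of_mul _ _).symm
    rw [e, e2, liftOmega_of, liftOmega_of, liftOmega_of, FedosovOmega.evalMap_mul]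
  have h2 : ∀ (x : OmegaAn A) (y : FedosovOmega A),
      liftOmega l hl (incl A (even A x) * OmegaAn.of A y) =
        liftOmega l hl (incl A (even A x)) * liftOmega l hl (OmegaAn.of A y) := by
    intro x y
    exact LinearMap.congr_fun (OmegaAn.linearMap_ext A
      (f := (liftOmega l hl).comp ((LinearMap.mulRight ℂ (OmegaAn.of A y)).comp
        ((incl A).linear.comp (even A))))
      (g := (LinearMap.mulRight ℂ (liftOmega l hl (OmegaAn.of A y))).comp ((liftOmega l hl).comp
        ((incl A).linear.comp (even A))))
      (isBoundedMap_linear_comp hF (isBoundedMap_linear_comp (isBoundedMap_mulRight _) hE))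
      (isBoundedMap_linear_comp (isBoundedMap_mulRight _) (isBoundedMap_linear_comp hF hE))
      fun x => h1 x y) x
  exact LinearMap.congr_fun (OmegaAn.linearMap_ext A
    (f := (liftOmega l hl).comp (LinearMap.mulLeft ℂ (incl A (even A x))))
    (g := (LinearMap.mulLeft ℂ (liftOmega l hl (incl A (even A x)))).comp (liftOmega l hl))
    (isBoundedMap_linear_comp hF (isBoundedMap_mulLeft _))
    (isBoundedMap_linear_comp (isBoundedMap_mulLeft _) hF) fun y => h2 x y) y

/-- The bounded homomorphism on the analytic tensor algebra induced by a bounded linear map with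
analytically nilpotent curvature. -/
noncomputable def lift : BHom (Tan A) B :=
  .ofLinear ((liftOmega l hl).comp (incl A).linear)
    (isBoundedMap_linear_comp (isBoundedMap_liftOmega l hl) (incl A).bounded) fun x y => by
      -- For even `x` the element `even (incl x)` is `2x`, so the factor `2` can be cancelled on
      -- both sides.
      have h := liftOmega_even_mul l hl (incl A x) (incl A y)
      rw [even_incl, BHom.map_smul, smul_mul_assoc, _root_.map_smul, _root_.map_smul,
        smul_mul_assoc] at h
      change liftOmega l hl (incl A (x * y)) = liftOmega l hl (incl A x) * liftOmega l hl (incl A y)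
      rw [BHom.map_mul]
      exact smul_right_injective B (two_ne_zero : (2 : ℂ) ≠ 0) h

theorem lift_σ (a : A) : lift l hl (σ A a) = l a :=
  (liftOmega_of l hl _).trans (FedosovOmega.evalMap_ofDegZero l a)

end Lift

variable (A)

theorem isBounded_closure_ker {X : Set (Tan A)} (hX : IsBounded X) (h0 : ∀ x ∈ X, τ A x = 0) :
    IsBounded (Subsemigroup.closure X : Set (Tan A)) := by
  refine (incl A).isBounded_closure_of_embedding (fun S => (isBounded_iff A).2)
    (OmegaAn.isBounded_closure_ker A ((incl A).bounded X hX) ?_)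
  rintro _ ⟨x, hx, rfl⟩
  exact h0 x hx

end Tan

theorem isANilpotent_Jan (A : CBAlg.{u}) : IsANilpotent (Jan A) := by
  intro S hS
  refine (Tan.τ A).kerIncl.isBounded_closure_of_embedding (fun S => (Tan.τ A).isBounded_ker_iff.2)
    (Tan.isBounded_closure_ker A ((Tan.τ A).kerIncl.bounded S hS) ?_)
  rintro _ ⟨x, -, rfl⟩
  exact (Tan.τ A).kerIncl_eq_zero x

/-! ### Extensions of analytically nilpotent sets -/

section Extension

variable {E : CBAlg.{u}} {Q : CBAlg.{v}}

/-- A kernel is a subspace, so a nilpotent kernel tolerates any rescaling of its small subsets. This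
supplies the constants needed to keep sums inside a disk. -/
theorem isBounded_closure_smul_of_ker {N : CBAlg.{u}} {B : CBAlg.{v}} (p : BHom N B)
    (hp : ∀ X : Set N, IsBounded X → (∀ x ∈ X, p x = 0) →
      IsBounded (Subsemigroup.closure X : Set N)) {X : Set N} (hX : IsBounded X)
    (h0 : ∀ x ∈ X, p x = 0) (c : ℂ) : IsBounded (Subsemigroup.closure (c • X) : Set N) := by
  refine hp _ (isBounded_smul hX c) ?_
  rintro _ ⟨x, hx, rfl⟩
  rw [BHom.map_smul, h0 x hx, smul_zero]

/-- Extensions of analytically nilpotent sets by analytically nilpotent algebras are analytically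
nilpotent. -/
theorem isBounded_closure_of_extension (p : BHom E Q) (s : Q →ₗ[ℂ] E) (hs : IsBoundedMap s)
    (hps : ∀ q, p (s q) = q)
    (hker : ∀ X : Set E, IsBounded X → (∀ x ∈ X, p x = 0) →
      IsBounded (Subsemigroup.closure X : Set E))
    {X : Set E} (hX : IsBounded X)
    (hpX : IsBounded (Subsemigroup.closure ((2 : ℂ) • (p '' X)) : Set Q)) :
    IsBounded (Subsemigroup.closure X : Set E) := by
  -- The disk `T` contains twice the image of `X`, so that multiplying an element of `T` by one of
  -- `p '' X` lands in half of `T`.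
  obtain ⟨T, hT, hTd, h0, hXT, hTT⟩ := exists_submultiplicative_disk hpX
  set S := p '' X with hS
  have hSb : IsBounded S := p.bounded X hX
  have hST : ∀ q ∈ S, (2 : ℂ) • q ∈ T := fun q hq => hXT (smul_smul_mem hq)
  have hST' : S ⊆ T := fun q hq => by
    have := hTd.smul_mem (hST q hq) (a := 1 / 2) (by norm_num)
    rwa [smul_smul, one_div, inv_mul_cancel₀ (two_ne_zero : (2 : ℂ) ≠ 0), one_smul] at this
  -- the part of `X` in the kernel
  set K := (fun x => x - s (p x)) '' X with hK
  have hKb : IsBounded K := isBoundedMap_sub (l := LinearMap.id) (l' := s.comp p.linear)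
    isBoundedMap_id (isBoundedMap_linear_comp hs p.bounded) X hX
  have hpK : ∀ k ∈ K, p k = 0 := by
    rintro _ ⟨x, hx, rfl⟩
    simp only
    rw [BHom.map_sub, hps, sub_self]
  have hsT : IsBounded (s '' T) := hs T hT
  have hcurv : IsBounded (image2 (fun q t => s (q * t) - s q * s t) S T) := by
    have h1 : IsBounded (s '' (S * T)) := hs _ (BornAlgebra.isBounded_mul _ _ hSb hT)
    have h2 : IsBounded ((s '' S) * (s '' T)) := BornAlgebra.isBounded_mul _ _ (hs S hSb) hsT
    refine (ConvexBornology.isBounded_add _ _ h1 (isBounded_smul h2 (-1))).subset ?_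
    rintro _ ⟨q, hq, t, ht, rfl⟩
    exact ⟨_, ⟨_, mul_mem_mul hq ht, rfl⟩, _,
      smul_smul_mem (mul_mem_mul ⟨q, hq, rfl⟩ ⟨t, ht, rfl⟩), by
        simp only [neg_one_smul, sub_eq_add_neg]⟩
  -- `K₁` collects the kernel elements that occur when `s q + k` is multiplied by `s t`: the part
  -- `k`, the product `k s(t)`, and the failure of `s` to be multiplicative.
  set K₁ := K ∪ K * (s '' T) ∪ image2 (fun q t => s (q * t) - s q * s t) S T with hK₁
  have hK₁b : IsBounded K₁ := (hKb.union (BornAlgebra.isBounded_mul _ _ hKb hsT)).union hcurv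
  have hpK₁ : ∀ k ∈ K₁, p k = 0 := by
    rintro k ((hk | ⟨k, hk, _, ⟨t, -, rfl⟩, rfl⟩) | ⟨q, -, t, -, rfl⟩)
    · exact hpK k hk
    · simp only
      rw [BHom.map_mul, hpK k hk, zero_mul]
    · simp only
      rw [BHom.map_sub, hps, BHom.map_mul, hps, hps, sub_self]
  obtain ⟨W, hW, hWd, hW0, hK₁W, hWW⟩ := exists_submultiplicative_disk
    (isBounded_closure_smul_of_ker p hker hK₁b hpK₁ 4)
  have hmulW : ∀ k ∈ K₁, ∀ w ∈ W, k * w ∈ (1 / 4 : ℂ) • W := by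
    intro k hk w hw
    refine ⟨((4 : ℂ) • k) * w, hWW _ (hK₁W (smul_smul_mem hk)) _ hw, ?_⟩
    simp only
    rw [smul_mul_assoc, smul_smul]
    norm_num
  have hK₁W' : ∀ k ∈ K₁, k ∈ (1 / 4 : ℂ) • W := fun k hk =>
    ⟨(4 : ℂ) • k, hK₁W (smul_smul_mem hk), by simp only [smul_smul]; norm_num⟩
  -- These are the normal forms `s t`, `s t · w` and `w` of products: at most one element from the
  -- quotient, followed by at most one from the kernel. Their hull will be stable under left
  -- multiplication by `X`.
  set G : Set E := (s '' T ∪ (s '' T) * W) ∪ W with hG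
  have hGb : IsBounded G := (hsT.union (BornAlgebra.isBounded_mul _ _ hsT hW)).union hW
  set D := diskHull G with hD
  have hDd : IsDisk D := isDisk_diskHull G
  have hDb : IsBounded D := ConvexBornology.isBounded_diskHull _ hGb
  have sT : ∀ t ∈ T, s t ∈ D := fun t ht => subset_diskHull _ (Or.inl (Or.inl ⟨t, ht, rfl⟩))
  have sTW : ∀ t ∈ T, ∀ w ∈ W, s t * w ∈ D := fun t ht w hw =>
    subset_diskHull _ (Or.inl (Or.inr (mul_mem_mul ⟨t, ht, rfl⟩ hw)))
  have wD : ∀ w ∈ W, w ∈ D := fun w hw => subset_diskHull _ (Or.inr hw)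
  have half : ∀ x, x ∈ (1 / 4 : ℂ) • W → (4 : ℂ) • x ∈ D := by
    rintro _ ⟨w, hw, rfl⟩
    simp only [smul_smul]
    norm_num
    exact wD w hw
  -- The weights are `1/2 + 1/4 + 1/4 = 1`. The factor `2` comes from the choice of `T`, and the
  -- factor `4` from the choice of `W`.
  have comb : ∀ a b c : E, (2 : ℂ) • a ∈ D → (4 : ℂ) • b ∈ D → (4 : ℂ) • c ∈ D →
      a - b + c ∈ D := by
    intro a b c ha hb hc
    have h1 := hDd hb hc (-(1 / 2)) (1 / 2) (by norm_num)
    have h2 := hDd ha h1 (1 / 2) (1 / 2) (by norm_num)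
    convert h2 using 1
    module
  have two : ∀ q ∈ S, ∀ t ∈ T, (2 : ℂ) • (q * t) ∈ T := fun q hq t ht => by
    rw [← smul_mul_assoc]
    exact hTT _ (hST q hq) _ ht
  have decomp : ∀ x ∈ X, ∃ q ∈ S, ∃ k ∈ K, x = s q + k := fun x hx =>
    ⟨p x, ⟨x, hx, rfl⟩, _, ⟨x, hx, rfl⟩, by simp⟩
  have hzero : (4 : ℂ) • (0 : E) ∈ D := by
    rw [smul_zero]
    exact wD 0 hW0
  have hXD : X ⊆ D := by
    intro x hx
    obtain ⟨q, hq, k, hk, rfl⟩ := decomp x hx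
    have := comb (s q) 0 k (by rw [← map_smul]; exact sT _ (hST q hq)) hzero
      (half k (hK₁W' k (Or.inl (Or.inl hk))))
    rwa [sub_zero] at this
  refine hDb.subset (closure_subset_of_mul_mem hXD fun x hx => ?_)
  obtain ⟨q, hq, k, hk, rfl⟩ := decomp x hx
  have hG' : ∀ y ∈ G, (s q + k) * y ∈ D := by
    rintro y ((⟨t, ht, rfl⟩ | ⟨_, ⟨t, ht, rfl⟩, w, hw, rfl⟩) | hw)
    -- Here `(s q + k) s t = s(qt) - (s(qt) - s q s t) + k s t`, whose last two terms lie in a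
    -- quarter of `W`. The next case is the same identity multiplied by `w` on the right.
    · have := comb (s (q * t)) (s (q * t) - s q * s t) (k * s t)
        (by rw [← map_smul]; exact sT _ (two q hq t ht))
        (half _ (hK₁W' _ (Or.inr ⟨q, hq, t, ht, rfl⟩)))
        (half _ (hK₁W' _ (Or.inl (Or.inr (mul_mem_mul hk ⟨t, ht, rfl⟩)))))
      rwa [sub_sub_cancel, ← add_mul] at this
    · have := comb (s (q * t) * w) ((s (q * t) - s q * s t) * w) (k * s t * w)
        (by rw [← smul_mul_assoc, ← map_smul]; exact sTW _ (two q hq t ht) w hw)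
        (half _ (hmulW _ (Or.inr ⟨q, hq, t, ht, rfl⟩) w hw))
        (half _ (hmulW _ (Or.inl (Or.inr (mul_mem_mul hk ⟨t, ht, rfl⟩))) w hw))
      rwa [← sub_mul, sub_sub_cancel, ← add_mul, ← add_mul, mul_assoc] at this
    · have := comb (s q * y) 0 (k * y)
        (by rw [← smul_mul_assoc, ← map_smul]; exact sTW _ (hST q hq) y hw) hzero
        (half _ (hmulW _ (Or.inl (Or.inl hk)) y hw))
      rwa [sub_zero, ← add_mul] at this
  intro y hy
  exact diskHull_subset (hDd.preimage (LinearMap.mulLeft ℂ (s q + k))) hG' hy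

end Extension

/-! ### Lifting in analytically nilpotent extensions -/

section Lifting

/-- A bounded linear map is a homomorphism modulo an analytically nilpotent ideal if its
composition with the quotient map is multiplicative. -/
theorem isLanilcur_of_ker {R : CBAlg.{u}} {E : CBAlg.{v}} {Q : CBAlg.{w}} (p : BHom E Q)
    (hker : ∀ X : Set E, IsBounded X → (∀ x ∈ X, p x = 0) →
      IsBounded (Subsemigroup.closure X : Set E))
    (l : R →ₗ[ℂ] E) (hl : IsBoundedMap l) (hm : ∀ x y, p (l (x * y)) = p (l x) * p (l y)) :
    IsLanilcur l where
  bounded := hl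
  nilpotent S hS := by
    refine hker _ ?_ ?_
    · have h1 : IsBounded (l '' (S * S)) := hl _ (BornAlgebra.isBounded_mul _ _ hS hS)
      have h2 : IsBounded ((l '' S) * (l '' S)) :=
        BornAlgebra.isBounded_mul _ _ (hl S hS) (hl S hS)
      refine (ConvexBornology.isBounded_add _ _ h1 (isBounded_smul h2 (-1))).subset ?_
      rintro _ ⟨x, hx, y, hy, rfl⟩
      exact ⟨_, ⟨_, mul_mem_mul hx hy, rfl⟩, _,
        smul_smul_mem (mul_mem_mul ⟨x, hx, rfl⟩ ⟨y, hy, rfl⟩), by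
          simp only [curvature, neg_one_smul, sub_eq_add_neg]⟩
    · rintro _ ⟨x, -, y, -, rfl⟩
      rw [curvature, BHom.map_sub, hm, BHom.map_mul, sub_self]

/-- The homomorphism `R → 𝒯 R → E` that is induced by a linear map `l : R → E` and a section of
`𝒯 R → R` agrees with `l` modulo ideals for which `l` is a homomorphism. -/
theorem comp_lift_comp_section {R : CBAlg.{u}} {υ : BHom R (Tan R)}
    (hυ : (Tan.τ R).comp υ = .id R) {E : CBAlg.{v}} (l : R →ₗ[ℂ] E) (hl : IsLanilcur l)
    {F : CBAlg.{w}} (p : BHom E F) (g : BHom R F) (h : ∀ x, p (l x) = g x) :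
    p.comp ((Tan.lift l hl).comp υ) = g := by
  -- Both homomorphisms on `Tan R` restrict to `g` on the generators, so the uniqueness part of the
  -- universal property applies. The target map `p` may be a quotient map or an evaluation at an end
  -- point; both uses occur in homotopy lifting.
  have h1 : p.comp (Tan.lift l hl) = g.comp (Tan.τ R) := Tan.hom_ext fun a => by
    rw [BHom.comp_apply, BHom.comp_apply, Tan.lift_σ, Tan.τ_σ, h]
  refine BHom.hom_ext fun x => ?_
  have h2 : p (Tan.lift l hl (υ x)) = g (Tan.τ R (υ x)) :=
    congrArg (fun f : BHom (Tan R) F => f (υ x)) h1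
  have h3 : Tan.τ R (υ x) = x := congrArg (fun f : BHom R R => f x) hυ
  rw [BHom.comp_apply, BHom.comp_apply, h2, h3]

/-- The composite of the linear sections `A → Tan A → Tan (Tan A)` is multiplicative modulo the
kernel of `Tan (Tan A) → A`. Applying `τ` for `Tan A` maps that kernel to the nilpotent kernel of
`τ` for `A`, with fibre the kernel of the first `τ`, so it is nilpotent as well. The universal
property then gives a homomorphism out of `Tan A`, and it is a section because it is one on the
generators `A`. -/
theorem isAQuasiFree_Tan (A : CBAlg.{u}) : IsAQuasiFree (Tan A) := by
  have hl : IsLanilcur ((Tan.σ (Tan A)).comp (Tan.σ A)) := by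
    refine isLanilcur_of_ker ((Tan.τ A).comp (Tan.τ (Tan A))) ?_ _
      (isBoundedMap_linear_comp (Tan.isBoundedMap_σ _) (Tan.isBoundedMap_σ A)) fun x y => ?_
    · intro X hX h0
      refine isBounded_closure_of_extension (Tan.τ (Tan A)) (Tan.σ (Tan A))
        (Tan.isBoundedMap_σ _) (Tan.τ_σ _) (fun X => Tan.isBounded_closure_ker _) hX ?_
      refine isBounded_closure_smul_of_ker (Tan.τ A) (fun X => Tan.isBounded_closure_ker _)
        ((Tan.τ (Tan A)).bounded X hX) ?_ 2
      rintro _ ⟨x, hx, rfl⟩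
      exact h0 x hx
    · simp only [BHom.comp_apply, LinearMap.comp_apply, Tan.τ_σ]
  refine ⟨Tan.lift _ hl, Tan.hom_ext fun a => ?_⟩
  rw [BHom.comp_apply, Tan.lift_σ, LinearMap.comp_apply, Tan.τ_σ]
  rfl

/-- The extension by the analytic tensor algebra is a universal analytically nilpotent
extension. -/
theorem isUniversal_tensorDiagram (A : CBAlg.{u}) : (tensorDiagram A).IsUniversal where
  isExtension :=
    { injective := Subtype.val_injective
      isBounded_of_image := fun _ => (Tan.τ A).isBounded_ker_iff.2
      exact := fun x => ⟨fun h => ⟨⟨x, h⟩, rfl⟩, by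
        rintro ⟨y, rfl⟩
        exact (Tan.τ A).kerIncl_eq_zero y⟩
      surjective := fun a => ⟨Tan.σ A a, Tan.τ_σ A a⟩
      exists_lift := fun S hS => ⟨Tan.σ A '' S, Tan.isBoundedMap_σ A S hS,
        fun a ha => ⟨Tan.σ A a, ⟨a, ha, rfl⟩, Tan.τ_σ A a⟩⟩ }
  isAllowable := ⟨Tan.σ A, Tan.isBoundedMap_σ A, Tan.τ_σ A⟩
  isANilpotent := isANilpotent_Jan A
  isAQuasiFree := isAQuasiFree_Tan A

namespace Diagram

variable {Q : CBAlg.{w}} {Y : Diagram.{u, v, w} Q}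

/-- Since `K` carries the subspace bornology of the kernel, its nilpotency can be transported to
small subsets of the middle algebra. The lifting lemmas use nilpotency in this form. -/
theorem IsANilpotentExtension.isBounded_closure_ker (hY : Y.IsANilpotentExtension) {X : Set Y.E}
    (hX : IsBounded X) (h0 : ∀ x ∈ X, Y.p x = 0) :
    IsBounded (Subsemigroup.closure X : Set Y.E) := by
  have h1 : Y.i '' (Y.i ⁻¹' X) = X := image_preimage_eq_of_subset fun x hx =>
    (hY.isExtension.exact x).1 (h0 x hx)
  have h2 : IsBounded (Y.i ⁻¹' X) := hY.isExtension.isBounded_of_image _ (by rwa [h1])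
  have h3 := Y.i.bounded _ (hY.isANilpotent _ h2)
  refine h3.subset ?_
  have h4 := Y.i.closure_image_subset (Y.i ⁻¹' X)
  rwa [h1] at h4

/-- A homomorphism of the middle terms that is compatible with the quotient maps restricts to the
kernels. -/
theorem IsExtension.exists_hom (hY : Y.IsExtension) {Q' : CBAlg.{w₁}} {X : Diagram.{u₁, v₁, w₁} Q'}
    (hX : ∀ x, X.p (X.i x) = 0) (ψ : BHom X.E Y.E) (φ : BHom Q' Q)
    (h : φ.comp X.p = Y.p.comp ψ) : ∃ f : Hom X Y, f.ψ = ψ ∧ f.φ = φ := by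
  have hex : ∀ x : X.K, ∃ y : Y.K, Y.i y = ψ (X.i x) := fun x => by
    refine (hY.exact _).1 ?_
    have h1 : φ (X.p (X.i x)) = Y.p (ψ (X.i x)) :=
      congrArg (fun f : BHom X.E Q => f (X.i x)) h
    rw [← h1, hX, BHom.map_zero]
  choose r hr using hex
  refine ⟨⟨BHom.ofLinear ⟨⟨r, fun x y => hY.injective ?_⟩, fun c x => hY.injective ?_⟩ ?_
    fun x y => hY.injective ?_, ψ, φ, BHom.hom_ext fun x => (hr x).symm, h⟩, rfl, rfl⟩
  · rw [BHom.map_add, hr, hr, hr, BHom.map_add, BHom.map_add]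
  · rw [RingHom.id_apply, BHom.map_smul, hr, hr, BHom.map_smul, BHom.map_smul]
  · intro S hS
    refine hY.isBounded_of_image _ ?_
    have e : Y.i '' (r '' S) = (ψ.comp X.i) '' S := by
      rw [image_image]
      exact image_congr fun x _ => hr x
    change IsBounded (Y.i '' (r '' S))
    rw [e]
    exact (ψ.comp X.i).bounded S hS
  · change Y.i (r (x * y)) = Y.i (r x * r y)
    rw [BHom.map_mul, hr, hr, hr, BHom.map_mul, BHom.map_mul]

end Diagram

end Lifting

end BornologicalAlgebra
-- Path algebras: stability of a-nilpotent extensions under completed tensor products.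
namespace BornologicalAlgebra

/-! ### Locally multiplicative algebras -/

section LocallyMultiplicative

/-- Algebras in which each small set is absorbed by a set with small multiplicative closure. -/
def IsLocallyMultiplicative (C : Type*) [NonUnitalRing C] [Module ℂ C] [Bornology C] : Prop :=
  ∀ S : Set C, IsBounded S → ∃ r : ℂ, r ≠ 0 ∧ IsBounded (Subsemigroup.closure (r • S) : Set C)

theorem IsLocallyMultiplicative.completion {C : Type*} [NonUnitalRing C] [Module ℂ C] [Bornology C]
    [BornAlgebra C] (hC : IsLocallyMultiplicative C) : IsLocallyMultiplicative (Completion C) := by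
  intro X hX
  obtain ⟨S, hS, -, hXS⟩ := Completion.exists_disk hX
  obtain ⟨r, hr, h⟩ := hC S hS
  refine ⟨r, hr, Completion.isBounded_closure h ?_⟩
  rintro _ ⟨x, hx, rfl⟩
  obtain ⟨z, hz, rfl⟩ := hXS hx
  have hb : IsBoundedMap (LinearMap.lsmul ℂ C r) := fun T hT => isBounded_smul hT r
  exact ⟨r • z, CauchySeqs.map_mem_cauchyBall hb hz, map_smul (Completion.mk C) r z⟩

/-- A scalar can be moved across the tensor sign: `S ⊗ T = rS ⊗ r⁻¹T`. Choose `r` so that `rS` has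
small multiplicative closure; nilpotency of `K` then accepts the rescaled set `r⁻¹T`. So `C` only
has to be locally multiplicative, not nilpotent. -/
theorem isANilpotent_completion_tensor {C : Type u} [NonUnitalRing C] [Module ℂ C] [Bornology C]
    [BornAlgebra C] (hC : IsLocallyMultiplicative C) {K : CBAlg.{v}} (hK : IsANilpotent K) :
    IsANilpotent (CBAlg.completion (C ⊗[ℂ] K)) := by
  intro X hX
  obtain ⟨S, hS, -, hXS⟩ := Completion.exists_disk (V := C ⊗[ℂ] K) hX
  obtain ⟨S₁, T₁, hS₁, hT₁, hST⟩ := exists_tmul_diskHull hS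
  obtain ⟨r, hr, h⟩ := hC S₁ hS₁
  obtain ⟨D, hD, -, -, hSD, hDD⟩ := exists_submultiplicative_disk h
  obtain ⟨D', hD', -, -, hSD', hDD'⟩ :=
    exists_submultiplicative_disk (hK _ (isBounded_smul hT₁ r⁻¹))
  refine Completion.isBounded_closure (A := C ⊗[ℂ] K) ?_ hXS
  refine isBounded_closure_of_subset (ConvexBornology.isBounded_diskHull _
    (isBounded_tmul hD hD')) (hST.trans (diskHull_mono ?_))
    (mul_mem_of_diskHull (isDisk_diskHull _) ?_)
  · rintro _ ⟨s, hs, t, ht, rfl⟩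
    refine ⟨r • s, hSD (smul_smul_mem hs), r⁻¹ • t, hSD' (smul_smul_mem ht), ?_⟩
    simp only [TensorProduct.smul_tmul, smul_smul, mul_inv_cancel₀ hr, one_smul]
  · rintro _ ⟨s, hs, t, ht, rfl⟩ _ ⟨s', hs', t', ht', rfl⟩
    refine subset_diskHull _ ⟨s * s', hDD _ hs _ hs', t * t', hDD' _ ht _ ht', ?_⟩
    simp only [Algebra.TensorProduct.tmul_mul_tmul]

end LocallyMultiplicative

/-! ### Extensions of path algebras -/

namespace PathAlg

section Functor

variable (P : PathAlg) {A : CBAlg.{u}} {B : CBAlg.{v}} {C : CBAlg.{w}}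

/-- The canonical map from the algebraic tensor product to `P ⊗̂ B`. -/
noncomputable def of (B : CBAlg.{v}) : P ⊗[ℂ] B →ₗ[ℂ] P.paths B := CBAlg.of (P ⊗[ℂ] B)

theorem isBoundedMap_of : IsBoundedMap (P.of B) := CBAlg.isBoundedMap_of (A := P ⊗[ℂ] B)

/-- The elementary tensors in `P ⊗̂ B`. -/
noncomputable def tmul (B : CBAlg.{v}) (c : P) : B →ₗ[ℂ] P.paths B :=
  (P.of B).comp (TensorProduct.mk ℂ P B c)

theorem isBoundedMap_tmul (c : P) : IsBoundedMap (P.tmul B c) := by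
  refine isBoundedMap_linear_comp P.isBoundedMap_of fun S hS => ?_
  refine (isBounded_tmul (isBounded_singleton (x := c)) hS).subset ?_
  rintro _ ⟨x, hx, rfl⟩
  exact ⟨c, rfl, x, hx, rfl⟩

theorem tmul_mul (c c' : P) (x y : B) :
    P.tmul B c x * P.tmul B c' y = P.tmul B (c * c') (x * y) :=
  (CBAlg.of_mul (A := P ⊗[ℂ] B) _ _).symm.trans
    (congrArg (CBAlg.of (P ⊗[ℂ] B)) (Algebra.TensorProduct.tmul_mul_tmul c c' x y))

theorem linearMap_ext {W : Type*} [AddCommGroup W] [Module ℂ W] [Bornology W] [ConvexBornology W]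
    [CompleteBornology W] {f g : P.paths B →ₗ[ℂ] W} (hf : IsBoundedMap f) (hg : IsBoundedMap g)
    (h : ∀ c x, f (P.tmul B c x) = g (P.tmul B c x)) : f = g := by
  refine CBAlg.linearMap_ext (A := P ⊗[ℂ] B) (f := f) (g := g) hf hg fun z => ?_
  have : f.comp (CBAlg.of (P ⊗[ℂ] B)) = g.comp (CBAlg.of (P ⊗[ℂ] B)) := TensorProduct.ext' h
  exact LinearMap.congr_fun this z

theorem isBoundedMap_lTensor_linear (l : A →ₗ[ℂ] B) (hl : IsBoundedMap l) :
    IsBoundedMap (l.lTensor P) := by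
  intro S hS
  refine isBounded_image_generated _ ?_ hS
  rintro _ ⟨S, T, hS, hT, rfl⟩
  refine (isBounded_tmul hS (hl T hT)).subset ?_
  rintro _ ⟨_, ⟨x, hx, y, hy, rfl⟩, rfl⟩
  exact ⟨x, hx, l y, ⟨y, hy, rfl⟩, rfl⟩

/-- The map `id ⊗̂ l` for a bounded linear map `l`. -/
noncomputable def mapLinear (l : A →ₗ[ℂ] B) (hl : IsBoundedMap l) : P.paths A →ₗ[ℂ] P.paths B :=
  CBAlg.mapLinear (l.lTensor P) (P.isBoundedMap_lTensor_linear l hl)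

theorem isBoundedMap_mapLinear (l : A →ₗ[ℂ] B) (hl : IsBoundedMap l) :
    IsBoundedMap (P.mapLinear l hl) := CBAlg.isBoundedMap_mapLinear _ _

theorem mapLinear_tmul (l : A →ₗ[ℂ] B) (hl : IsBoundedMap l) (c : P) (x : A) :
    P.mapLinear l hl (P.tmul A c x) = P.tmul B c (l x) :=
  (CBAlg.mapLinear_of (A := P ⊗[ℂ] A) (B := P ⊗[ℂ] B) _ _ _).trans
    (congrArg (CBAlg.of (P ⊗[ℂ] B)) (LinearMap.lTensor_tmul _ _ _ _))

theorem map_tmul (f : BHom A B) (c : P) (x : A) :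
    (P.map f).linear (P.tmul A c x) = P.tmul B c (f x) :=
  (CBAlg.completionMap_of (A := P ⊗[ℂ] A) (B := P ⊗[ℂ] B) _ (P.isBoundedMap_lTensor f)
    (P.lTensor_mul f) _).trans
    (congrArg (CBAlg.of (P ⊗[ℂ] B)) (LinearMap.lTensor_tmul _ _ _ _))

theorem eval_tmul (t : unitInterval) (c : P) (x : B) :
    (P.eval B t).linear (P.tmul B c x) = P.ev t c • x :=
  (CBAlg.completionLift_of (A := P ⊗[ℂ] B) _ (P.isBoundedMap_evLin B t) (P.evLin_mul B t) _).trans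
    (by simp [evLin])

theorem eval_map (f : BHom A B) (t : unitInterval) (x : P.paths A) :
    P.eval B t (P.map f x) = f (P.eval A t x) := by
  refine LinearMap.congr_fun (P.linearMap_ext
    (f := (P.eval B t).linear.comp (P.map f).linear) (g := f.linear.comp (P.eval A t).linear)
    (isBoundedMap_linear_comp (P.eval B t).bounded (P.map f).bounded)
    (isBoundedMap_linear_comp f.bounded (P.eval A t).bounded) fun c x => ?_) x
  rw [LinearMap.comp_apply, LinearMap.comp_apply, map_tmul, eval_tmul, eval_tmul, _root_.map_smul]
  rfl

theorem eval_mapLinear (l : A →ₗ[ℂ] B) (hl : IsBoundedMap l) (t : unitInterval) (x : P.paths A) :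
    P.eval B t (P.mapLinear l hl x) = l (P.eval A t x) := by
  refine LinearMap.congr_fun (P.linearMap_ext
    (f := (P.eval B t).linear.comp (P.mapLinear l hl)) (g := l.comp (P.eval A t).linear)
    (isBoundedMap_linear_comp (P.eval B t).bounded (P.isBoundedMap_mapLinear l hl))
    (isBoundedMap_linear_comp hl (P.eval A t).bounded) fun c x => ?_) x
  rw [LinearMap.comp_apply, LinearMap.comp_apply, mapLinear_tmul, eval_tmul, eval_tmul,
    _root_.map_smul]

/-- The composite `m` is a separate argument, so that relations such as `p ∘ s = id` or `p ∘ i = 0`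
can be used directly for rewriting. -/
theorem map_mapLinear (f : BHom B C) (l : A →ₗ[ℂ] B) (hl : IsBoundedMap l) (m : A →ₗ[ℂ] C)
    (hm : IsBoundedMap m) (h : ∀ x, f (l x) = m x) (x : P.paths A) :
    P.map f (P.mapLinear l hl x) = P.mapLinear m hm x := by
  refine LinearMap.congr_fun (P.linearMap_ext
    (f := (P.map f).linear.comp (P.mapLinear l hl)) (g := P.mapLinear m hm)
    (isBoundedMap_linear_comp (P.map f).bounded (P.isBoundedMap_mapLinear l hl))
    (P.isBoundedMap_mapLinear m hm) fun c x => ?_) x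
  rw [LinearMap.comp_apply, mapLinear_tmul, mapLinear_tmul, map_tmul, h]

theorem mapLinear_map (f : BHom A B) (l : B →ₗ[ℂ] C) (hl : IsBoundedMap l) (m : A →ₗ[ℂ] C)
    (hm : IsBoundedMap m) (h : ∀ x, l (f x) = m x) (x : P.paths A) :
    P.mapLinear l hl (P.map f x) = P.mapLinear m hm x := by
  refine LinearMap.congr_fun (P.linearMap_ext
    (f := (P.mapLinear l hl).comp (P.map f).linear) (g := P.mapLinear m hm)
    (isBoundedMap_linear_comp (P.isBoundedMap_mapLinear l hl) (P.map f).bounded)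
    (P.isBoundedMap_mapLinear m hm) fun c x => ?_) x
  rw [LinearMap.comp_apply, mapLinear_tmul, map_tmul, mapLinear_tmul, h]

theorem mapLinear_id (x : P.paths A) : P.mapLinear (LinearMap.id) isBoundedMap_id x = x := by
  refine LinearMap.congr_fun (P.linearMap_ext
    (f := P.mapLinear (LinearMap.id : A →ₗ[ℂ] A) isBoundedMap_id) (g := LinearMap.id)
    (P.isBoundedMap_mapLinear _ _) isBoundedMap_id fun c x => ?_) x
  rw [mapLinear_tmul, LinearMap.id_apply, LinearMap.id_apply]

theorem mapLinear_zero (x : P.paths A) (h0 : IsBoundedMap (0 : A →ₗ[ℂ] B)) :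
    P.mapLinear (0 : A →ₗ[ℂ] B) h0 x = 0 := by
  have hz : IsBoundedMap (0 : P.paths A →ₗ[ℂ] P.paths B) := (BHom.zero _ _).bounded
  refine LinearMap.congr_fun (P.linearMap_ext
    (f := P.mapLinear (0 : A →ₗ[ℂ] B) h0) (g := 0)
    (P.isBoundedMap_mapLinear _ _) hz fun c x => ?_) x
  rw [mapLinear_tmul, LinearMap.zero_apply, LinearMap.zero_apply, _root_.map_zero]

theorem mapLinear_add (l m : A →ₗ[ℂ] B) (hl : IsBoundedMap l) (hm : IsBoundedMap m)
    (x : P.paths A) : P.mapLinear (l + m) (isBoundedMap_add hl hm) x =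
      P.mapLinear l hl x + P.mapLinear m hm x := by
  refine LinearMap.congr_fun (P.linearMap_ext
    (f := P.mapLinear (l + m) (isBoundedMap_add hl hm)) (g := P.mapLinear l hl + P.mapLinear m hm)
    (P.isBoundedMap_mapLinear _ _)
    (isBoundedMap_add (P.isBoundedMap_mapLinear _ _) (P.isBoundedMap_mapLinear _ _)) fun c x => ?_) x
  rw [LinearMap.add_apply, mapLinear_tmul, mapLinear_tmul, mapLinear_tmul, LinearMap.add_apply,
    _root_.map_add]

end Functor

section Diagram

variable {P : PathAlg} {Q : CBAlg.{w}} {Y : Diagram.{u, v, w} Q}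

/-- A bounded linear section of an extension yields a bounded linear retraction to the kernel. -/
theorem exists_retraction (hY : Y.IsExtension) (s : Q →ₗ[ℂ] Y.E) (hs : IsBoundedMap s)
    (hps : ∀ q, Y.p (s q) = q) :
    ∃ r : Y.E →ₗ[ℂ] Y.K, IsBoundedMap r ∧ ∀ x, Y.i (r x) = x - s (Y.p x) := by
  have hex : ∀ x : Y.E, ∃ y : Y.K, Y.i y = x - s (Y.p x) := fun x => by
    refine (hY.exact _).1 ?_
    rw [BHom.map_sub, hps, sub_self]
  choose r hr using hex
  refine ⟨⟨⟨r, fun x y => hY.injective ?_⟩, fun c x => hY.injective ?_⟩, ?_, hr⟩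
  · rw [BHom.map_add, hr, hr, hr, BHom.map_add, map_add]
    abel
  · rw [RingHom.id_apply, BHom.map_smul, hr, hr, BHom.map_smul, map_smul, smul_sub]
  · intro S hS
    refine hY.isBounded_of_image _ ?_
    change IsBounded (Y.i '' (r '' S))
    rw [image_image]
    have := isBoundedMap_sub (l := LinearMap.id) (l' := s.comp Y.p.linear)
      isBoundedMap_id (isBoundedMap_linear_comp hs Y.p.bounded) S hS
    convert this using 1
    exact image_congr fun x _ => hr x

/-- A linearly split extension is encoded by the identities `r i = 1`, `p s = 1`, `p i = 0` and `i r
+ s p = 1`. Any additive functor preserves these, so no exactness property of the completed tensor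
product is needed. The kernel stays nilpotent by `isANilpotent_completion_tensor`. -/
theorem isANilpotentExtension_diagram (hP : IsLocallyMultiplicative P)
    (hY : Y.IsANilpotentExtension) : (P.diagram Y).IsANilpotentExtension := by
  obtain ⟨s, hs, hps⟩ := hY.isAllowable
  obtain ⟨r, hr, hir⟩ := exists_retraction hY.isExtension s hs hps
  have hpi : ∀ x, Y.p (Y.i x) = 0 := fun x => (hY.isExtension.exact _).2 ⟨x, rfl⟩
  have hri : ∀ x, r (Y.i x) = x := fun x => hY.isExtension.injective (by
    rw [hir, hpi, map_zero, sub_zero])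
  have h1 : ∀ x : P.paths Y.K, P.mapLinear r hr (P.map Y.i x) = x := fun x => by
    rw [P.mapLinear_map Y.i r hr LinearMap.id isBoundedMap_id hri, P.mapLinear_id]
  have h2 : ∀ x : P.paths Q, P.map Y.p (P.mapLinear s hs x) = x := fun x => by
    rw [P.map_mapLinear Y.p s hs LinearMap.id isBoundedMap_id hps, P.mapLinear_id]
  have h3 : ∀ x : P.paths Y.K, P.map Y.p (P.map Y.i x) = 0 := fun x => by
    have h0 : IsBoundedMap (0 : Y.K →ₗ[ℂ] Q) := (BHom.zero _ _).bounded
    have hb : IsBoundedMap Y.i.linear := Y.i.bounded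
    -- The homomorphism `map` and the linear map `mapLinear` are constructed separately; inserting
    -- the identity map identifies them.
    have e : P.map Y.i x = P.mapLinear Y.i.linear hb x := by
      conv_lhs => rw [← P.mapLinear_id x]
      exact P.map_mapLinear Y.i LinearMap.id isBoundedMap_id Y.i.linear hb (fun _ => rfl) x
    rw [e, P.map_mapLinear Y.p Y.i.linear hb 0 h0 hpi, P.mapLinear_zero]
  have h4 : ∀ x : P.paths Y.E,
      P.map Y.i (P.mapLinear r hr x) + P.mapLinear s hs (P.map Y.p x) = x := fun x => by
    have hb1 : IsBoundedMap (Y.i.linear.comp r) := isBoundedMap_linear_comp Y.i.bounded hr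
    have hb2 : IsBoundedMap (s.comp Y.p.linear) := isBoundedMap_linear_comp hs Y.p.bounded
    rw [P.map_mapLinear Y.i r hr _ hb1 (fun _ => rfl), P.mapLinear_map Y.p s hs _ hb2 (fun _ => rfl),
      ← P.mapLinear_add]
    have e : Y.i.linear.comp r + s.comp Y.p.linear = LinearMap.id := LinearMap.ext fun x => by
      change Y.i (r x) + s (Y.p x) = x
      rw [hir, sub_add_cancel]
    simp only [e]
    exact P.mapLinear_id x
  exact
    { isExtension :=
        { injective := Function.LeftInverse.injective (g := P.mapLinear r hr) h1
          isBounded_of_image := fun (S : Set (P.paths Y.K)) (hS : IsBounded (P.map Y.i '' S)) => by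
            have := P.isBoundedMap_mapLinear r hr _ hS
            rwa [image_image, image_congr (g := fun x => x) fun x _ => h1 x, image_id'] at this
          exact := fun x => ⟨fun h => ⟨P.mapLinear r hr x, by
              have h5 := h4 x
              have h6 : P.map Y.p x = 0 := h
              rw [h6, map_zero, add_zero] at h5
              exact h5⟩, by
            rintro ⟨y, rfl⟩
            exact h3 y⟩
          surjective := fun x => ⟨_, h2 x⟩
          exists_lift := fun S hS => ⟨_, P.isBoundedMap_mapLinear s hs S hS, fun x hx =>
            ⟨_, ⟨x, hx, rfl⟩, h2 x⟩⟩ }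
      isAllowable := ⟨P.mapLinear s hs, P.isBoundedMap_mapLinear s hs, h2⟩
      isANilpotent := isANilpotent_completion_tensor hP hY.isANilpotent }

end Diagram

/-- Path algebras for which homotopies can be lifted: they are locally multiplicative, contain a
unit, and contain functions that separate the end points. -/
structure IsAdmissible (P : PathAlg) : Prop where
  locallyMultiplicative : IsLocallyMultiplicative P
  exists_unit : ∃ e : P, e * e = e ∧ ∀ t, P.ev t e = 1
  exists_left : ∃ c : P, P.ev 0 c = 1 ∧ P.ev 1 c = 0
  exists_right : ∃ c : P, P.ev 0 c = 0 ∧ P.ev 1 c = 1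

end PathAlg

/-! ### Smooth and absolutely continuous functions -/

namespace SmoothFun

/-- Bounds for the derivatives of products that are stable under multiplication by functions whose
derivatives are bounded by `c`. -/
noncomputable def derivBound (c : ℕ → ℝ) (r : ℝ) : ℕ → ℝ
  | k => c k + ∑ j : Fin k, 2 * r * ((k.choose (k - j) : ℝ) * c (k - j) * derivBound c r j)

theorem derivBound_eq (c : ℕ → ℝ) (r : ℝ) (k : ℕ) : derivBound c r k =
    c k + ∑ j : Fin k, 2 * r * ((k.choose (k - j) : ℝ) * c (k - j) * derivBound c r j) := by
  rw [derivBound]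

theorem le_derivBound {c : ℕ → ℝ} (hc : ∀ k, 0 ≤ c k) {r : ℝ} (hr : 0 ≤ r) (k : ℕ) :
    c k ≤ derivBound c r k := by
  induction k using Nat.strong_induction_on with
  | _ k ih =>
    rw [derivBound_eq]
    refine le_add_of_nonneg_right (Finset.sum_nonneg fun j _ => ?_)
    have := (hc j).trans (ih j j.2)
    have := hc (k - j)
    positivity

/-- Write `M k` for the bounds. The top term `r c₀ M k` is at most half of `M k` by the choice of
`r`. The remaining terms are half of the recursive sum in the definition of `M k`, so they
contribute at most the other half. -/
theorem sum_derivBound_le {c : ℕ → ℝ} (hc : ∀ k, 0 ≤ c k) {r : ℝ} (hr : 0 ≤ r)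
    (hrc : 2 * r * c 0 ≤ 1) (k : ℕ) :
    r * ∑ i ∈ Finset.range (k + 1), (k.choose i : ℝ) * c i * derivBound c r (k - i) ≤
      derivBound c r k := by
  have h1 : ∑ i ∈ Finset.range (k + 1), (k.choose i : ℝ) * c i * derivBound c r (k - i) =
      ∑ j ∈ Finset.range (k + 1), (k.choose (k - j) : ℝ) * c (k - j) * derivBound c r j := by
    rw [← Finset.sum_range_reflect]
    refine Finset.sum_congr rfl fun j hj => ?_
    have : j ≤ k := Nat.lt_succ_iff.1 (Finset.mem_range.1 hj)
    rw [show k + 1 - 1 - j = k - j by omega, show k - (k - j) = j by omega]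
  have h2 := derivBound_eq c r k
  rw [Fin.sum_univ_eq_sum_range
    (fun j => 2 * r * ((k.choose (k - j) : ℝ) * c (k - j) * derivBound c r j)),
    ← Finset.mul_sum] at h2
  have h3 := (hc k).trans (le_derivBound hc hr k)
  have h4 := hc k
  rw [h1, Finset.sum_range_succ, Nat.sub_self, Nat.choose_zero_right, Nat.cast_one, one_mul]
  nlinarith [mul_le_mul_of_nonneg_right hrc h3]

/-- The scaling factor depends only on a bound for the functions themselves, not on their
derivatives. In the Leibniz rule only the undifferentiated factor multiplies the derivative of
highest order; all other terms involve lower derivatives and are absorbed by the recursive bounds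
`derivBound`. -/
theorem isLocallyMultiplicative : IsLocallyMultiplicative SmoothFun := by
  intro S hS
  choose c hc using isBounded_iff.1 hS
  set c' : ℕ → ℝ := fun k => max (c k) 0 with hc'
  have hc0 : ∀ k, 0 ≤ c' k := fun k => le_max_right _ _
  -- Adding `1` keeps the denominator positive and gives both `2 r c₀ ≤ 1` for the recursion and `r
  -- ≤ 1` for the generators.
  set r : ℝ := 1 / (2 * (c' 0 + 1)) with hr
  have hpos : 0 < c' 0 + 1 := by linarith [hc0 0]
  have hr0 : 0 < r := by positivity
  have hrc : 2 * r * c' 0 ≤ 1 := by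
    rw [hr, mul_one_div, div_mul_eq_mul_div, div_le_one (by positivity)]
    linarith
  have hr1 : r ≤ 1 := by
    rw [hr, div_le_one (by positivity)]
    linarith [hc0 0]
  refine ⟨r, by exact_mod_cast hr0.ne', ?_⟩
  have hD : ∀ f ∈ S, ∀ k t, ‖D k t f‖ ≤ c' k := fun f hf k t =>
    (hc k f hf t).trans (le_max_left _ _)
  have hb : IsBounded {f : SmoothFun | ∀ k t, ‖D k t f‖ ≤ derivBound c' r k} :=
    isBounded_iff.2 fun k => ⟨_, fun f hf t => hf k t⟩
  refine hb.subset (closure_subset_of_mul_mem ?_ ?_)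
  · rintro _ ⟨f, hf, rfl⟩ k t
    simp only [map_smul, norm_smul, Complex.norm_real, Real.norm_of_nonneg hr0.le]
    have h1 := hD f hf k t
    have h2 := le_derivBound hc0 hr0.le k
    nlinarith [norm_nonneg (D k t f)]
  · rintro _ ⟨f, hf, rfl⟩ g hg k t
    have e : (r : ℂ) • f * g = (r : ℂ) • (f * g) := smul_mul_assoc _ _ _
    simp only [e, map_smul, norm_smul, Complex.norm_real, Real.norm_of_nonneg hr0.le]
    refine le_trans (mul_le_mul_of_nonneg_left ((norm_D_mul_le k t f g).trans
      (Finset.sum_le_sum fun i _ => ?_)) hr0.le) (sum_derivBound_le hc0 hr0.le hrc k)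
    have h1 := hD f hf i t
    have h2 := hg (k - i) t
    have h3 := hc0 i
    gcongr

/-- The coordinate function. -/
noncomputable def coord : SmoothFun := ⟨fun t => ((t : ℝ) : ℂ), by
  have h : ContDiffOn ℝ ⊤ (fun x : ℝ => (x : ℂ)) (Icc 0 1) :=
    Complex.ofRealCLM.contDiff.contDiffOn
  refine (h.of_le le_top).congr fun x hx => ?_
  rw [IccExtend_of_mem _ _ hx]⟩

end SmoothFun

theorem isAdmissible_smoothPaths : smoothPaths.IsAdmissible where
  locallyMultiplicative := SmoothFun.isLocallyMultiplicative
  exists_unit := ⟨(1 : SmoothFun), mul_one (1 : SmoothFun), fun _ => rfl⟩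
  exists_left := ⟨(1 - SmoothFun.coord : SmoothFun), by
    change (1 : ℂ) - ((0 : ℝ) : ℂ) = 1
    simp, by
    change (1 : ℂ) - ((1 : ℝ) : ℂ) = 0
    simp⟩
  exists_right := ⟨SmoothFun.coord, by
    change ((0 : ℝ) : ℂ) = 0
    simp, by
    change ((1 : ℝ) : ℂ) = 1
    simp⟩

/-- The norm is submultiplicative up to a factor `2`, so the ball of radius `1/2` is closed under
multiplication, and every bounded set can be scaled into it. -/
theorem ACFun.isLocallyMultiplicative : IsLocallyMultiplicative ACFun := by
  intro S hS
  obtain ⟨c, hc⟩ := ACFun.isBounded_iff.1 hS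
  have hpos : 0 < 2 * (|c| + 1) := by positivity
  refine ⟨((2 * (|c| + 1) : ℝ) : ℂ)⁻¹, inv_ne_zero (by exact_mod_cast hpos.ne'), ?_⟩
  have hb : IsBounded {f : ACFun | ACFun.acNorm f ≤ 1 / 2} :=
    ACFun.isBounded_iff.2 ⟨1 / 2, fun f hf => hf⟩
  refine isBounded_closure_of_subset hb ?_ fun f hf g hg => ?_
  · rintro _ ⟨f, hf, rfl⟩
    have h1 := hc f hf
    have h2 := le_abs_self c
    simp only [mem_ofPred_eq, map_smul_eq_mul, norm_inv, Complex.norm_real,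
      Real.norm_of_nonneg hpos.le]
    rw [inv_mul_le_iff₀ hpos]
    linarith
  · have h1 : ACFun.acNorm f ≤ 1 / 2 := hf
    have h2 : ACFun.acNorm g ≤ 1 / 2 := hg
    have h3 := ACFun.acNorm_mul_le f g
    have h4 := apply_nonneg ACFun.acNorm f
    change ACFun.acNorm (f * g) ≤ 1 / 2
    nlinarith [mul_le_mul h1 h2 (apply_nonneg ACFun.acNorm g) (by norm_num)]

theorem isAdmissible_acPaths : acPaths.IsAdmissible := by
  have key : ∀ (t : unitInterval) (f : ACFun),
      acPaths.ev t (Completion.of (V := ACFun) f) = (ACFun.val f).1 t := fun t f =>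
    Completion.lift_of (ACFun.ev t) (ACFun.isBoundedMap_ev t) f
  exact
    { locallyMultiplicative := ACFun.isLocallyMultiplicative.completion
      exists_unit := ⟨Completion.of (V := ACFun) 1,
        (Completion.of_mul (1 : ACFun) 1).symm.trans (by rw [mul_one]), fun t => key t 1⟩
      exists_left := ⟨Completion.of (V := ACFun) (1 - SmoothFun.coord : SmoothFun), by
        refine (key 0 _).trans ?_
        change (1 : ℂ) - ((0 : ℝ) : ℂ) = 1
        simp, by
        refine (key 1 _).trans ?_
        change (1 : ℂ) - ((1 : ℝ) : ℂ) = 0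
        simp⟩
      exists_right := ⟨Completion.of (V := ACFun) (SmoothFun.coord : SmoothFun), by
        refine (key 0 _).trans ?_
        change ((0 : ℝ) : ℂ) = 0
        simp, by
        refine (key 1 _).trans ?_
        change ((1 : ℝ) : ℂ) = 1
        simp⟩ }

end BornologicalAlgebra
-- Lifting of morphisms and homotopies, and the theorem.
namespace BornologicalAlgebra

/-! ### The lifting theorems -/

namespace PathAlg

variable (P : PathAlg)

/-- The constant homotopy. -/
noncomputable def const (A : CBAlg.{u}) {e : P} (he : e * e = e) : BHom A (P.paths A) :=
  .ofLinear (P.tmul A e) (P.isBoundedMap_tmul e) fun x y => by rw [P.tmul_mul, he]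

theorem eval_const (A : CBAlg.{u}) {e : P} (he : e * e = e) (h1 : ∀ t, P.ev t e = 1)
    (t : unitInterval) : (P.eval A t).comp (P.const A he) = .id A := BHom.hom_ext fun x =>
  (P.eval_tmul t e x).trans (by rw [h1, one_smul]; rfl)

end PathAlg

namespace Diagram

variable {A : CBAlg.{w₁}} {X : Diagram.{u₁, v₁, w₁} A} {Q : CBAlg.{w₂}} {Y : Diagram.{u₂, v₂, w₂} Q}

theorem IsExtension.p_i (hX : X.IsExtension) (x : X.K) : X.p (X.i x) = 0 :=
  (hX.exact _).2 ⟨x, rfl⟩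

theorem Hom.φ_p (f : Hom X Y) (x : X.E) : f.φ (X.p x) = Y.p (f.ψ x) :=
  congrArg (fun h : BHom X.E Q => h x) f.comm_p

theorem Hom.ψ_i (f : Hom X Y) (x : X.K) : f.ψ (X.i x) = Y.i (f.ξ x) :=
  congrArg (fun h : BHom X.K Y.E => h x) f.comm_i

/-- Homomorphisms lift to morphisms from universal to analytically nilpotent extensions. -/
theorem IsUniversal.exists_hom (hX : X.IsUniversal) (hY : Y.IsANilpotentExtension)
    (φ : BHom A Q) : ∃ f : Hom X Y, f.φ = φ := by
  obtain ⟨s, hs, hps⟩ := hY.isAllowable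
  obtain ⟨υ, hυ⟩ := hX.isAQuasiFree
  -- The map `s ∘ φ ∘ p` becomes the homomorphism `φ ∘ p` in `Q`, so its curvature lies in the
  -- a-nilpotent kernel of `Y.p`.
  have hl : IsLanilcur (s.comp (φ.comp X.p).linear) :=
    isLanilcur_of_ker Y.p (fun _ => hY.isBounded_closure_ker) _
      (isBoundedMap_linear_comp hs (φ.comp X.p).bounded) fun x y => by
        simp only [LinearMap.comp_apply, hps, BHom.linear_apply, BHom.map_mul]
  obtain ⟨f, -, hf⟩ := hY.isExtension.exists_hom hX.isExtension.p_i
    ((Tan.lift _ hl).comp υ) φ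
    (comp_lift_comp_section hυ _ hl Y.p (φ.comp X.p) fun x => hps _).symm
  exact ⟨f, hf⟩

/-- Homotopies lift to homotopies of morphisms from universal to analytically nilpotent
extensions, with prescribed end points. -/
theorem IsUniversal.exists_homotopy {P : PathAlg} (hP : P.IsAdmissible) (hX : X.IsUniversal)
    (hY : Y.IsANilpotentExtension) (f g : Hom X Y) (Φ : BHom A (P.paths Q))
    (h0 : (P.eval Q 0).comp Φ = f.φ) (h1 : (P.eval Q 1).comp Φ = g.φ) :
    ∃ H : Hom X (P.diagram Y), H.φ = Φ ∧ H.EvaluatesTo 0 f ∧ H.EvaluatesTo 1 g := by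
  have hPY := PathAlg.isANilpotentExtension_diagram hP.locallyMultiplicative hY
  obtain ⟨s, hs, hps⟩ := hY.isAllowable
  obtain ⟨υ, hυ⟩ := hX.isAQuasiFree
  obtain ⟨c₀, hc₀, hc₀'⟩ := hP.exists_left
  obtain ⟨c₁, hc₁, hc₁'⟩ := hP.exists_right
  -- corrections at the end points
  have hd : ∀ f : Hom X Y, IsBoundedMap (f.ψ.linear - s.comp (f.φ.comp X.p).linear) := fun f =>
    isBoundedMap_sub f.ψ.bounded (isBoundedMap_linear_comp hs (f.φ.comp X.p).bounded)
  have hpd : ∀ (f : Hom X Y) (x : X.E),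
      Y.p ((f.ψ.linear - s.comp (f.φ.comp X.p).linear) x) = 0 := fun f x => by
    change Y.p (f.ψ x - s (f.φ (X.p x))) = 0
    rw [BHom.map_sub, hps, f.φ_p, sub_self]
  -- The first term lifts `Φ ∘ p`, but with end values `s φ p` instead of the prescribed
  -- homomorphisms. The differences `ψ - s φ p` take values in the kernel, so adding them with
  -- weights `c₀` and `c₁` corrects the ends without changing the image in `P ⊗̂ Q`.
  let l : X.E →ₗ[ℂ] P.paths Y.E := (P.mapLinear s hs).comp (Φ.comp X.p).linear +
    ((P.tmul Y.E c₀).comp (f.ψ.linear - s.comp (f.φ.comp X.p).linear) +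
      (P.tmul Y.E c₁).comp (g.ψ.linear - s.comp (g.φ.comp X.p).linear))
  have hlb : IsBoundedMap l := isBoundedMap_add
    (isBoundedMap_linear_comp (P.isBoundedMap_mapLinear s hs) (Φ.comp X.p).bounded)
    (isBoundedMap_add (isBoundedMap_linear_comp (P.isBoundedMap_tmul c₀) (hd f))
      (isBoundedMap_linear_comp (P.isBoundedMap_tmul c₁) (hd g)))
  have hl_apply : ∀ x, l x = P.mapLinear s hs (Φ (X.p x)) +
      (P.tmul Y.E c₀ ((f.ψ.linear - s.comp (f.φ.comp X.p).linear) x) +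
        P.tmul Y.E c₁ ((g.ψ.linear - s.comp (g.φ.comp X.p).linear) x)) := fun x => rfl
  have hpl : ∀ x, P.map Y.p (l x) = Φ (X.p x) := fun x => by
    have e1 : P.map Y.p (P.mapLinear s hs (Φ (X.p x))) = Φ (X.p x) := by
      rw [P.map_mapLinear Y.p s hs LinearMap.id isBoundedMap_id hps, P.mapLinear_id]
    have e2 : ∀ (f : Hom X Y) (c : P),
        P.map Y.p (P.tmul Y.E c ((f.ψ.linear - s.comp (f.φ.comp X.p).linear) x)) = 0 :=
      fun f c => (P.map_tmul Y.p c _).trans (by rw [hpd, map_zero])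
    rw [hl_apply, BHom.map_add, BHom.map_add, e1, e2, e2, add_zero, add_zero]
  have hev : ∀ t x, P.eval Y.E t (l x) = s (P.eval Q t (Φ (X.p x))) +
      (P.ev t c₀ • (f.ψ x - s (f.φ (X.p x))) + P.ev t c₁ • (g.ψ x - s (g.φ (X.p x)))) :=
    fun t x => by
      have e2 : ∀ (f : Hom X Y) (c : P),
          P.eval Y.E t (P.tmul Y.E c ((f.ψ.linear - s.comp (f.φ.comp X.p).linear) x)) =
            P.ev t c • (f.ψ x - s (f.φ (X.p x))) := fun f c => P.eval_tmul t c _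
      rw [hl_apply, BHom.map_add, BHom.map_add, P.eval_mapLinear, e2, e2]
  -- Multiplicativity modulo the kernel follows because `l` lifts the homomorphism `Φ ∘ p`;
  -- nilpotency of the kernel is that of the extension tensored with `P`.
  have hl : IsLanilcur l := isLanilcur_of_ker (P.map Y.p)
    (fun _ => hPY.isBounded_closure_ker) l hlb fun x y => by
      rw [hpl, hpl, hpl, BHom.map_mul, BHom.map_mul]
  obtain ⟨H, hψ, hφ⟩ := hPY.isExtension.exists_hom hX.isExtension.p_i
    ((Tan.lift l hl).comp υ) Φ
    (comp_lift_comp_section hυ l hl (P.map Y.p) (Φ.comp X.p) hpl).symm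
  -- evaluation is determined by the middle and right components
  have ends : ∀ (t : unitInterval) (f : Hom X Y), (P.eval Q t).comp Φ = f.φ →
      (∀ x, P.eval Y.E t (l x) = f.ψ x) → H.EvaluatesTo t f := by
    intro t f h h'
    have e : (P.eval Y.E t).comp H.ψ = f.ψ := by
      rw [hψ]
      exact comp_lift_comp_section hυ l hl (P.eval Y.E t) f.ψ h'
    refine ⟨BHom.hom_ext fun x => hY.isExtension.injective ?_, e, by rw [hφ, h]⟩
    let ξ : BHom X.K (P.paths Y.K) := H.ξ
    let ψ : BHom X.E (P.paths Y.E) := H.ψ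
    have a1 : P.map Y.i (ξ x) = ψ (X.i x) := (H.ψ_i x).symm
    have a2 : P.eval Y.E t (ψ (X.i x)) = f.ψ (X.i x) :=
      congrArg (fun h : BHom X.E Y.E => h (X.i x)) e
    exact (P.eval_map Y.i t (ξ x)).symm.trans
      ((congrArg (P.eval Y.E t) a1).trans (a2.trans (f.ψ_i x)))
  have h0' : ∀ a, P.eval Q 0 (Φ a) = f.φ a := fun a => congrArg (fun h : BHom A Q => h a) h0
  have h1' : ∀ a, P.eval Q 1 (Φ a) = g.φ a := fun a => congrArg (fun h : BHom A Q => h a) h1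
  refine ⟨H, hφ, ends 0 f h0 fun x => ?_, ends 1 g h1 fun x => ?_⟩
  · rw [hev, hc₀, hc₁, h0', one_smul, zero_smul, add_zero, add_sub_cancel]
  · rw [hev, hc₀', hc₁', h1', one_smul, zero_smul, zero_add, add_sub_cancel]

/-- Two lifts of the same `φ` are joined by lifting the constant homotopy `a ↦ e ⊗ φ(a)`. It is
multiplicative since `e` is idempotent, and its evaluations are all `φ` since `e` takes the value
`1` everywhere. -/
theorem IsUniversal.homotopicRel {P : PathAlg} (hP : P.IsAdmissible) (hX : X.IsUniversal)
    (hY : Y.IsANilpotentExtension) {φ : BHom A Q} {f g : Hom X Y} (hf : f.φ = φ) (hg : g.φ = φ) :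
    Hom.HomotopicRel P φ f g := by
  obtain ⟨e, he, he1⟩ := hP.exists_unit
  have h : ∀ t, (P.eval Q t).comp ((P.const Q he).comp φ) = φ := fun t =>
    congrArg (fun h : BHom Q Q => h.comp φ) (P.eval_const Q he he1 t)
  obtain ⟨H, hφ, h0, h1⟩ := hX.exists_homotopy hP hY f g ((P.const Q he).comp φ)
    ((h 0).trans hf.symm) ((h 1).trans hg.symm)
  exact ⟨H, h0, h1, fun t => by rw [hφ, h]⟩

/-- The usual uniqueness argument for universal objects: the identity of `A` lifts to some morphism
back, and both composites lift the identity, as do the identity morphisms, so they are homotopic. -/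
theorem IsUniversal.isHomotopyEquivalenceRel {P : PathAlg} (hP : P.IsAdmissible)
    {Y : Diagram.{u₂, v₂, w₁} A} (hX : X.IsUniversal) (hY : Y.IsUniversal) {f : Hom X Y}
    (hf : f.φ = .id A) : f.IsHomotopyEquivalenceRel P := by
  obtain ⟨g, hg⟩ := hY.exists_hom hX.toIsANilpotentExtension (.id A)
  refine ⟨hf, g, hg, hX.homotopicRel hP hX.toIsANilpotentExtension ?_ rfl,
    hY.homotopicRel hP hY.toIsANilpotentExtension ?_ rfl⟩
  · change g.φ.comp f.φ = _
    rw [hf, hg]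
    rfl
  · change f.φ.comp g.φ = _
    rw [hf, hg]
    rfl

theorem Hom.IsHomotopyEquivalenceRel.homotopyEquivalent {P : PathAlg}
    {Y : Diagram.{u₂, v₂, w₁} A} {f : Hom X Y} (hf : f.IsHomotopyEquivalenceRel P) :
    CBAlg.HomotopyEquivalent P X.E Y.E ∧ CBAlg.HomotopyEquivalent P X.K Y.K := by
  obtain ⟨-, g, -, ⟨H, h0, h1, -⟩, ⟨H', h0', h1', -⟩⟩ := hf
  exact ⟨⟨f.ψ, g.ψ, ⟨H.ψ, h0.2.1, h1.2.1⟩, ⟨H'.ψ, h0'.2.1, h1'.2.1⟩⟩,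
    ⟨f.ξ, g.ξ, ⟨H.ξ, h0.1, h1.1⟩, ⟨H'.ξ, h0'.1, h1'.1⟩⟩⟩

end Diagram

end BornologicalAlgebra

theorem mainTheorem4 (A : CBAlg.{u}) :
    -- the extension by the analytic tensor algebra is universal
    (tensorDiagram A).IsUniversal ∧
    -- it is the only universal a-nilpotent extension, up to smooth homotopy equivalence rel `A`
    (∀ X : Diagram.{u₁, v₁, u} A, X.IsUniversal →
      (∃ f : Diagram.Hom X (tensorDiagram A), f.IsHomotopyEquivalenceRel smoothPaths) ∧
      CBAlg.HomotopyEquivalent smoothPaths X.E (Tan A) ∧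
      CBAlg.HomotopyEquivalent smoothPaths X.K (Jan A)) ∧
    -- morphisms `(ξ, ψ, id)` between universal a-nilpotent extensions of `A`
    (∀ (X : Diagram.{u₁, v₁, u} A) (Y : Diagram.{u₂, v₂, u} A), X.IsUniversal → Y.IsUniversal →
      (∀ f : Diagram.Hom X Y, f.φ = .id A → f.IsHomotopyEquivalenceRel smoothPaths) ∧
      (∀ f g : Diagram.Hom X Y, f.φ = .id A → g.φ = .id A →
        Diagram.Hom.HomotopicRel smoothPaths (.id A) f g)) ∧
    -- the lifting property against all a-nilpotent extensions
    (∀ (X : Diagram.{u₁, v₁, u} A) (Q : CBAlg.{w}) (Y : Diagram.{u₂, v₂, w} Q),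
      X.IsUniversal → Y.IsANilpotentExtension →
      (∀ φ : BHom A Q,
        (∃ f : Diagram.Hom X Y, f.φ = φ) ∧
        ∀ f g : Diagram.Hom X Y, f.φ = φ → g.φ = φ →
          Diagram.Hom.HomotopicRel smoothPaths φ f g ∧ Diagram.Hom.HomotopicRel acPaths φ f g) ∧
      (∀ P : PathAlg, P = smoothPaths ∨ P = acPaths →
        ∀ (f g : Diagram.Hom X Y) (Φ : BHom A (P.paths Q)),
          (P.eval Q 0).comp Φ = f.φ → (P.eval Q 1).comp Φ = g.φ →
          ∃ H : Diagram.Hom X (P.diagram Y),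
            H.φ = Φ ∧ H.EvaluatesTo 0 f ∧ H.EvaluatesTo 1 g)) := by
  have hT := isUniversal_tensorDiagram A
  refine ⟨hT, fun X hX => ?_, fun X Y hX hY => ⟨fun f hf => ?_, fun f g hf hg => ?_⟩,
    fun X Q Y hX hY => ⟨fun φ => ⟨hX.exists_hom hY φ, fun f g hf hg => ⟨?_, ?_⟩⟩, ?_⟩⟩
  · obtain ⟨f, hf⟩ := hX.exists_hom hT.toIsANilpotentExtension (.id A)
    have h := hX.isHomotopyEquivalenceRel isAdmissible_smoothPaths hT hf
    exact ⟨⟨f, h⟩, h.homotopyEquivalent⟩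
  · exact hX.isHomotopyEquivalenceRel isAdmissible_smoothPaths hY hf
  · exact hX.homotopicRel isAdmissible_smoothPaths hY.toIsANilpotentExtension hf hg
  · exact hX.homotopicRel isAdmissible_smoothPaths hY hf hg
  · exact hX.homotopicRel isAdmissible_acPaths hY hf hg
  · rintro P (rfl | rfl) f g Φ h0 h1
    · exact hX.exists_homotopy isAdmissible_smoothPaths hY f g Φ h0 h1
    · exact hX.exists_homotopy isAdmissible_acPaths hY f g Φ h0 h1
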